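/- **Conventions.** Let $G$ be a diffeological group (a group with a diffeology for which multiplication and inversion are smooth). Subsets, products, quotients and sets of smooth maps carry the subspace, product, quotient and functional diffeologies. A smooth path in a diffeological space $Y$ is a smooth map $\alpha : \mathrm{dom}(\alpha) \to Y$ on an open interval $\mathrm{dom}(\alpha) \subseteq \mathbb R$. The set $\mathcal PY$ of these paths carries the functional diffeology: $r \mapsto \psi_r$ is a plot if for all $r_0$ and $s_0 \in \mathrm{dom}(\psi_{r_0})$ there are open neighbourhoods $V \ni r_0$, $W \ni s_0$ with $W \subseteq \mathrm{dom}(\psi_r)$ for $r \in V$ and $(r,s) \mapsto \psi_r(s)$ smooth on $V \times W$. Put $\hat{\mathcal P}Y = \{(\alpha,t) \in \mathcal PY \times \mathbb R : t \in \mathrm{dom}(\alpha)\}$. The space $Y$ is path-connected if any two of its points lie on a common smooth path. **Path classes.** Let $\mathcal F(X)$ be the quotient of the space of smooth maps $\alpha : [0,1] \to X$ that are constant near $0$ and near $1$ by the smallest equivalence relation that is compatible with concatenation ($\beta \vee \alpha$ means first $\alpha$, then $\beta$) and identifies $\alpha \circ f$ with $\alpha$ for every smooth $f : [0,1] \to [0,1]$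 with $f(0) = 0$, $f(1) = 1$, and $\beta \vee \eta \vee \eta^{\leftarrow} \vee \alpha$ with $\beta \vee \alpha$, where $\eta^{\leftarrow}(t) = \eta(1-t)$. For an arbitrary smooth $\alpha : [0,1] \to X$ let $[\alpha]$ be the class of $\alpha \circ b$, where $b : [0,1] \to [0,1]$ is smooth, $b = 0$ near $0$ and $b = 1$ near $1$. Let $\mathcal F_{x_0}(X)$ consist of the classes of paths starting at $x_0$, and let $\Omega_{x_0}(X)$ be the group, under $\vee$, of the classes of loops at $x_0$. **Bundles and connections.** A diffeological principal $G$-bundle is a smooth surjection $\pi : E \to X$ with a smooth right action of $G$ on $E$ such that $E \times G \to E \times E$, $(\xi,g) \mapsto (\xi, \xi g)$, is a diffeomorphism onto its image and there is a diffeomorphism $\Phi : X \to E/G$ with $\Phi(\pi(\xi)) = \xi G$. A connection on it is a smooth map $A : \hat{\mathcal P}E \to \mathcal PE$, $(\alpha,t) \mapsto A_t\alpha$, such that 1. $\mathrm{dom}(A_t\alpha) = \mathrm{dom}(\alpha)$; 2. $\pi \circ A_t\alpha = \pi \circ \alpha$; 3. $A_t\alpha(t) = \alpha(t)$; 4. $A_t(\alpha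 \cdot \rho) = A_t\alpha \cdot \rho(t)$ for every smooth $\rho : \mathrm{dom}(\alpha) \to G$; 5. $A_t(\alpha \circ f) = A_{f(t)}\alpha \circ f$ for every smooth path $f$ in $\mathrm{dom}(\alpha)$; 6. $A_t(A_t\alpha) = A_t\alpha$; 7. if $A_t\alpha = \alpha$ for some $t \in \mathrm{dom}(\alpha)$, then $A_s\alpha = \alpha$ for all $s \in \mathrm{dom}(\alpha)$; such a path $\alpha$ is called horizontal. **Categories.** Objects of $\mathbf{Hol}^G$ are triples $(X, x_0, H)$ of a path-connected diffeological space $X$, a point $x_0 \in X$ and a smooth group homomorphism $H : \Omega_{x_0}(X) \to G$; morphisms $(X,x_0,H) \to (X',x_0',H')$ are smooth maps $f : X \to X'$ with $f(x_0) = x_0'$ and $H'([f \circ \gamma]) = H([\gamma])$ for all $[\gamma] \in \Omega_{x_0}(X)$. Objects of $\mathbf{Bun}^G$ are pairs of a diffeological principal $G$-bundle $\pi : (E,\xi_0) \to (X,x_0)$ with $X$ path-connected and $\pi(\xi_0) = x_0$, and a connection $A$ on it; morphisms are pairs $(F,f)$ of smooth maps $F : E \to E'$, $f : X \to X'$ with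 $\pi' \circ F = f \circ \pi$, $F(\xi g) = F(\xi) g$, $F(\xi_0) = \xi_0'$, $f(x_0) = x_0'$ and $F \circ A_t\alpha = A'_t(F \circ \alpha)$. **Theorem.** (a) For every object $(X,x_0,H)$ of $\mathbf{Hol}^G$ let $\mathcal F_{x_0}(X) \times_H G$ be the quotient of $\mathcal F_{x_0}(X) \times G$ by $([\alpha], g) \sim ([\alpha \vee \gamma], H([\gamma])^{-1} g)$, $[\gamma] \in \Omega_{x_0}(X)$, with projection $\tau_H([\![[\alpha], g]\!]) = \alpha(1)$, action $[\![[\alpha], g]\!] h = [\![[\alpha], gh]\!]$ and base point $[\![[x_0], e]\!]$, where $[x_0]$ is the class of the constant path. This is a diffeological principal $G$-bundle over $X$, and $$\Theta^H_r c\,(s) = [\![[(\tau_H \circ c)^{r \to s} \vee \beta],\, g]\!] \quad \text{if } c(r) = [\![[\beta], g]\!],\qquad \alpha^{r \to s}(t) = \alpha(ts + (1-t)r),$$ defines a connection $\Theta^H$ on it. With $f \mapsto \big([\![[\alpha], g]\!] \mapsto [\![[f \circ \alpha], g]\!],\ f\big)$ on morphisms this gives a functor $\Phi : \mathbf{Hol}^G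 \to \mathbf{Bun}^G$. (b) For every object $(\pi : (E,\xi_0) \to (X,x_0), A)$ of $\mathbf{Bun}^G$ there is a smooth group homomorphism $H^A_{\xi_0} : \Omega_{x_0}(X) \to G$, the holonomy representation, such that for every smooth path $\gamma$ with $0,1 \in \mathrm{dom}(\gamma)$ and $\gamma(0) = x_0 = \gamma(1)$ there is a horizontal path $\bar\gamma$ with $\pi \circ \bar\gamma = \gamma$ and $\bar\gamma(0) = \xi_0$, and every such $\bar\gamma$ satisfies $\bar\gamma(1) = \xi_0 \cdot H^A_{\xi_0}([\gamma|_{[0,1]}])$. The assignments $(\pi, A) \mapsto (X, x_0, H^A_{\xi_0})$ and $(F,f) \mapsto f$ define a functor $\Psi : \mathbf{Bun}^G \to \mathbf{Hol}^G$. (c) $\Phi$ and $\Psi$ are mutually inverse equivalences of categories $\mathbf{Hol}^G \rightleftarrows \mathbf{Bun}^G$. -/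

import Mathlib

open Diffeology CategoryTheory
open scoped ContDiff Topology

universe u

noncomputable section

namespace DiffHol

/-! ### Constructions with diffeological spaces -/

section Constructions

variable {X Y Z : Type*} [DiffeologicalSpace X] [DiffeologicalSpace Y] [DiffeologicalSpace Z]

/-- The subspace diffeology. -/
instance instSubtype (P : X → Prop) : DiffeologicalSpace (Subtype P) where
  plots n := {p | IsPlot (fun r => (p r : X))}
  constant_plots _ := isPlot_const
  plot_reparam hp hf := isPlot_reparam hp hf
  locality hp := DiffeologicalSpace.locality hp

/-- The product diffeology. -/
instance instProd : DiffeologicalSpace (X × Y) where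
  plots n := {p | IsPlot (fun r => (p r).1) ∧ IsPlot (fun r => (p r).2)}
  constant_plots _ := ⟨isPlot_const, isPlot_const⟩
  plot_reparam hp hf := ⟨isPlot_reparam hp.1 hf, isPlot_reparam hp.2 hf⟩
  locality hp := by
    refine ⟨DiffeologicalSpace.locality fun x => ?_, DiffeologicalSpace.locality fun x => ?_⟩
    · obtain ⟨u, hu, hx, h⟩ := hp x
      exact ⟨u, hu, hx, fun hf hf' => (h hf hf').1⟩
    · obtain ⟨u, hu, hx, h⟩ := hp x
      exact ⟨u, hu, hx, fun hf hf' => (h hf hf').2⟩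

theorem dSmooth_subtype_val {P : X → Prop} : DSmooth (Subtype.val : Subtype P → X) :=
  fun _ _ hp => hp

theorem dSmooth_subtype_mk {P : Y → Prop} {f : X → Y} (hf : DSmooth f) (h : ∀ x, P (f x)) :
    DSmooth (fun x => (⟨f x, h x⟩ : Subtype P)) :=
  fun n p hp => hf n p hp

theorem dSmooth_fst : DSmooth (Prod.fst : X × Y → X) := fun _ _ hp => hp.1

theorem dSmooth_snd : DSmooth (Prod.snd : X × Y → Y) := fun _ _ hp => hp.2

theorem dSmooth_prodMk {f : X → Y} {g : X → Z} (hf : DSmooth f) (hg : DSmooth g) :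
    DSmooth (fun x => (f x, g x)) :=
  fun n p hp => ⟨hf n p hp, hg n p hp⟩

/-- A smooth map into a neighbourhood of a point that is the identity near the point. -/
theorem exists_localizer {n : ℕ} {u : Set (EuclideanSpace ℝ (Fin n))} (hu : IsOpen u)
    {x : EuclideanSpace ℝ (Fin n)} (hx : x ∈ u) :
    ∃ (f : EuclideanSpace ℝ (Fin n) → EuclideanSpace ℝ (Fin n))
      (v : Set (EuclideanSpace ℝ (Fin n))), ContDiff ℝ ∞ f ∧ (∀ y, f y ∈ u) ∧ IsOpen v ∧ x ∈ v ∧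
        ∀ y ∈ v, f y = y := by
  obtain ⟨ε, hε, hb⟩ := Metric.isOpen_iff.1 hu x hx
  let b : ContDiffBump x := ⟨ε / 2, ε, by positivity, by linarith⟩
  refine ⟨fun y => x + b y • (y - x), Metric.ball x (ε / 2), ?_, ?_, Metric.isOpen_ball,
    Metric.mem_ball_self (by positivity), ?_⟩
  · exact contDiff_const.add (b.contDiff.smul (contDiff_id.sub contDiff_const))
  · intro y
    apply hb
    by_cases hy : dist y x < ε
    · rw [Metric.mem_ball, dist_eq_norm, add_sub_cancel_left, norm_smul]
      rw [dist_eq_norm] at hy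
      calc ‖b y‖ * ‖y - x‖ ≤ 1 * ‖y - x‖ := by
            gcongr
            rw [Real.norm_eq_abs, abs_of_nonneg b.nonneg]
            exact b.le_one
        _ < ε := by linarith
    · have h0 : b y = 0 := b.zero_of_le_dist (not_lt.1 hy)
      simp [h0, hε]
  · intro y hy
    have h1 : b y = 1 := b.one_of_mem_closedBall (Metric.ball_subset_closedBall hy)
    simp [h1]

/-- The quotient diffeology on the quotient of `X` by the equivalence relation generated by `R`:
plots are the maps that locally lift to plots of `X`. -/
instance instQuot (R : X → X → Prop) : DiffeologicalSpace (Quot R) where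
  plots n := {p | ∀ r₀, ∃ V : Set (EuclideanSpace ℝ (Fin n)), IsOpen V ∧ r₀ ∈ V ∧
    ∃ q : V → X, DSmooth q ∧ ∀ r : V, Quot.mk R (q r) = p r}
  constant_plots c := by
    obtain ⟨x, rfl⟩ := Quot.exists_rep c
    exact fun r₀ => ⟨Set.univ, isOpen_univ, trivial, fun _ => x, dSmooth_const, fun _ => rfl⟩
  plot_reparam {n m p f} hp hf := by
    intro r₀
    obtain ⟨V, hV, hr, q, hq, h⟩ := hp (f r₀)
    exact ⟨f ⁻¹' V, hV.preimage hf.continuous, hr, fun r => q ⟨f r, r.2⟩,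
      hq.comp (dSmooth_subtype_mk (hf.dSmooth.comp dSmooth_subtype_val) fun r => r.2),
      fun r => h ⟨f r, r.2⟩⟩
  locality {n p} hp := by
    intro r₀
    obtain ⟨u, hu, hru, h⟩ := hp r₀
    obtain ⟨f, v, hf, hfu, hv, hrv, hfv⟩ := exists_localizer hu hru
    obtain ⟨V, hV, hr, q, hq, hqp⟩ := h hfu hf r₀
    refine ⟨V ∩ v, hV.inter hv, ⟨hr, hrv⟩, fun r => q ⟨r, r.2.1⟩,
      hq.comp (dSmooth_subtype_mk dSmooth_subtype_val fun r => r.2.1), fun r => ?_⟩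
    rw [hqp ⟨r, r.2.1⟩, Function.comp_apply, hfv _ r.2.2]

theorem dSmooth_quotMk (R : X → X → Prop) : DSmooth (Quot.mk R) :=
  fun _ p hp _ => ⟨Set.univ, isOpen_univ, trivial, fun r => p r,
    (IsPlot.dSmooth hp).comp dSmooth_subtype_val, fun _ => rfl⟩

/-- Being smooth on the quotient can be tested upstairs. -/
theorem dSmooth_of_comp_quotMk {R : X → X → Prop} {f : Quot R → Y}
    (hf : DSmooth (fun x => f (Quot.mk R x))) : DSmooth f := by
  intro n p hp
  refine DiffeologicalSpace.locality fun r₀ => ?_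
  obtain ⟨V, hV, hr, q, hq, h⟩ := hp r₀
  refine ⟨V, hV, hr, fun {m g} hg hg' => ?_⟩
  have h1 : DSmooth (fun r => f (Quot.mk R (q ⟨g r, hg r⟩))) :=
    hf.comp (hq.comp (dSmooth_subtype_mk hg'.dSmooth hg))
  have h2 : (f ∘ p) ∘ g = fun r => f (Quot.mk R (q ⟨g r, hg r⟩)) := by
    funext r
    rw [h ⟨g r, hg r⟩]
    rfl
  rw [h2]
  exact h1.isPlot

/-- The set of smooth maps from `Y` to `Z`. -/
structure SmoothMap (Y Z : Type*) [DiffeologicalSpace Y] [DiffeologicalSpace Z] where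
  toFun : Y → Z
  smooth : DSmooth toFun

instance : CoeFun (SmoothMap Y Z) (fun _ => Y → Z) := ⟨SmoothMap.toFun⟩

/-- The functional diffeology on the set of smooth maps. -/
instance instSmoothMap : DiffeologicalSpace (SmoothMap Y Z) where
  plots n := {ψ | DSmooth (fun q : EuclideanSpace ℝ (Fin n) × Y => ψ q.1 q.2)}
  constant_plots f := f.smooth.comp dSmooth_snd
  plot_reparam {_ _ _ _} hp hf :=
    DSmooth.comp hp (dSmooth_prodMk (hf.dSmooth.comp dSmooth_fst) dSmooth_snd)
  locality {n ψ} hp := by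
    intro m ab hab
    have ha : ContDiff ℝ ∞ (fun x => (ab x).1) := IsPlot.contDiff hab.1
    refine DiffeologicalSpace.locality fun x => ?_
    obtain ⟨u, hu, hx, h⟩ := hp (ab x).1
    refine ⟨(fun x => (ab x).1) ⁻¹' u, hu.preimage ha.continuous, hx, fun {k f} hf hf' => ?_⟩
    have h1 := h (f := fun y => (ab (f y)).1) hf (ha.comp hf')
    exact h1 k (fun y => (y, (ab (f y)).2)) ⟨isPlot_id, isPlot_reparam hab.2 hf'⟩

end Constructions

/-- A diffeological group: multiplication and inversion are smooth. -/
class DiffeologicalGroup (G : Type*) [Group G] [DiffeologicalSpace G] : Prop where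
  smooth_mul : DSmooth (fun p : G × G => p.1 * p.2)
  smooth_inv : DSmooth (fun g : G => g⁻¹)

/-! ### Smooth paths on open intervals -/

section LocalPath

variable {X Y : Type*} [DiffeologicalSpace X] [DiffeologicalSpace Y]

/-- The elements of the path space `𝒫 Y`: smooth maps from an open interval of the real line
to `Y`. -/
structure LocalPath (Y : Type*) [DiffeologicalSpace Y] where
  dom : Set ℝ
  isOpen_dom : IsOpen dom
  ordConnected_dom : dom.OrdConnected
  toFun : dom → Y
  smooth : DSmooth toFun

instance : CoeFun (LocalPath Y) (fun α => α.dom → Y) := ⟨LocalPath.toFun⟩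

/-- The path space with the (restriction of the) functional diffeology of a diffeology. -/
instance instLocalPath : DiffeologicalSpace (LocalPath Y) where
  plots n := {ψ | ∀ (r₀ : EuclideanSpace ℝ (Fin n)) (s₀ : (ψ r₀).dom),
    ∃ (V : Set (EuclideanSpace ℝ (Fin n))) (W : Set ℝ),
      IsOpen V ∧ IsOpen W ∧ r₀ ∈ V ∧ (s₀ : ℝ) ∈ W ∧
      ∃ h : ∀ r ∈ V, W ⊆ (ψ r).dom,
        DSmooth (fun q : V × W => (ψ q.1) ⟨q.2, h q.1 q.1.2 q.2.2⟩)}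
  constant_plots α r₀ s₀ := ⟨Set.univ, α.dom, isOpen_univ, α.isOpen_dom, trivial, s₀.2,
    fun _ _ => subset_rfl, α.smooth.comp dSmooth_snd⟩
  plot_reparam {n m ψ f} hp hf := by
    intro r₀ s₀
    obtain ⟨V, W, hV, hW, hr, hs, h, hsm⟩ := hp (f r₀) s₀
    exact ⟨f ⁻¹' V, W, hV.preimage hf.continuous, hW, hr, hs, fun r hr => h (f r) hr,
      hsm.comp (dSmooth_prodMk
        (dSmooth_subtype_mk (hf.dSmooth.comp (dSmooth_subtype_val.comp dSmooth_fst))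
          fun q : (f ⁻¹' V) × W => q.1.2) dSmooth_snd)⟩
  locality {n ψ} hp := by
    intro r₀ s₀
    obtain ⟨u, hu, hru, h⟩ := hp r₀
    obtain ⟨f, v, hf, hfu, hv, hrv, hfv⟩ := exists_localizer hu hru
    have hf0 : f r₀ = r₀ := hfv _ hrv
    obtain ⟨V, W, hV, hW, hr, hs, hd, hsm⟩ := h hfu hf r₀
      ⟨s₀, by rw [Function.comp_apply, hf0]; exact s₀.2⟩
    have hd' : ∀ r ∈ V ∩ v, W ⊆ (ψ r).dom := by
      intro r hr
      have := hd r hr.1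
      rwa [Function.comp_apply, hfv r hr.2] at this
    refine ⟨V ∩ v, W, hV.inter hv, hW, ⟨hr, hrv⟩, hs, hd', ?_⟩
    have key := hsm.comp (dSmooth_prodMk
        (dSmooth_subtype_mk (dSmooth_subtype_val.comp dSmooth_fst)
          fun q : ↑(V ∩ v) × W => q.1.2.1) dSmooth_snd)
    have aux : ∀ (a b : EuclideanSpace ℝ (Fin n)) (s : ℝ) (ha : s ∈ (ψ a).dom)
        (hb : s ∈ (ψ b).dom), a = b → (ψ a) ⟨s, ha⟩ = (ψ b) ⟨s, hb⟩ := by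
      rintro a b s ha hb rfl
      rfl
    convert key using 1
    funext q
    exact aux _ _ _ _ _ (hfv _ q.1.2.2).symm

/-- The initialized path space, with the subspace diffeology from `𝒫 Y × ℝ`. -/
abbrev InitPath (Y : Type*) [DiffeologicalSpace Y] : Type _ :=
  {p : LocalPath Y × ℝ // p.2 ∈ p.1.dom}

namespace LocalPath

/-- A path in another space with the same domain as `α`. -/
abbrev withFun (α : LocalPath X) (f : α.dom → Y) (hf : DSmooth f) : LocalPath Y where
  dom := α.dom
  isOpen_dom := α.isOpen_dom
  ordConnected_dom := α.ordConnected_dom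
  toFun := f
  smooth := hf

/-- The composite `F ∘ α`. -/
abbrev map (α : LocalPath X) (F : X → Y) (hF : DSmooth F) : LocalPath Y :=
  α.withFun (fun s => F (α s)) (hF.comp α.smooth)

/-- The reparameterized path `α ∘ f`, for a smooth path `f` in the domain of `α`. -/
abbrev reparam (α : LocalPath X) (f : LocalPath α.dom) : LocalPath X :=
  f.map α.toFun α.smooth

end LocalPath

variable (X) in
/-- Any two points lie on a common smooth path. -/
def IsDPathConnected : Prop :=
  ∀ x y : X, ∃ (α : LocalPath X) (s t : α.dom), α s = x ∧ α t = y

end LocalPath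

/-! ### Path classes modulo reparameterization and retracing -/

section Paths

variable {X Y : Type*} [DiffeologicalSpace X] [DiffeologicalSpace Y]

/-- Smooth paths `[0,1] → X` that are constant near `0` and constant near `1`. They carry the
subspace diffeology of the functional diffeology. -/
abbrev SitPath (X : Type*) [DiffeologicalSpace X] : Type _ :=
  {α : SmoothMap unitInterval X // ∃ ε : ℝ, 0 < ε ∧ ∀ t : unitInterval,
    ((t : ℝ) < ε → α t = α 0) ∧ (1 - ε < (t : ℝ) → α t = α 1)}

instance : CoeFun (SitPath X) (fun _ => unitInterval → X) := ⟨fun α => α.1.toFun⟩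

/-- The retraction of the real line onto `[0,1]`. -/
abbrev clamp (t : ℝ) : unitInterval := Set.projIcc (0 : ℝ) 1 zero_le_one t

theorem coe_clamp {t : ℝ} (h0 : 0 ≤ t) (h1 : t ≤ 1) : ((clamp t : unitInterval) : ℝ) = t := by
  change ((Set.projIcc (0 : ℝ) 1 zero_le_one t : unitInterval) : ℝ) = t
  rw [Set.projIcc_of_mem zero_le_one ⟨h0, h1⟩]

theorem clamp_zero : clamp 0 = 0 := Set.projIcc_left zero_le_one

theorem clamp_one : clamp 1 = 1 := Set.projIcc_right zero_le_one

theorem SitPath.ext' {α β : SitPath X} (h : ∀ t, α t = β t) : α = β := by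
  obtain ⟨⟨f, hf⟩, hs⟩ := α
  obtain ⟨⟨g, hg⟩, ht⟩ := β
  obtain rfl : f = g := funext h
  rfl

/-- First `α` (on `[0,1/2]`), then `β` (on `[1/2,1]`). -/
def concatFun (β α : unitInterval → X) (t : unitInterval) : X :=
  if (t : ℝ) < 1 / 2 then α (clamp (2 * t)) else β (clamp (2 * t - 1))

theorem isPlot_unitInterval {n : ℕ} {f : EuclideanSpace ℝ (Fin n) → ℝ} (hf : ContDiff ℝ ∞ f)
    (h : ∀ x, f x ∈ unitInterval) : IsPlot (fun x => clamp (f x)) := by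
  have : (fun x => ((clamp (f x) : unitInterval) : ℝ)) = f :=
    funext fun x => coe_clamp (h x).1 (h x).2
  change IsPlot (fun x => ((clamp (f x) : unitInterval) : ℝ))
  rw [this]
  exact hf.isPlot

theorem concatFun_smooth (β α : SitPath X) (h : α 1 = β 0) :
    DSmooth (concatFun β.1.toFun α.1.toFun) := by
  intro n p hp
  have hq : ContDiff ℝ ∞ (fun x => (p x : ℝ)) := IsPlot.contDiff hp
  obtain ⟨ε, hε, hα⟩ := α.2
  obtain ⟨δ, hδ, hβ⟩ := β.2
  refine DiffeologicalSpace.locality fun x => ?_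
  rcases lt_trichotomy (p x : ℝ) (1 / 2) with hx | hx | hx
  · refine ⟨{y | (p y : ℝ) < 1 / 2}, isOpen_lt hq.continuous continuous_const, hx,
      fun {m f} hf hf' => ?_⟩
    have h1 : (concatFun β.1.toFun α.1.toFun ∘ p) ∘ f =
        fun y => α (clamp (2 * (p (f y) : ℝ))) := by
      funext y
      have := hf y
      simp only [Set.mem_ofPred_eq] at this
      simp only [Function.comp_apply, concatFun]
      rw [if_pos this]
    rw [h1]
    refine (isPlot_unitInterval (contDiff_const.mul (hq.comp hf')) fun y => ?_).dSmooth_comp'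
      α.1.smooth
    have := hf y
    simp only [Set.mem_ofPred_eq] at this
    have h0 := (p (f y)).2.1
    exact ⟨by simp only [Function.comp_apply]; linarith,
      by simp only [Function.comp_apply]; linarith⟩
  · refine ⟨{y | |(p y : ℝ) - 1 / 2| < min (ε / 2) (min (δ / 2) (1 / 2))},
      isOpen_lt (hq.continuous.sub continuous_const).abs continuous_const, ?_,
      fun {m f} hf hf' => ?_⟩
    · simp only [Set.mem_ofPred_eq, hx, sub_self, abs_zero]
      positivity
    have h1 : (concatFun β.1.toFun α.1.toFun ∘ p) ∘ f = fun y => α 1 := by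
      funext y
      have := hf y
      simp only [Set.mem_ofPred_eq, lt_min_iff, abs_lt] at this
      obtain ⟨⟨a1, a2⟩, ⟨b1, b2⟩, c1, c2⟩ := this
      simp only [Function.comp_apply, concatFun]
      split_ifs with hlt
      · refine (hα _).2 ?_
        rw [coe_clamp (by linarith [(p (f y)).2.1]) (by linarith)]
        linarith
      · rw [h]
        refine (hβ _).1 ?_
        rw [coe_clamp (by linarith) (by linarith [(p (f y)).2.2])]
        linarith
    rw [h1]
    exact isPlot_const
  · refine ⟨{y | (1 / 2 : ℝ) < (p y : ℝ)}, isOpen_lt continuous_const hq.continuous, hx,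
      fun {m f} hf hf' => ?_⟩
    have h1 : (concatFun β.1.toFun α.1.toFun ∘ p) ∘ f =
        fun y => β (clamp (2 * (p (f y) : ℝ) - 1)) := by
      funext y
      have := hf y
      simp only [Set.mem_ofPred_eq] at this
      simp only [Function.comp_apply, concatFun]
      rw [if_neg (by linarith)]
    rw [h1]
    refine (isPlot_unitInterval ((contDiff_const.mul (hq.comp hf')).sub contDiff_const)
      fun y => ?_).dSmooth_comp' β.1.smooth
    have := hf y
    simp only [Set.mem_ofPred_eq] at this
    have h0 := (p (f y)).2.2
    exact ⟨by simp only [Function.comp_apply]; linarith,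
      by simp only [Function.comp_apply]; linarith⟩

theorem concatFun_zero {A : Type*} (β α : unitInterval → A) : concatFun β α 0 = α 0 := by
  simp [concatFun]

theorem concatFun_one {A : Type*} (β α : unitInterval → A) : concatFun β α 1 = β 1 := by
  have h2 : (2 : ℝ) * ((1 : unitInterval) : ℝ) - 1 = 1 := by
    rw [Set.Icc.coe_one]
    norm_num
  simp only [concatFun]
  rw [if_neg (by rw [Set.Icc.coe_one]; norm_num), h2, clamp_one]

namespace SitPath

/-- The concatenation `β ∨ α` (`β` after `α`). -/
def concat (β α : SitPath X) (h : α 1 = β 0) : SitPath X :=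
  ⟨⟨concatFun β.1.toFun α.1.toFun, concatFun_smooth β α h⟩, by
    obtain ⟨ε, hε, hα⟩ := α.2
    obtain ⟨δ, hδ, hβ⟩ := β.2
    refine ⟨min (ε / 2) (min (δ / 2) (1 / 2)), by positivity, fun t => ⟨fun ht => ?_,
      fun ht => ?_⟩⟩
    · simp only [lt_min_iff] at ht
      change concatFun _ _ t = concatFun _ _ 0
      rw [concatFun_zero, concatFun, if_pos ht.2.2]
      refine (hα _).1 ?_
      rw [coe_clamp (by linarith [t.2.1]) (by linarith [ht.2.2])]
      linarith [ht.1]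
    · have h1 : (t : ℝ) > 1 - δ / 2 := by
        have := (min_le_right (ε / 2) (min (δ / 2) (1 / 2))).trans (min_le_left _ _)
        linarith
      have h2 : (t : ℝ) > 1 / 2 := by
        have := (min_le_right (ε / 2) (min (δ / 2) (1 / 2))).trans (min_le_right _ _)
        linarith
      change concatFun _ _ t = concatFun _ _ 1
      rw [concatFun_one, concatFun, if_neg (by linarith)]
      refine (hβ _).2 ?_
      rw [coe_clamp (by linarith) (by linarith [t.2.2])]
      linarith⟩

@[simp] theorem concat_zero (β α : SitPath X) (h : α 1 = β 0) : concat β α h 0 = α 0 :=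
  concatFun_zero _ _

@[simp] theorem concat_one (β α : SitPath X) (h : α 1 = β 0) : concat β α h 1 = β 1 :=
  concatFun_one _ _

/-- The reversed path `t ↦ α (1 - t)`. -/
def reverse (α : SitPath X) : SitPath X :=
  ⟨⟨fun t => α (unitInterval.symm t), α.1.smooth.comp (by
    intro n p hp
    have hq : ContDiff ℝ ∞ (fun x => (p x : ℝ)) := IsPlot.contDiff hp
    exact ContDiff.isPlot (X := ℝ) (contDiff_const.sub hq : ContDiff ℝ ∞ fun x => 1 - (p x : ℝ)))⟩, by
    obtain ⟨ε, hε, hα⟩ := α.2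
    refine ⟨ε, hε, fun t => ⟨fun ht => ?_, fun ht => ?_⟩⟩
    · simp only [unitInterval.symm_zero]
      exact (hα _).2 (by rw [unitInterval.coe_symm_eq]; linarith)
    · simp only [unitInterval.symm_one]
      exact (hα _).1 (by rw [unitInterval.coe_symm_eq]; linarith)⟩

@[simp] theorem reverse_zero (α : SitPath X) : reverse α 0 = α 1 := by
  change α (unitInterval.symm 0) = _
  rw [unitInterval.symm_zero]

@[simp] theorem reverse_one (α : SitPath X) : reverse α 1 = α 0 := by
  change α (unitInterval.symm 1) = _
  rw [unitInterval.symm_one]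

/-- The constant path. -/
def const (x : X) : SitPath X :=
  ⟨⟨fun _ => x, dSmooth_const⟩, 1, one_pos, fun _ => ⟨fun _ => rfl, fun _ => rfl⟩⟩

@[simp] theorem const_apply (x : X) (t : unitInterval) : const x t = x := rfl

/-- The composite `F ∘ α`. -/
def map (F : X → Y) (hF : DSmooth F) (α : SitPath X) : SitPath Y :=
  ⟨⟨fun t => F (α t), hF.comp α.1.smooth⟩, by
    obtain ⟨ε, hε, hα⟩ := α.2
    exact ⟨ε, hε, fun t => ⟨fun ht => congrArg F ((hα t).1 ht),
      fun ht => congrArg F ((hα t).2 ht)⟩⟩⟩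

theorem map_concat (F : X → Y) (hF : DSmooth F) (β α : SitPath X) (h : α 1 = β 0) :
    map F hF (concat β α h) = concat (map F hF β) (map F hF α) (congrArg F h) := by
  refine SitPath.ext' fun t => ?_
  change F (concatFun _ _ t) = concatFun _ _ t
  simp only [concatFun]
  split_ifs <;> rfl

theorem map_reverse (F : X → Y) (hF : DSmooth F) (α : SitPath X) :
    map F hF (reverse α) = reverse (map F hF α) := rfl

/-- A smooth function that equals `0` for `t ≤ 1/3` and `1` for `t ≥ 2/3`. -/
def bump (t : ℝ) : ℝ := Real.smoothTransition (3 * t - 1)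

theorem contDiff_bump : ContDiff ℝ ∞ bump :=
  Real.smoothTransition.contDiff.comp ((contDiff_const.mul contDiff_id).sub contDiff_const)

theorem bump_nonneg (t : ℝ) : 0 ≤ bump t := Real.smoothTransition.nonneg _

theorem bump_le_one (t : ℝ) : bump t ≤ 1 := Real.smoothTransition.le_one _

theorem bump_of_le {t : ℝ} (h : t ≤ 1 / 3) : bump t = 0 :=
  Real.smoothTransition.zero_of_nonpos (by linarith)

theorem bump_of_ge {t : ℝ} (h : 2 / 3 ≤ t) : bump t = 1 :=
  Real.smoothTransition.one_of_one_le (by linarith)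

theorem bump_smooth : DSmooth (fun t : unitInterval => (clamp (bump t) : unitInterval)) := by
  intro n p hp
  exact isPlot_unitInterval (contDiff_bump.comp (IsPlot.contDiff hp))
    fun x => ⟨bump_nonneg _, bump_le_one _⟩

/-- The reparameterization of a smooth path `[0,1] → X` that is constant near the endpoints. -/
def ofSmooth (α : SmoothMap unitInterval X) : SitPath X :=
  ⟨⟨fun t => α (clamp (bump t)), α.smooth.comp bump_smooth⟩, 1 / 3, by norm_num, fun t =>
    ⟨fun ht => by
      simp only [Set.Icc.coe_zero]
      rw [bump_of_le ht.le, bump_of_le (by norm_num)],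
    fun ht => by
      simp only [Set.Icc.coe_one]
      rw [bump_of_ge (by linarith), bump_of_ge (by norm_num)]⟩⟩

@[simp] theorem ofSmooth_zero (α : SmoothMap unitInterval X) : ofSmooth α 0 = α 0 := by
  change α (clamp (bump _)) = _
  rw [Set.Icc.coe_zero, bump_of_le (by norm_num), clamp_zero]

@[simp] theorem ofSmooth_one (α : SmoothMap unitInterval X) : ofSmooth α 1 = α 1 := by
  change α (clamp (bump _)) = _
  rw [Set.Icc.coe_one, bump_of_ge (by norm_num), clamp_one]

end SitPath

/-- The elementary moves: reparameterizations by smooth maps `[0,1] → [0,1]` that fix the endpoints,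
retraces `β ∨ η ∨ η⁻ ∨ α ∼ β ∨ α`, and these moves inside a concatenation. -/
inductive RetraceStep : SitPath X → SitPath X → Prop
  | reparam (α β : SitPath X) (f : SmoothMap unitInterval unitInterval) (h0 : f 0 = 0)
      (h1 : f 1 = 1) (h : ∀ t, α t = β (f t)) : RetraceStep α β
  | retrace (β η α : SitPath X) (hβ : η 1 = β 0) (hα : α 1 = η 1) :
      RetraceStep
        (β.concat (η.concat (η.reverse.concat α (by simpa using hα)) (by simp)) (by simpa using hβ))
        (β.concat α (hα.trans hβ))
  | concat_left (β α α' : SitPath X) (h : α 1 = β 0) (h' : α' 1 = β 0) :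
      RetraceStep α α' → RetraceStep (β.concat α h) (β.concat α' h')
  | concat_right (β β' α : SitPath X) (h : α 1 = β 0) (h' : α 1 = β' 0) :
      RetraceStep β β' → RetraceStep (β.concat α h) (β'.concat α h')

theorem RetraceStep.endpoints {α β : SitPath X} (h : RetraceStep α β) :
    α 0 = β 0 ∧ α 1 = β 1 := by
  induction h with
  | reparam α β f h0 h1 h => exact ⟨by rw [h, h0], by rw [h, h1]⟩
  | retrace β η α hβ hα => simp
  | concat_left β α α' h h' _ ih => simpa using ih.1
  | concat_right β β' α h h' _ ih => simpa using ih.2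

/-- The space `ℱ(X)` of smooth paths modulo retrace equivalence (the equivalence relation generated
by the elementary moves), with the quotient diffeology. -/
def PathClass (X : Type*) [DiffeologicalSpace X] : Type _ := Quot (RetraceStep (X := X))

instance : DiffeologicalSpace (PathClass X) :=
  inferInstanceAs (DiffeologicalSpace (Quot (RetraceStep (X := X))))

namespace PathClass

/-- The class of a path that is constant near the endpoints. -/
def mk (α : SitPath X) : PathClass X := Quot.mk _ α

/-- The class of an arbitrary smooth path `[0,1] → X`. -/
def ofSmooth (α : SmoothMap unitInterval X) : PathClass X := mk (SitPath.ofSmooth α)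

/-- The initial point of a path class. -/
def src : PathClass X → X := Quot.lift (fun α => α 0) fun _ _ h => h.endpoints.1

/-- The end point of a path class. -/
def tgt : PathClass X → X := Quot.lift (fun α => α 1) fun _ _ h => h.endpoints.2

@[simp] theorem src_mk (α : SitPath X) : (mk α).src = α 0 := rfl

@[simp] theorem tgt_mk (α : SitPath X) : (mk α).tgt = α 1 := rfl

open Classical in
/-- Concatenation `b ∨ a = [β ∨ α]` of path classes `b = [β]`, `a = [α]`. It is meaningful only if
`a` ends where `b` starts; otherwise the value is the placeholder `a`. -/
def comp : PathClass X → PathClass X → PathClass X :=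
  Quot.lift₂ (fun β α => if h : α 1 = β 0 then mk (β.concat α h) else mk α)
    (fun β α α' hs => by
      by_cases h : α 1 = β 0
      · have h' : α' 1 = β 0 := hs.endpoints.2 ▸ h
        rw [dif_pos h, dif_pos h']
        exact Quot.sound (.concat_left β α α' h h' hs)
      · have h' : ¬ α' 1 = β 0 := hs.endpoints.2 ▸ h
        rw [dif_neg h, dif_neg h']
        exact Quot.sound hs)
    (fun β β' α hs => by
      by_cases h : α 1 = β 0
      · have h' : α 1 = β' 0 := hs.endpoints.1 ▸ h
        rw [dif_pos h, dif_pos h']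
        exact Quot.sound (.concat_right β β' α h h' hs)
      · have h' : ¬ α 1 = β' 0 := hs.endpoints.1 ▸ h
        rw [dif_neg h, dif_neg h'])

theorem comp_mk (β α : SitPath X) (h : α 1 = β 0) : comp (mk β) (mk α) = mk (β.concat α h) :=
  dif_pos h

theorem comp_of_ne (b a : PathClass X) (h : a.tgt ≠ b.src) : comp b a = a := by
  induction b using Quot.ind with | _ β => ?_
  induction a using Quot.ind with | _ α => ?_
  exact dif_neg h

theorem src_comp (b a : PathClass X) : (comp b a).src = a.src := by
  induction b using Quot.ind with | _ β => ?_
  induction a using Quot.ind with | _ α => ?_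
  by_cases h : α 1 = β 0
  · exact (congrArg src (comp_mk β α h)).trans (SitPath.concat_zero β α h)
  · exact congrArg src (comp_of_ne (mk β) (mk α) h)

theorem tgt_comp (b a : PathClass X) (h : a.tgt = b.src) : (comp b a).tgt = b.tgt := by
  induction b using Quot.ind with | _ β => ?_
  induction a using Quot.ind with | _ α => ?_
  exact (congrArg tgt (comp_mk β α h)).trans (SitPath.concat_one β α h)

/-- The class of the composite with a smooth map. -/
def map (F : X → Y) (hF : DSmooth F) : PathClass X → PathClass Y :=
  Quot.map (SitPath.map F hF) fun α β h => by
    induction h with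
    | reparam α β f h0 h1 h => exact .reparam _ _ f h0 h1 fun t => congrArg F (h t)
    | retrace β η α hβ hα =>
      simp only [SitPath.map_concat, SitPath.map_reverse]
      exact .retrace _ _ _ (congrArg F hβ) (congrArg F hα)
    | concat_left β α α' h h' _ ih =>
      simp only [SitPath.map_concat]
      exact .concat_left _ _ _ _ _ ih
    | concat_right β β' α h h' _ ih =>
      simp only [SitPath.map_concat]
      exact .concat_right _ _ _ _ _ ih

theorem map_mk (F : X → Y) (hF : DSmooth F) (α : SitPath X) :
    map F hF (mk α) = mk (α.map F hF) := rfl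

theorem src_map (F : X → Y) (hF : DSmooth F) (a : PathClass X) :
    (map F hF a).src = F a.src := by
  induction a using Quot.ind with | _ α => rfl

theorem tgt_map (F : X → Y) (hF : DSmooth F) (a : PathClass X) :
    (map F hF a).tgt = F a.tgt := by
  induction a using Quot.ind with | _ α => rfl

theorem map_comp (F : X → Y) (hF : DSmooth F) (b a : PathClass X) (h : a.tgt = b.src) :
    map F hF (comp b a) = comp (map F hF b) (map F hF a) := by
  induction b using Quot.ind with | _ β => ?_
  induction a using Quot.ind with | _ α => ?_
  have h' : α 1 = β 0 := h
  refine (congrArg (map F hF) (comp_mk β α h')).trans ?_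
  rw [map_mk, SitPath.map_concat]
  exact (comp_mk _ _ _).symm

theorem map_id (h : DSmooth (id : X → X)) (a : PathClass X) : map id h a = a := by
  induction a using Quot.ind with | _ α => rfl

theorem map_map {Z : Type*} [DiffeologicalSpace Z] (F : X → Y) (hF : DSmooth F) (F' : Y → Z)
    (hF' : DSmooth F') (a : PathClass X) :
    map F' hF' (map F hF a) = map (fun x => F' (F x)) (hF'.comp hF) a := by
  induction a using Quot.ind with | _ α => rfl

theorem dSmooth_map (F : X → Y) (hF : DSmooth F) : DSmooth (map F hF) := by
  refine dSmooth_of_comp_quotMk (R := RetraceStep (X := X)) (f := map F hF) ?_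
  have h1 : DSmooth (fun α : SitPath X => α.map F hF) := fun _ _ hp => hF.comp hp
  exact (dSmooth_quotMk (RetraceStep (X := Y))).comp h1

theorem eq_of_common {P Q : SitPath X} (θ₁ θ₂ : SmoothMap unitInterval unitInterval)
    (h₁ : ∃ ε : ℝ, 0 < ε ∧ ∀ t : unitInterval, ((t : ℝ) < ε → θ₁ t = 0) ∧
      (1 - ε < (t : ℝ) → θ₁ t = 1)) (h₂ : θ₂ 0 = 0 ∧ θ₂ 1 = 1)
    (h : ∀ t, P (θ₁ t) = Q (θ₂ t)) : mk P = mk Q := by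
  obtain ⟨ε, hε, hθ⟩ := h₁
  have h0 : θ₁ 0 = 0 := (hθ 0).1 (by rw [Set.Icc.coe_zero]; exact hε)
  have h1 : θ₁ 1 = 1 := (hθ 1).2 (by rw [Set.Icc.coe_one]; linarith)
  let R : SitPath X := ⟨⟨fun t => P (θ₁ t), P.1.smooth.comp θ₁.smooth⟩, ε, hε, fun t =>
    ⟨fun ht => by
      change P (θ₁ t) = P (θ₁ 0)
      rw [(hθ t).1 ht, h0],
    fun ht => by
      change P (θ₁ t) = P (θ₁ 1)
      rw [(hθ t).2 ht, h1]⟩⟩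
  have hP : mk R = mk P := Quot.sound (.reparam R P θ₁ h0 h1 fun _ => rfl)
  have hQ : mk R = mk Q := Quot.sound (.reparam R Q θ₂ h₂.1 h₂.2 h)
  exact hP.symm.trans hQ

/-- A reparameterization of `[0,1]` that increases by `a`, `b`, `c` on the three thirds. -/
def thirds (a b c : ℝ) (ha : 0 ≤ a) (hb : 0 ≤ b) (hc : 0 ≤ c) (h : a + b + c = 1) :
    SmoothMap unitInterval unitInterval where
  toFun t := clamp (a * SitPath.bump (3 * t) + b * SitPath.bump (3 * t - 1) +
    c * SitPath.bump (3 * t - 2))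
  smooth := by
    intro n p hp
    have hq : ContDiff ℝ ∞ (fun x => 3 * (p x : ℝ)) :=
      contDiff_const.mul (IsPlot.contDiff hp : ContDiff ℝ ∞ fun x => (p x : ℝ))
    refine isPlot_unitInterval (((contDiff_const.mul (SitPath.contDiff_bump.comp hq)).add
      (contDiff_const.mul (SitPath.contDiff_bump.comp (hq.sub contDiff_const)))).add
      (contDiff_const.mul (SitPath.contDiff_bump.comp (hq.sub contDiff_const)))) fun x => ?_
    change a * SitPath.bump (3 * (p x : ℝ)) + b * SitPath.bump (3 * (p x : ℝ) - 1) +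
      c * SitPath.bump (3 * (p x : ℝ) - 2) ∈ Set.Icc 0 1
    have a0 := SitPath.bump_nonneg (3 * (p x : ℝ))
    have a1 := SitPath.bump_le_one (3 * (p x : ℝ))
    have b0 := SitPath.bump_nonneg (3 * (p x : ℝ) - 1)
    have b1 := SitPath.bump_le_one (3 * (p x : ℝ) - 1)
    have c0 := SitPath.bump_nonneg (3 * (p x : ℝ) - 2)
    have c1 := SitPath.bump_le_one (3 * (p x : ℝ) - 2)
    generalize SitPath.bump (3 * (p x : ℝ)) = u at a0 a1
    generalize SitPath.bump (3 * (p x : ℝ) - 1) = v at b0 b1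
    generalize SitPath.bump (3 * (p x : ℝ) - 2) = w at c0 c1
    exact ⟨by positivity, by nlinarith⟩

section thirds

variable {a b c : ℝ} {ha : 0 ≤ a} {hb : 0 ≤ b} {hc : 0 ≤ c} {h : a + b + c = 1}

theorem thirds_one {t : unitInterval} (ht : (t : ℝ) ≤ 1 / 3) :
    thirds a b c ha hb hc h t = clamp (a * SitPath.bump (3 * t)) := by
  change clamp _ = _
  rw [SitPath.bump_of_le (t := 3 * (t : ℝ) - 1) (by linarith),
    SitPath.bump_of_le (t := 3 * (t : ℝ) - 2) (by linarith)]
  simp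

theorem thirds_two {t : unitInterval} (ht : 1 / 3 ≤ (t : ℝ)) (ht' : (t : ℝ) ≤ 2 / 3) :
    thirds a b c ha hb hc h t = clamp (a + b * SitPath.bump (3 * t - 1)) := by
  change clamp _ = _
  rw [SitPath.bump_of_ge (t := 3 * (t : ℝ)) (by linarith),
    SitPath.bump_of_le (t := 3 * (t : ℝ) - 2) (by linarith)]
  simp

theorem thirds_three {t : unitInterval} (ht : 2 / 3 ≤ (t : ℝ)) :
    thirds a b c ha hb hc h t = clamp (a + b + c * SitPath.bump (3 * t - 2)) := by
  change clamp _ = _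
  rw [SitPath.bump_of_ge (t := 3 * (t : ℝ)) (by linarith),
    SitPath.bump_of_ge (t := 3 * (t : ℝ) - 1) (by linarith)]
  simp

theorem thirds_flat : ∃ ε : ℝ, 0 < ε ∧ ∀ t : unitInterval,
    ((t : ℝ) < ε → thirds a b c ha hb hc h t = 0) ∧
      (1 - ε < (t : ℝ) → thirds a b c ha hb hc h t = 1) := by
  refine ⟨1 / 9, by norm_num, fun t => ⟨fun ht => ?_, fun ht => ?_⟩⟩
  · rw [thirds_one (by linarith), SitPath.bump_of_le (by linarith), mul_zero, clamp_zero]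
  · rw [thirds_three (by linarith), SitPath.bump_of_ge (by linarith), mul_one, h, clamp_one]

theorem thirds_endpoints : thirds a b c ha hb hc h 0 = 0 ∧ thirds a b c ha hb hc h 1 = 1 := by
  obtain ⟨ε, hε, hθ⟩ := thirds_flat (ha := ha) (hb := hb) (hc := hc) (h := h)
  exact ⟨(hθ 0).1 (by rw [Set.Icc.coe_zero]; exact hε),
    (hθ 1).2 (by rw [Set.Icc.coe_one]; linarith)⟩

end thirds

theorem concat_left_half (β α : SitPath X) (h : α 1 = β 0) {u : ℝ} (h0 : 0 ≤ u) (h1 : u ≤ 1) :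
    β.concat α h (clamp (u / 2)) = α (clamp u) := by
  change concatFun _ _ _ = _
  rw [concatFun, coe_clamp (by linarith) (by linarith)]
  split_ifs with hu
  · rw [mul_div_cancel₀ u two_ne_zero]
  · obtain rfl : u = 1 := by linarith
    rw [mul_div_cancel₀ _ two_ne_zero, sub_self, clamp_zero, clamp_one]
    exact h.symm

theorem concat_right_half (β α : SitPath X) (h : α 1 = β 0) {u : ℝ} (h0 : 0 ≤ u) (h1 : u ≤ 1) :
    β.concat α h (clamp ((1 + u) / 2)) = β (clamp u) := by
  change concatFun _ _ _ = _
  rw [concatFun, coe_clamp (by linarith) (by linarith), if_neg (by linarith),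
    mul_div_cancel₀ _ two_ne_zero, add_sub_cancel_left]

theorem comp_assoc (c b a : PathClass X) (h₁ : a.tgt = b.src) (h₂ : b.tgt = c.src) :
    comp (comp c b) a = comp c (comp b a) := by
  induction c using Quot.ind with | _ γ => ?_
  induction b using Quot.ind with | _ β => ?_
  induction a using Quot.ind with | _ α => ?_
  have h₁' : α 1 = β 0 := h₁
  have h₂' : β 1 = γ 0 := h₂
  change comp (comp (mk γ) (mk β)) (mk α) = comp (mk γ) (comp (mk β) (mk α))
  rw [comp_mk _ _ h₂', comp_mk _ _ h₁', comp_mk _ _ (by simpa using h₁'),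
    comp_mk _ _ (by simpa using h₂')]
  refine eq_of_common
    (thirds (1 / 2) (1 / 4) (1 / 4) (by norm_num) (by norm_num) (by norm_num) (by norm_num))
    (thirds (1 / 4) (1 / 4) (1 / 2) (by norm_num) (by norm_num) (by norm_num) (by norm_num))
    thirds_flat thirds_endpoints fun t => ?_
  rcases le_total (t : ℝ) (1 / 3) with ht | ht
  · rw [thirds_one ht, thirds_one ht]
    have h0 := SitPath.bump_nonneg (3 * (t : ℝ))
    have h1 := SitPath.bump_le_one (3 * (t : ℝ))
    generalize SitPath.bump (3 * (t : ℝ)) = u at h0 h1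
    rw [show 1 / 2 * u = u / 2 by ring, show 1 / 4 * u = u / 2 / 2 by ring,
      concat_left_half _ _ _ h0 h1, concat_left_half _ _ _ (by linarith) (by linarith),
      concat_left_half _ _ _ h0 h1]
  rcases le_total (t : ℝ) (2 / 3) with ht' | ht'
  · rw [thirds_two ht ht', thirds_two ht ht']
    have h0 := SitPath.bump_nonneg (3 * (t : ℝ) - 1)
    have h1 := SitPath.bump_le_one (3 * (t : ℝ) - 1)
    generalize SitPath.bump (3 * (t : ℝ) - 1) = u at h0 h1
    rw [show 1 / 2 + 1 / 4 * u = (1 + u / 2) / 2 by ring,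
      show 1 / 4 + 1 / 4 * u = (1 + u) / 2 / 2 by ring,
      concat_right_half _ _ _ (by linarith) (by linarith), concat_left_half _ _ _ h0 h1,
      concat_left_half _ _ _ (by linarith) (by linarith), concat_right_half _ _ _ h0 h1]
  · rw [thirds_three ht', thirds_three ht']
    have h0 := SitPath.bump_nonneg (3 * (t : ℝ) - 2)
    have h1 := SitPath.bump_le_one (3 * (t : ℝ) - 2)
    generalize SitPath.bump (3 * (t : ℝ) - 2) = u at h0 h1
    rw [show 1 / 2 + 1 / 4 + 1 / 4 * u = (1 + (1 + u) / 2) / 2 by ring,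
      show 1 / 4 + 1 / 4 + 1 / 2 * u = (1 + u) / 2 by ring,
      concat_right_half _ _ _ (by linarith) (by linarith), concat_right_half _ _ _ h0 h1,
      concat_right_half _ _ _ h0 h1]

theorem const_comp (x : X) (a : PathClass X) (h : a.tgt = x) : comp (mk (.const x)) a = a := by
  induction a using Quot.ind with | _ α => ?_
  have h' : α 1 = SitPath.const x 0 := h
  refine (comp_mk (.const x) α h').trans ?_
  refine eq_of_common
    (thirds (1 / 2) 0 (1 / 2) (by norm_num) (by norm_num) (by norm_num) (by norm_num))
    (thirds 1 0 0 (by norm_num) (by norm_num) (by norm_num) (by norm_num))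
    thirds_flat thirds_endpoints fun t => ?_
  rcases le_total (t : ℝ) (1 / 3) with ht | ht
  · rw [thirds_one ht, thirds_one ht]
    have h0 := SitPath.bump_nonneg (3 * (t : ℝ))
    have h1 := SitPath.bump_le_one (3 * (t : ℝ))
    generalize SitPath.bump (3 * (t : ℝ)) = u at h0 h1
    rw [show 1 / 2 * u = u / 2 by ring, one_mul, concat_left_half _ _ _ h0 h1]
  have key : ∀ u : ℝ, 0 ≤ u → u ≤ 1 →
      (SitPath.const x).concat α h' (clamp ((1 + u) / 2)) = α (clamp 1) := by
    intro u h0 h1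
    rw [concat_right_half _ _ _ h0 h1, clamp_one, h']
    rfl
  rcases le_total (t : ℝ) (2 / 3) with ht' | ht'
  · rw [thirds_two ht ht', thirds_two ht ht']
    simpa using key 0 le_rfl zero_le_one
  · rw [thirds_three ht', thirds_three ht']
    have h0 := SitPath.bump_nonneg (3 * (t : ℝ) - 2)
    have h1 := SitPath.bump_le_one (3 * (t : ℝ) - 2)
    generalize SitPath.bump (3 * (t : ℝ) - 2) = u at h0 h1
    rw [show 1 / 2 + 0 + 1 / 2 * u = (1 + u) / 2 by ring, key u h0 h1]
    simp

theorem comp_const (x : X) (a : PathClass X) (h : a.src = x) : comp a (mk (.const x)) = a := by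
  induction a using Quot.ind with | _ α => ?_
  have h' : SitPath.const x 1 = α 0 := h.symm
  refine (comp_mk α (.const x) h').trans ?_
  refine eq_of_common
    (thirds (1 / 2) 0 (1 / 2) (by norm_num) (by norm_num) (by norm_num) (by norm_num))
    (thirds 0 0 1 (by norm_num) (by norm_num) (by norm_num) (by norm_num))
    thirds_flat thirds_endpoints fun t => ?_
  have key : ∀ u : ℝ, 0 ≤ u → u ≤ 1 →
      α.concat (SitPath.const x) h' (clamp (u / 2)) = α (clamp 0) := by
    intro u h0 h1
    rw [concat_left_half _ _ _ h0 h1, clamp_zero, ← h']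
    rfl
  rcases le_total (t : ℝ) (1 / 3) with ht | ht
  · rw [thirds_one ht, thirds_one ht]
    have h0 := SitPath.bump_nonneg (3 * (t : ℝ))
    have h1 := SitPath.bump_le_one (3 * (t : ℝ))
    generalize SitPath.bump (3 * (t : ℝ)) = u at h0 h1
    rw [show 1 / 2 * u = u / 2 by ring, key u h0 h1, zero_mul]
  rcases le_total (t : ℝ) (2 / 3) with ht' | ht'
  · rw [thirds_two ht ht', thirds_two ht ht']
    simpa using key 1 zero_le_one le_rfl
  · rw [thirds_three ht', thirds_three ht']
    have h0 := SitPath.bump_nonneg (3 * (t : ℝ) - 2)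
    have h1 := SitPath.bump_le_one (3 * (t : ℝ) - 2)
    generalize SitPath.bump (3 * (t : ℝ) - 2) = u at h0 h1
    rw [show 1 / 2 + 0 + 1 / 2 * u = (1 + u) / 2 by ring, concat_right_half _ _ _ h0 h1]
    simp

theorem comp_reverse (η : SitPath X) :
    comp (mk η) (mk η.reverse) = mk (.const (η 1)) := by
  have e1 : SitPath.const (η 1) 1 = η.reverse 0 := by simp
  have e2 : (η.reverse.concat (.const (η 1)) e1) 1 = η 0 := by simp
  have e3 : (η.concat (η.reverse.concat (.const (η 1)) e1) e2) 1 = SitPath.const (η 1) 0 := by simp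
  have e4 : SitPath.const (η 1) 1 = SitPath.const (η 1) 0 := rfl
  have key : mk ((SitPath.const (η 1)).concat _ e3) =
      mk ((SitPath.const (η 1)).concat (.const (η 1)) e4) :=
    Quot.sound (.retrace (.const (η 1)) η (.const (η 1)) rfl rfl)
  rw [← comp_mk, ← comp_mk, ← comp_mk, ← comp_mk,
    comp_const _ (mk η.reverse) (by simp), const_comp (η 1) (mk (.const (η 1))) rfl,
    const_comp] at key
  · exact key
  · rw [tgt_comp _ _ (by simp)]
    rfl

end PathClass

/-- The space `ℱ_x(X)` of path classes starting at `x`, with the subspace diffeology. -/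
abbrev PointedPaths {X : Type*} [DiffeologicalSpace X] (x : X) : Type _ :=
  {a : PathClass X // a.src = x}

/-- The loop space `Ω_x(X)` of classes of loops based at `x`, with the subspace diffeology. -/
abbrev LoopGroup {X : Type*} [DiffeologicalSpace X] (x : X) : Type _ :=
  {a : PathClass X // a.src = x ∧ a.tgt = x}

namespace LoopGroup

variable {x : X}

/-- The multiplication `[γ] ∨ [σ] = [γ ∨ σ]` and the class of the constant loop. -/
instance : Monoid (LoopGroup x) where
  mul c d := ⟨c.1.comp d.1, (PathClass.src_comp _ _).trans d.2.1,
    (PathClass.tgt_comp _ _ (d.2.2.trans c.2.1.symm)).trans c.2.2⟩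
  mul_assoc c d e := Subtype.ext
    (PathClass.comp_assoc _ _ _ (e.2.2.trans d.2.1.symm) (d.2.2.trans c.2.1.symm))
  one := ⟨.mk (.const x), rfl, rfl⟩
  one_mul c := Subtype.ext (PathClass.const_comp _ _ c.2.2)
  mul_one c := Subtype.ext (PathClass.comp_const _ _ c.2.1)

theorem coe_mul (c d : LoopGroup x) : (c * d).1 = c.1.comp d.1 := rfl

theorem exists_inv (c : LoopGroup x) : IsUnit c := by
  obtain ⟨a, h0, h1⟩ := c
  induction a using Quot.ind with | _ γ => ?_
  have h0' : γ 0 = x := h0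
  have h1' : γ 1 = x := h1
  refine ⟨⟨⟨.mk γ, h0, h1⟩, ⟨.mk γ.reverse, ?_, ?_⟩, Subtype.ext ?_, Subtype.ext ?_⟩, rfl⟩
  · simpa using h1'
  · simpa using h0'
  · exact (PathClass.comp_reverse γ).trans (by rw [h1']; rfl)
  · have := PathClass.comp_reverse γ.reverse
    have hr : γ.reverse.reverse = γ := SitPath.ext' fun t => by
      change γ (unitInterval.symm (unitInterval.symm t)) = _
      rw [unitInterval.symm_symm]
    rw [hr, SitPath.reverse_one, h0'] at this
    exact this

/-- The group structure; the inverse of `[γ]` is the class of the reversed loop. -/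
instance : Group (LoopGroup x) := groupOfIsUnit exists_inv

/-- The map on loop spaces induced by a pointed smooth map. -/
def map (F : X → Y) (hF : DSmooth F) {y : Y} (h : F x = y) (c : LoopGroup x) : LoopGroup y :=
  ⟨c.1.map F hF, by rw [PathClass.src_map, c.2.1, h], by rw [PathClass.tgt_map, c.2.2, h]⟩

end LoopGroup

/-- The path `α^{r → s}(t) = α(t s + (1 - t) r)` on `[0,1]`. -/
def LocalPath.segment (α : LocalPath X) (r s : α.dom) : SmoothMap unitInterval X where
  toFun t := α ⟨t * s + (1 - t) * r, by
    have := α.ordConnected_dom.convex s.2 r.2 t.2.1 (sub_nonneg.2 t.2.2) (by ring)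
    simpa using this⟩
  smooth := by
    refine α.smooth.comp (dSmooth_subtype_mk ?_ _)
    intro n p hp
    have hq : ContDiff ℝ ∞ (fun x => (p x : ℝ)) := IsPlot.contDiff hp
    exact ContDiff.isPlot (X := ℝ)
      ((hq.mul contDiff_const).add ((contDiff_const.sub hq).mul contDiff_const))

theorem LocalPath.segment_zero (α : LocalPath X) (r s : α.dom) : α.segment r s 0 = α r := by
  simp [segment]

theorem LocalPath.segment_one (α : LocalPath X) (r s : α.dom) : α.segment r s 1 = α s := by
  simp [segment]

/-- The class of the restriction to `[0,1]` of a smooth loop `γ` based at `x`. -/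
def LoopGroup.ofLoop {x : X} (γ : LocalPath X) (h0 : (0 : ℝ) ∈ γ.dom) (h1 : (1 : ℝ) ∈ γ.dom)
    (hγ0 : γ ⟨0, h0⟩ = x) (hγ1 : γ ⟨1, h1⟩ = x) : LoopGroup x :=
  ⟨.ofSmooth (γ.segment ⟨0, h0⟩ ⟨1, h1⟩),
    (SitPath.ofSmooth_zero _).trans ((γ.segment_zero _ _).trans hγ0),
    (SitPath.ofSmooth_one _).trans ((γ.segment_one _ _).trans hγ1)⟩

end Paths

/-! ### Principal bundles and connections -/

section Bundles

variable {E X G : Type*} [DiffeologicalSpace E] [DiffeologicalSpace X] [Group G]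
  [DiffeologicalSpace G]

/-- A smooth injection with a smooth inverse on its image, the image carrying the subspace
diffeology. -/
def IsDiffeoOntoImage (f : E → X) : Prop :=
  DSmooth f ∧ ∃ g : Set.range f → E, DSmooth g ∧ ∀ x, g ⟨f x, Set.mem_range_self x⟩ = x

/-- Lying in the same orbit of a right action. -/
def OrbitRel (act : E → G → E) (ξ η : E) : Prop := ∃ g, η = act ξ g

/-- Diffeological principal `G`-bundles, for a right action `act` of `G` on `E`. -/
structure IsPrincipalBundle (act : E → G → E) (π : E → X) : Prop where
  act_one : ∀ ξ, act ξ 1 = ξ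
  act_mul : ∀ ξ g h, act ξ (g * h) = act (act ξ g) h
  smooth_act : DSmooth (fun p : E × G => act p.1 p.2)
  smooth_proj : DSmooth π
  surjective_proj : Function.Surjective π
  graph : IsDiffeoOntoImage (fun p : E × G => (p.1, act p.1 p.2))
  quotient : ∃ Φ : X ≃ Quot (OrbitRel act), DSmooth Φ ∧ DSmooth Φ.symm ∧
    ∀ ξ, Φ (π ξ) = Quot.mk _ ξ

/-- Assignments `A` of a map `A α t = A_t α` on the domain of `α` to every initialized path
`(α, t)`; so `A α t s` is the value `(A_t α)(s)`. -/
abbrev Transport (E : Type*) [DiffeologicalSpace E] : Type _ :=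
  (α : LocalPath E) → α.dom → α.dom → E

/-- The path `α` is horizontal: `A_t α = α` for some `t` in its domain. -/
def IsHorizontal (A : Transport E) (α : LocalPath E) : Prop :=
  ∃ t : α.dom, ∀ s, A α t s = α s

/-- Diffeological connections. The equality of the domains of `A_t α` and `α` is part of the type
of `A`. The last field says that horizontality does not depend on the time `t` at which
it is tested. -/
structure IsConnection (act : E → G → E) (π : E → X) (A : Transport E) : Prop where
  smooth_path : ∀ (α : LocalPath E) (t : α.dom), DSmooth (A α t)
  smooth : DSmooth (fun p : InitPath E =>
    p.1.1.withFun (A p.1.1 ⟨p.1.2, p.2⟩) (smooth_path p.1.1 ⟨p.1.2, p.2⟩))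
  lifting : ∀ (α : LocalPath E) (t s : α.dom), π (A α t s) = π (α s)
  basepoint : ∀ (α : LocalPath E) (t : α.dom), A α t t = α t
  equivariant : ∀ (α : LocalPath E) (ρ : α.dom → G) (_ : DSmooth ρ)
    (h : DSmooth (fun s : α.dom => act (α s) (ρ s))) (t s : α.dom),
    A (α.withFun (fun s : α.dom => act (α s) (ρ s)) h) t s = act (A α t s) (ρ t)
  reparam : ∀ (α : LocalPath E) (f : LocalPath α.dom) (t s : f.dom),
    A (α.reparam f) t s = A α (f t) (f s)
  projection : ∀ (α : LocalPath E) (t s : α.dom),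
    A (α.withFun (A α t) (smooth_path α t)) t s = A α t s
  horizontal : ∀ α : LocalPath E, IsHorizontal A α → ∀ t s : α.dom, A α t s = α s

end Bundles

/-! ### The two categories -/

section Categories

variable (G : Type u) [Group G] [DiffeologicalSpace G]

/-- Objects `(X, x₀, H)` of the holonomy category. -/
structure HolObj : Type (u + 1) where
  X : Type u
  [diffX : DiffeologicalSpace X]
  pathConnected : IsDPathConnected X
  pt : X
  hol : LoopGroup pt →* G
  smooth_hol : DSmooth hol

/-- Objects of the bundle-connection category. -/
structure BundleObj : Type (u + 1) where
  E : Type u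
  X : Type u
  [diffE : DiffeologicalSpace E]
  [diffX : DiffeologicalSpace X]
  pathConnected : IsDPathConnected X
  proj : E → X
  act : E → G → E
  principal : IsPrincipalBundle act proj
  ptE : E
  ptX : X
  proj_pt : proj ptE = ptX
  conn : Transport E
  isConnection : IsConnection act proj conn

attribute [instance] HolObj.diffX BundleObj.diffE BundleObj.diffX

variable {G}

/-- Morphisms of the holonomy category. -/
@[ext]
structure HolHom (P Q : HolObj G) where
  map : P.X → Q.X
  smooth : DSmooth map
  map_pt : map P.pt = Q.pt
  map_hol : ∀ γ : LoopGroup P.pt, Q.hol (LoopGroup.map map smooth map_pt γ) = P.hol γ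

/-- Morphisms of the bundle-connection category: pointed `G`-bundle morphisms compatible with
the connections. -/
@[ext]
structure BundleHom (P Q : BundleObj G) where
  tot : P.E → Q.E
  base : P.X → Q.X
  smooth_tot : DSmooth tot
  smooth_base : DSmooth base
  comm : ∀ ξ, Q.proj (tot ξ) = base (P.proj ξ)
  equivariant : ∀ ξ g, tot (P.act ξ g) = Q.act (tot ξ) g
  tot_pt : tot P.ptE = Q.ptE
  base_pt : base P.ptX = Q.ptX
  map_conn : ∀ (α : LocalPath P.E) (t s : α.dom),
    tot (P.conn α t s) = Q.conn (α.map tot smooth_tot) t s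

/-- The holonomy category. -/
instance : Category (HolObj G) where
  Hom := HolHom
  id P :=
    { map := id
      smooth := dSmooth_id
      map_pt := rfl
      map_hol := fun γ => congrArg P.hol (Subtype.ext (PathClass.map_id dSmooth_id γ.1)) }
  comp f g :=
    { map := fun x => g.map (f.map x)
      smooth := g.smooth.comp f.smooth
      map_pt := by rw [f.map_pt, g.map_pt]
      map_hol := fun γ => by
        rw [← f.map_hol, ← g.map_hol]
        exact congrArg _ (Subtype.ext (PathClass.map_map _ f.smooth _ g.smooth γ.1).symm) }
  id_comp _ := rfl
  comp_id _ := rfl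
  assoc _ _ _ := rfl

/-- The bundle-connection category. -/
instance : Category (BundleObj G) where
  Hom := BundleHom
  id P :=
    { tot := id
      base := id
      smooth_tot := dSmooth_id
      smooth_base := dSmooth_id
      comm := fun _ => rfl
      equivariant := fun _ _ => rfl
      tot_pt := rfl
      base_pt := rfl
      map_conn := fun _ _ _ => rfl }
  comp f g :=
    { tot := fun x => g.tot (f.tot x)
      base := fun x => g.base (f.base x)
      smooth_tot := g.smooth_tot.comp f.smooth_tot
      smooth_base := g.smooth_base.comp f.smooth_base
      comm := fun ξ => by rw [g.comm, f.comm]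
      equivariant := fun ξ h => by rw [f.equivariant, g.equivariant]
      tot_pt := by rw [f.tot_pt, g.tot_pt]
      base_pt := by rw [f.base_pt, g.base_pt]
      map_conn := fun α t s => by rw [f.map_conn, g.map_conn] }
  id_comp _ := rfl
  comp_id _ := rfl
  assoc _ _ _ := rfl

end Categories

/-! ### The associated bundle with the universal connection -/

section Associated

variable {X Y : Type*} [DiffeologicalSpace X] [DiffeologicalSpace Y]

theorem PathClass.dSmooth_tgt : DSmooth (PathClass.tgt (X := X)) := by
  refine dSmooth_of_comp_quotMk (R := RetraceStep (X := X)) (f := PathClass.tgt) ?_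
  intro n ψ hψ
  have h : DSmooth (fun q : EuclideanSpace ℝ (Fin n) × unitInterval => ψ q.1 q.2) := hψ
  exact (h.comp (dSmooth_prodMk dSmooth_id (dSmooth_const (y := 1)))).isPlot

/-- The right action `[α] ∨ [γ]` of the loop space on `ℱ_x(X)`. -/
def PointedPaths.mulLoop {x : X} (a : PointedPaths x) (γ : LoopGroup x) : PointedPaths x :=
  ⟨a.1.comp γ.1, (PathClass.src_comp _ _).trans γ.2.1⟩

/-- The prolongation `p ∨ a` of a path class `a` starting at `x` by a path class `p` that starts
where `a` ends. -/
def PointedPaths.push {x : X} (p : PathClass X) (a : PointedPaths x) : PointedPaths x :=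
  ⟨p.comp a.1, (PathClass.src_comp _ _).trans a.2⟩

theorem PointedPaths.tgt_mulLoop {x : X} (a : PointedPaths x) (γ : LoopGroup x) :
    (a.mulLoop γ).1.tgt = a.1.tgt :=
  PathClass.tgt_comp _ _ (γ.2.2.trans a.2.symm)

theorem PointedPaths.push_mulLoop {x : X} (p : PathClass X) (a : PointedPaths x)
    (γ : LoopGroup x) : push p (a.mulLoop γ) = (push p a).mulLoop γ := by
  refine Subtype.ext ?_
  by_cases h : a.1.tgt = p.src
  · exact (PathClass.comp_assoc _ _ _ (γ.2.2.trans a.2.symm) h).symm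
  · have h' : (a.mulLoop γ).1.tgt ≠ p.src := by rwa [tgt_mulLoop]
    change p.comp (a.mulLoop γ).1 = (p.comp a.1).comp γ.1
    rw [PathClass.comp_of_ne _ _ h', PathClass.comp_of_ne _ _ h]
    rfl

/-- The map `ℱ_x(X) → ℱ_y(Y)` induced by a pointed smooth map. -/
def PointedPaths.map (F : X → Y) (hF : DSmooth F) {x : X} {y : Y} (h : F x = y)
    (a : PointedPaths x) : PointedPaths y :=
  ⟨a.1.map F hF, by rw [PathClass.src_map, a.2, h]⟩

end Associated

section Assoc

variable {G : Type u} [Group G] [DiffeologicalSpace G]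

namespace HolObj

variable (P Q : HolObj G)

/-- The identification `([α], g) ∼ ([α] ∨ [γ], H([γ])⁻¹ g)`. -/
def AssocRel (p q : PointedPaths P.pt × G) : Prop :=
  ∃ γ : LoopGroup P.pt, q = (p.1.mulLoop γ, (P.hol γ)⁻¹ * p.2)

/-- The total space `ℱ_{x₀}(X) ×_H G` of the associated bundle, with the quotient diffeology. -/
def Assoc : Type u := Quot P.AssocRel

instance : DiffeologicalSpace P.Assoc := inferInstanceAs (DiffeologicalSpace (Quot P.AssocRel))

/-- The projection `⟦[α], g⟧ ↦ α 1`. -/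
def assocProj : P.Assoc → P.X :=
  Quot.lift (fun p => p.1.1.tgt) (by
    rintro p _ ⟨γ, rfl⟩
    exact (PointedPaths.tgt_mulLoop _ _).symm)

/-- The right action `⟦[α], g⟧ h = ⟦[α], g h⟧`. -/
def assocAct (ξ : P.Assoc) (h : G) : P.Assoc :=
  Quot.map (fun p : PointedPaths P.pt × G => (p.1, p.2 * h)) (by
    rintro p _ ⟨γ, rfl⟩
    exact ⟨γ, by simp only [mul_assoc]⟩) ξ

/-- The base point `⟦x₀, e⟧`, where `x₀` denotes the constant path. -/
def assocPt : P.Assoc := Quot.mk _ (⟨.mk (.const P.pt), rfl⟩, 1)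

theorem assocProj_pt : P.assocProj P.assocPt = P.pt := rfl

theorem dSmooth_assocProj : DSmooth P.assocProj := by
  refine dSmooth_of_comp_quotMk (R := P.AssocRel) (f := P.assocProj) ?_
  exact PathClass.dSmooth_tgt.comp (dSmooth_subtype_val.comp dSmooth_fst)

/-- `⟦a, g⟧ ↦ ⟦p ∨ a, g⟧`. -/
def assocPush (p : PathClass P.X) : P.Assoc → P.Assoc :=
  Quot.map (fun q : PointedPaths P.pt × G => (q.1.push p, q.2)) (by
    rintro q _ ⟨γ, rfl⟩
    exact ⟨γ, by simp only [PointedPaths.push_mulLoop]⟩)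

/-- The connection `Θ^H` induced by the universal connection: if `c r = ⟦[β], g⟧`, then
`(Θ^H_r c)(s) = ⟦[(τ_H ∘ c)^{r → s} ∨ β], g⟧`. -/
def assocConn : Transport P.Assoc := fun c r s =>
  P.assocPush (.ofSmooth ((c.map P.assocProj P.dSmooth_assocProj).segment r s)) (c r)

variable {P Q}

/-- The map `⟦[α], g⟧ ↦ ⟦[f ∘ α], g⟧` induced by a morphism `f` of the holonomy category. -/
def assocMap (f : P ⟶ Q) : P.Assoc → Q.Assoc :=
  Quot.map (fun p : PointedPaths P.pt × G => (p.1.map f.map f.smooth f.map_pt, p.2)) (by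
    rintro p _ ⟨γ, rfl⟩
    refine ⟨LoopGroup.map f.map f.smooth f.map_pt γ, Prod.ext (Subtype.ext ?_) ?_⟩
    · exact PathClass.map_comp _ f.smooth _ _ (γ.2.2.trans p.1.2.symm)
    · simp only [f.map_hol])

theorem dSmooth_assocMap (f : P ⟶ Q) : DSmooth (assocMap f) := by
  refine dSmooth_of_comp_quotMk (R := P.AssocRel) (f := assocMap f) ?_
  refine (dSmooth_quotMk Q.AssocRel).comp (dSmooth_prodMk ?_ dSmooth_snd)
  exact dSmooth_subtype_mk
    ((PathClass.dSmooth_map f.map f.smooth).comp (dSmooth_subtype_val.comp dSmooth_fst))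
    fun p : PointedPaths P.pt × G => (p.1.map f.map f.smooth f.map_pt).2

theorem assocProj_map (f : P ⟶ Q) (ξ : P.Assoc) :
    Q.assocProj (assocMap f ξ) = f.map (P.assocProj ξ) := by
  induction ξ using Quot.ind with | _ p => exact PathClass.tgt_map _ f.smooth _

theorem assocMap_push (f : P ⟶ Q) (p : PathClass P.X) (ξ : P.Assoc) (h : P.assocProj ξ = p.src) :
    assocMap f (P.assocPush p ξ) = Q.assocPush (p.map f.map f.smooth) (assocMap f ξ) := by
  induction ξ using Quot.ind with | _ q => ?_
  exact congrArg (Quot.mk _) (Prod.ext (Subtype.ext (PathClass.map_comp _ f.smooth _ _ h)) rfl)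

theorem assocMap_conn (f : P ⟶ Q) (c : LocalPath P.Assoc) (r s : c.dom) :
    assocMap f (P.assocConn c r s) =
      Q.assocConn (c.map (assocMap f) (dSmooth_assocMap f)) r s := by
  refine (assocMap_push f _ _ ?_).trans ?_
  · exact ((SitPath.ofSmooth_zero ((c.map P.assocProj P.dSmooth_assocProj).segment r s)).trans
      ((c.map P.assocProj P.dSmooth_assocProj).segment_zero r s)).symm
  · have h : ∀ t, SitPath.map f.map f.smooth (SitPath.ofSmooth
        ((c.map P.assocProj P.dSmooth_assocProj).segment r s)) t =
        SitPath.ofSmooth (((c.map (assocMap f) (dSmooth_assocMap f)).map Q.assocProj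
          Q.dSmooth_assocProj).segment r s) t := fun t => (assocProj_map f _).symm
    exact congrArg (fun p : SitPath Q.X => Q.assocPush (PathClass.mk p) (assocMap f (c r)))
      (SitPath.ext' h)

end HolObj

/-- The functor `(X, x₀, H) ↦ (ℱ_{x₀}(X) ×_H G → X, Θ^H)`, on morphisms given by
`f ↦ (⟦[α], g⟧ ↦ ⟦[f ∘ α], g⟧, f)`, given that the values are bundles with connection. -/
def assocFunctor
    (hP : ∀ P : HolObj G, IsPrincipalBundle P.assocAct P.assocProj)
    (hA : ∀ P : HolObj G, IsConnection P.assocAct P.assocProj P.assocConn) :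
    HolObj G ⥤ BundleObj G where
  obj P :=
    { E := P.Assoc
      X := P.X
      pathConnected := P.pathConnected
      proj := P.assocProj
      act := P.assocAct
      principal := hP P
      ptE := P.assocPt
      ptX := P.pt
      proj_pt := P.assocProj_pt
      conn := P.assocConn
      isConnection := hA P }
  map {P Q} f :=
    { tot := HolObj.assocMap f
      base := f.map
      smooth_tot := HolObj.dSmooth_assocMap f
      smooth_base := f.smooth
      comm := HolObj.assocProj_map f
      equivariant := fun ξ g => by
        induction ξ using Quot.ind with | _ p => rfl
      tot_pt := congrArg (Quot.mk _) (Prod.ext (Subtype.ext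
        (congrArg PathClass.mk (SitPath.ext' fun _ => f.map_pt))) rfl)
      base_pt := f.map_pt
      map_conn := HolObj.assocMap_conn f }
  map_id P := BundleHom.ext (funext fun ξ => by
    induction ξ using Quot.ind with | _ p =>
      exact congrArg (Quot.mk _)
        (Prod.ext (Subtype.ext (PathClass.map_id dSmooth_id p.1.1)) rfl)) rfl
  map_comp {P Q R} f g := BundleHom.ext (funext fun ξ => by
    induction ξ using Quot.ind with | _ p =>
      exact congrArg (Quot.mk _)
        (Prod.ext (Subtype.ext (PathClass.map_map _ f.smooth _ g.smooth p.1.1).symm) rfl)) rfl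

/-! ### The holonomy representation -/

/-- `H` is the holonomy representation of the connection `A` of `B` at the base point `ξ₀`: every
smooth loop `γ` at `x₀` has a horizontal lift that starts at `ξ₀` at time `0`, and any such lift
`γ'` satisfies `γ' 1 = ξ₀ · H([γ])`. -/
def IsHolonomy (B : BundleObj G) (H : LoopGroup B.ptX → G) : Prop :=
  ∀ (γ : LocalPath B.X) (h0 : (0 : ℝ) ∈ γ.dom) (h1 : (1 : ℝ) ∈ γ.dom)
    (hγ0 : γ ⟨0, h0⟩ = B.ptX) (hγ1 : γ ⟨1, h1⟩ = B.ptX),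
    (∃ (f : γ.dom → B.E) (hf : DSmooth f), (∀ s, B.proj (f s) = γ s) ∧ f ⟨0, h0⟩ = B.ptE ∧
      IsHorizontal B.conn (γ.withFun f hf)) ∧
    ∀ (f : γ.dom → B.E) (hf : DSmooth f), (∀ s, B.proj (f s) = γ s) → f ⟨0, h0⟩ = B.ptE →
      IsHorizontal B.conn (γ.withFun f hf) →
      f ⟨1, h1⟩ = B.act B.ptE (H (LoopGroup.ofLoop γ h0 h1 hγ0 hγ1))

/-- The functor sending a bundle with connection to `(X, x₀, H)` for the given representations `H`,
and a morphism `(F, f)` to `f`. -/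
def holFunctor (H : ∀ B : BundleObj G, LoopGroup B.ptX →* G) (hs : ∀ B, DSmooth (H B))
    (hm : ∀ {B C : BundleObj G} (F : B ⟶ C) (γ : LoopGroup B.ptX),
      H C (LoopGroup.map F.base F.smooth_base F.base_pt γ) = H B γ) :
    BundleObj G ⥤ HolObj G where
  obj B :=
    { X := B.X
      pathConnected := B.pathConnected
      pt := B.ptX
      hol := H B
      smooth_hol := hs B }
  map F :=
    { map := F.base
      smooth := F.smooth_base
      map_pt := F.base_pt
      map_hol := hm F }
  map_id _ := rfl
  map_comp _ _ := rfl

end Assoc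

end DiffHol

end

open DiffHol

/-! A connection is the same thing as a smooth, equivariant parallel transport along path classes,
and a pointed bundle over a path-connected base can be rebuilt from the transport of its base point.

From bundles to holonomies: every path in the base has a horizontal lift with a prescribed value at
one time. Locally it arises by lifting the path arbitrarily to `E`, applying `A_t` and translating
in the fibre; connectedness of the interval extends it to the whole domain
(`IsConnection.exists_horLift`). It is unique, because two lifts differ by a smooth `ρ` and `A_t`
only sees `ρ t` (`IsConnection.horLift_unique`). Transport is therefore invariant under
reparameterization and retracing and descends to path classes (`par_retraceStep`). It is smooth in
the class and in the starting point (`dSmooth_horLift`, `dSmooth_parClass`). Transporting `ξ₀`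
around loops gives the holonomy `hol`.

From holonomies to bundles: on `ℱ_{x₀}(X) ×_H G` transport is prolongation of path classes. The
connection axioms come from the fact that the class of `α ∘ f` depends only on the end points of the
path `f` in the interval on which `α` is defined (`LocalPath.mk_map_eq`). The bundle axioms use two
facts: plots of `X` lift to path classes by radial paths (`PointedPaths.liftsPlots_tgt`), and two
elements of one fibre differ by an explicit expression in `H` (`assocMk_eq_act`).

Equivalence: in the associated bundle transport is prolongation (`parClass_assoc`), so its holonomy
is `H` and the unit is the identity on underlying spaces. The counit is the comparison map `⟦[α], g⟧
↦ T_α(ξ₀) g`, where `T_α` is transport along `α`. It is well defined since `T_{α ∨ γ}(ξ₀) = T_α(ξ₀)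
H([γ])`, it intertwines the two transports and hence the connections, and it has a smooth inverse
because plots of `E` are smooth translates of transported base points. -/

noncomputable section

namespace DiffHol

/-! ### Smoothness tests and local lifting of plots -/

section Tools

variable {X Y Z : Type*} [DiffeologicalSpace X] [DiffeologicalSpace Y] [DiffeologicalSpace Z]

/-- Smoothness can be tested locally on the domains of plots. -/
theorem dSmooth_of_locally {f : X → Y}
    (h : ∀ (n : ℕ) (p : EuclideanSpace ℝ (Fin n) → X), IsPlot p → ∀ r₀,
      ∃ u : Set (EuclideanSpace ℝ (Fin n)), IsOpen u ∧ r₀ ∈ u ∧ DSmooth (fun r : u => f (p r))) :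
    DSmooth f := by
  intro n p hp
  refine DiffeologicalSpace.locality fun r => ?_
  obtain ⟨u, hu, hr, hs⟩ := h n p hp r
  exact ⟨u, hu, hr, fun {m g} hg hg' => (hs.comp (dSmooth_subtype_mk hg'.dSmooth hg)).isPlot⟩

theorem dSmooth_restrict {S : Set X} {f : X → Y} (hf : DSmooth f) : DSmooth (fun x : S => f x) :=
  hf.comp dSmooth_subtype_val

theorem dSmooth_inclusion {S T : Set X} (h : S ⊆ T) : DSmooth (Set.inclusion h) :=
  dSmooth_subtype_mk dSmooth_subtype_val fun x : S => h x.2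

/-- Lets `LiftsPlots.exists_lift` be applied on `EuclideanSpace ℝ (Fin n) × ℝ`, where smooth
families of paths live. -/
instance instIsContDiffCompatibleProd {V W : Type*} [NormedAddCommGroup V] [NormedSpace ℝ V]
    [DiffeologicalSpace V] [IsContDiffCompatible V] [NormedAddCommGroup W] [NormedSpace ℝ W]
    [DiffeologicalSpace W] [IsContDiffCompatible W] : IsContDiffCompatible (V × W) where
  isPlot_iff {n p} := by
    refine ⟨fun h => (IsPlot.contDiff h.1).prodMk (IsPlot.contDiff h.2), fun h => ⟨?_, ?_⟩⟩
    · exact (contDiff_fst.comp h).isPlot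
    · exact (contDiff_snd.comp h).isPlot

section Normed

variable {V : Type*} [NormedAddCommGroup V] [NormedSpace ℝ V] [DiffeologicalSpace V]
  [IsContDiffCompatible V]

/-- Smoothness can be tested near every point, where nearness is measured by a smooth map into a
normed space. -/
theorem dSmooth_of_nhds {c : X → V} (hc : DSmooth c) {f : X → Y}
    (h : ∀ x, ∃ w : Set V, IsOpen w ∧ c x ∈ w ∧ DSmooth (fun y : c ⁻¹' w => f y)) :
    DSmooth f := by
  refine dSmooth_of_locally fun n p hp r₀ => ?_
  obtain ⟨w, hw, hr, hs⟩ := h (p r₀)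
  have hcp : ContDiff ℝ ∞ (fun r => c (p r)) := IsPlot.contDiff (hc n p hp)
  exact ⟨(fun r => c (p r)) ⁻¹' w, hw.preimage hcp.continuous, hr,
    hs.comp (dSmooth_subtype_mk (P := fun y => y ∈ c ⁻¹' w) (dSmooth_restrict hp.dSmooth)
      fun r => r.2)⟩

/-- A smooth map into a neighbourhood of a point that is the identity near the point. -/
theorem exists_smooth_localizer [FiniteDimensional ℝ V] {u : Set V} (hu : IsOpen u)
    {x : V} (hx : x ∈ u) :
    ∃ (f : V → V) (v : Set V), DSmooth f ∧ (∀ y, f y ∈ u) ∧ IsOpen v ∧ x ∈ v ∧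
      ∀ y ∈ v, f y = y := by
  let e := toEuclidean (E := V)
  obtain ⟨f, v, hf, hfu, hv, hxv, hfv⟩ := exists_localizer
    (hu.preimage e.symm.continuous) (x := e x) (by simpa using hx)
  refine ⟨fun y => e.symm (f (e y)), e ⁻¹' v, ?_, fun y => hfu _, hv.preimage e.continuous, hxv,
    fun y hy => ?_⟩
  · exact (e.symm.contDiff.comp (hf.comp e.contDiff)).dSmooth
  · change e.symm (f (e y)) = y
    rw [hfv _ hy, e.symm_apply_apply]

end Normed

/-- Plots of `Y` lift locally along `π`. -/
def LiftsPlots (π : X → Y) : Prop :=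
  ∀ (n : ℕ) (p : EuclideanSpace ℝ (Fin n) → Y), IsPlot p → ∀ r₀,
    ∃ V : Set (EuclideanSpace ℝ (Fin n)), IsOpen V ∧ r₀ ∈ V ∧
      ∃ q : V → X, DSmooth q ∧ ∀ r : V, π (q r) = p r

theorem liftsPlots_quotMk (R : X → X → Prop) : LiftsPlots (Quot.mk R) :=
  fun _ _ hp r₀ => hp r₀

namespace LiftsPlots

variable {π : X → Y}

theorem dSmooth_of_comp (h : LiftsPlots π) {f : Y → Z} (hf : DSmooth (fun x => f (π x))) :
    DSmooth f := by
  refine dSmooth_of_locally fun n p hp r₀ => ?_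
  obtain ⟨V, hV, hr, q, hq, hqp⟩ := h n p hp r₀
  refine ⟨V, hV, hr, ?_⟩
  have := hf.comp hq
  convert this using 2 with r
  exact (congrArg f (hqp r)).symm

/-- Smooth maps on open subsets of finite-dimensional spaces lift locally. -/
theorem exists_lift (h : LiftsPlots π) {V : Type*} [NormedAddCommGroup V] [NormedSpace ℝ V]
    [DiffeologicalSpace V] [IsContDiffCompatible V] [FiniteDimensional ℝ V] {u : Set V}
    (hu : IsOpen u) {f : u → Y} (hf : DSmooth f) (x : u) :
    ∃ (w : Set V) (hw : w ⊆ u), IsOpen w ∧ (x : V) ∈ w ∧ ∃ q : w → X, DSmooth q ∧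
      ∀ y : w, π (q y) = f ⟨y, hw y.2⟩ := by
  obtain ⟨g, v, hg, hgu, hv, hxv, hgv⟩ := exists_smooth_localizer hu x.2
  let e := toEuclidean (E := V)
  have he : DSmooth e := e.contDiff.dSmooth
  have hes : DSmooth e.symm := e.symm.contDiff.dSmooth
  -- Precomposition with the localizer turns `f` into a globally defined plot without changing it
  -- near `x`.
  have hp : DSmooth (fun r => f ⟨g (e.symm r), hgu _⟩) :=
    hf.comp (dSmooth_subtype_mk (P := fun y => y ∈ u) (hg.comp hes) fun r => hgu _)
  obtain ⟨W, hW, hr, q, hq, hqp⟩ := h _ _ hp.isPlot (e x)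
  refine ⟨e ⁻¹' W ∩ v ∩ u, Set.inter_subset_right,
    ((hW.preimage e.continuous).inter hv).inter hu, ⟨⟨hr, hxv⟩, x.2⟩,
    fun y => q ⟨e y, y.2.1.1⟩, hq.comp (dSmooth_subtype_mk (dSmooth_restrict he) fun y => y.2.1.1),
    fun y => ?_⟩
  rw [hqp]
  congr 2
  rw [e.symm_apply_apply, hgv _ y.2.1.2]

theorem comp {ρ : Y → Z} (hρ : LiftsPlots ρ) (h : LiftsPlots π) :
    LiftsPlots (fun x => ρ (π x)) := by
  intro n p hp r₀
  obtain ⟨V, hV, hr, q, hq, hqp⟩ := hρ n p hp r₀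
  obtain ⟨w, hw, hwo, hrw, q', hq', hqq'⟩ := h.exists_lift hV hq ⟨r₀, hr⟩
  exact ⟨w, hwo, hrw, q', hq', fun r => (congrArg ρ (hqq' r)).trans (hqp _)⟩

end LiftsPlots

/-! ### Smoothness for local paths -/

theorem LocalPath.dSmooth_eval :
    DSmooth (fun p : InitPath Y => p.1.1 ⟨p.1.2, p.2⟩) := by
  refine dSmooth_of_locally fun n p hp r₀ => ?_
  obtain ⟨V, W, hV, hW, hr, hs, hd, hsm⟩ := hp.1 r₀ ⟨(p r₀).1.2, (p r₀).2⟩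
  have ht : ContDiff ℝ ∞ (fun r => (p r).1.2) := IsPlot.contDiff hp.2
  refine ⟨V ∩ (fun r => (p r).1.2) ⁻¹' W, hV.inter (hW.preimage ht.continuous), ⟨hr, hs⟩, ?_⟩
  exact hsm.comp (dSmooth_prodMk
    (dSmooth_subtype_mk (P := fun r => r ∈ V) dSmooth_subtype_val fun r => r.2.1)
    (dSmooth_subtype_mk (P := fun s => s ∈ W) (dSmooth_restrict ht.dSmooth) fun r => r.2.2))

/-- The domains of a family of local paths vary openly. -/
def OpenDomains (Ψ : X → LocalPath Y) : Prop :=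
  ∀ (n : ℕ) (p : EuclideanSpace ℝ (Fin n) → X), IsPlot p → ∀ r₀, ∀ s₀ ∈ (Ψ (p r₀)).dom,
    ∃ (V : Set (EuclideanSpace ℝ (Fin n))) (W : Set ℝ), IsOpen V ∧ IsOpen W ∧ r₀ ∈ V ∧ s₀ ∈ W ∧
      ∀ r ∈ V, W ⊆ (Ψ (p r)).dom

theorem OpenDomains.of_dSmooth {Ψ : X → LocalPath Y} (h : DSmooth Ψ) : OpenDomains Ψ := by
  intro n p hp r₀ s₀ hs
  obtain ⟨V, W, hV, hW, hr, hs, hd, -⟩ := h n p hp r₀ ⟨s₀, hs⟩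
  exact ⟨V, W, hV, hW, hr, hs, hd⟩

theorem OpenDomains.of_const {Ψ : X → LocalPath Y} (h : ∀ x y, (Ψ x).dom = (Ψ y).dom) :
    OpenDomains Ψ := fun _ p _ r₀ _ hs =>
  ⟨Set.univ, (Ψ (p r₀)).dom, isOpen_univ, (Ψ (p r₀)).isOpen_dom, trivial, hs,
    fun _ _ => (h _ _).subset⟩

/-- A plot of the path space needs joint smoothness of the values and, separately, domains that do
not shrink suddenly; the two conditions are split here because the second is usually inherited or
trivial. -/
theorem LocalPath.dSmooth_of_eval {Ψ : X → LocalPath Y} (ho : OpenDomains Ψ)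
    (h : DSmooth (fun q : {q : X × ℝ // q.2 ∈ (Ψ q.1).dom} => Ψ q.1.1 ⟨q.1.2, q.2⟩)) :
    DSmooth Ψ := by
  intro n p hp r₀ s₀
  obtain ⟨V, W, hV, hW, hr, hs, hd⟩ := ho n p hp r₀ s₀ s₀.2
  refine ⟨V, W, hV, hW, hr, hs, hd, ?_⟩
  exact h.comp (dSmooth_subtype_mk (P := fun q : X × ℝ => q.2 ∈ (Ψ q.1).dom)
    (dSmooth_prodMk (hp.dSmooth.comp (dSmooth_subtype_val.comp dSmooth_fst))
      (dSmooth_subtype_val.comp dSmooth_snd)) fun q : V × W => hd q.1 q.1.2 q.2.2)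

theorem SmoothMap.dSmooth_eval : DSmooth (fun p : SmoothMap X Y × X => p.1 p.2) := by
  intro n p hp
  have h : DSmooth (fun q : EuclideanSpace ℝ (Fin n) × X => (p q.1).1 q.2) := hp.1
  exact (h.comp (dSmooth_prodMk dSmooth_id hp.2.dSmooth)).isPlot

theorem SmoothMap.dSmooth_of_eval {Ψ : Z → SmoothMap X Y}
    (h : DSmooth (fun q : Z × X => Ψ q.1 q.2)) : DSmooth Ψ := fun _ _ hp =>
  h.comp (dSmooth_prodMk (hp.dSmooth.comp dSmooth_fst) dSmooth_snd)

end Tools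

/-! ### Smooth real functions on diffeological spaces -/

section RealTools

variable {X : Type*} [DiffeologicalSpace X] {f g : X → ℝ}

theorem dSmooth_real_add (hf : DSmooth f) (hg : DSmooth g) : DSmooth (fun x => f x + g x) :=
  fun n p hp => ((IsPlot.contDiff (hf n p hp)).add (IsPlot.contDiff (hg n p hp))).isPlot

theorem dSmooth_real_sub (hf : DSmooth f) (hg : DSmooth g) : DSmooth (fun x => f x - g x) :=
  fun n p hp => ((IsPlot.contDiff (hf n p hp)).sub (IsPlot.contDiff (hg n p hp))).isPlot

theorem dSmooth_real_mul (hf : DSmooth f) (hg : DSmooth g) : DSmooth (fun x => f x * g x) :=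
  fun n p hp => ((IsPlot.contDiff (hf n p hp)).mul (IsPlot.contDiff (hg n p hp))).isPlot

theorem dSmooth_clamp_bump (hf : DSmooth f) : DSmooth (fun x => clamp (SitPath.bump (f x))) :=
  fun n p hp => isPlot_unitInterval (SitPath.contDiff_bump.comp (IsPlot.contDiff (hf n p hp)))
    fun _ => ⟨SitPath.bump_nonneg _, SitPath.bump_le_one _⟩

end RealTools

/-- `bump` is constant on each side of `[0,1]`, so the corners of `clamp` disappear behind it. -/
theorem SitPath.bump_clamp (t : ℝ) : SitPath.bump (clamp t : unitInterval) = SitPath.bump t := by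
  rcases le_total t 0 with h0 | h0
  · rw [show (clamp t : unitInterval) = 0 from Set.projIcc_of_le_left _ h0, Set.Icc.coe_zero,
      bump_of_le (by norm_num), bump_of_le (by linarith)]
  rcases le_total t 1 with h1 | h1
  · rw [coe_clamp h0 h1]
  · rw [show (clamp t : unitInterval) = 1 from Set.projIcc_of_right_le _ h1, Set.Icc.coe_one,
      bump_of_ge (by norm_num), bump_of_ge (by linarith)]

/-! ### Path classes: dependence on end points and smooth concatenation -/

section Classes

variable {X Y Z : Type*} [DiffeologicalSpace X] [DiffeologicalSpace Y] [DiffeologicalSpace Z]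

/-- The reparameterization `t ↦ bump t` of the unit interval. -/
def bumpMap : SmoothMap unitInterval unitInterval :=
  ⟨fun t => clamp (SitPath.bump t), SitPath.bump_smooth⟩

theorem bumpMap_zero : bumpMap 0 = 0 := by
  change clamp (SitPath.bump _) = _
  rw [Set.Icc.coe_zero, SitPath.bump_of_le (by norm_num), clamp_zero]

theorem bumpMap_one : bumpMap 1 = 1 := by
  change clamp (SitPath.bump _) = _
  rw [Set.Icc.coe_one, SitPath.bump_of_ge (by norm_num), clamp_one]

namespace PathClass

theorem liftsPlots_mk : LiftsPlots (mk (X := X)) := liftsPlots_quotMk _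

theorem dSmooth_mk : DSmooth (mk (X := X)) := dSmooth_quotMk _

/-- Flattening by `bump` is an admissible reparameterization, so any representative may be replaced
by one that is constant on the outer thirds. -/
theorem mk_ofSmooth (α : SitPath X) : mk (SitPath.ofSmooth α.1) = mk α :=
  Quot.sound (.reparam _ α bumpMap bumpMap_zero bumpMap_one fun _ => rfl)

theorem reverse_comp (η : SitPath X) : comp (mk η.reverse) (mk η) = mk (.const (η 0)) := by
  have := comp_reverse η.reverse
  have hr : η.reverse.reverse = η := SitPath.ext' fun t => by
    change η (unitInterval.symm (unitInterval.symm t)) = _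
    rw [unitInterval.symm_symm]
  rwa [hr, SitPath.reverse_one] at this

/-- Retracing makes the reversed path a two-sided inverse, so path classes cancel as in a groupoid.
-/
theorem comp_left_cancel {c a b : PathClass X} (ha : a.tgt = c.src) (hb : b.tgt = c.src)
    (h : comp c a = comp c b) : a = b := by
  induction c using Quot.ind with | _ γ => ?_
  have key : ∀ d : PathClass X, d.tgt = γ 0 → comp (mk γ.reverse) (comp (mk γ) d) = d := by
    intro d hd
    rw [← comp_assoc _ _ _ hd (by simp), reverse_comp, const_comp _ _ hd]
  rw [← key a ha, ← key b hb]
  exact congrArg _ h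

theorem comp_right_cancel {c a b : PathClass X} (ha : c.tgt = a.src) (hb : c.tgt = b.src)
    (h : comp a c = comp b c) : a = b := by
  induction c using Quot.ind with | _ γ => ?_
  have key : ∀ d : PathClass X, γ 1 = d.src → comp (comp d (mk γ)) (mk γ.reverse) = d := by
    intro d hd
    have e : (mk γ.reverse).tgt = (mk γ).src := by simp
    rw [comp_assoc _ _ _ e hd, comp_reverse, comp_const _ _ hd.symm]
  rw [← key a ha, ← key b hb]
  exact congrArg (comp · (mk γ.reverse)) h

end PathClass

namespace SitPath

/-- The reparameterization `α ∘ κ`. -/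
def precomp (α : SitPath X) (κ : SitPath unitInterval) : SitPath X := κ.map α.1.toFun α.1.smooth

theorem exists_path_unitInterval (x y : unitInterval) :
    ∃ κ : SitPath unitInterval, κ 0 = x ∧ κ 1 = y := by
  have hf : ∀ t : unitInterval, (1 - (t : ℝ)) * x + t * y ∈ unitInterval := fun t =>
    (convex_Icc (0 : ℝ) 1) x.2 y.2 (sub_nonneg.2 t.2.2) t.2.1 (by ring)
  refine ⟨ofSmooth ⟨fun t => ⟨(1 - (t : ℝ)) * x + t * y, hf t⟩, dSmooth_subtype_mk ?_ hf⟩, ?_, ?_⟩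
  · exact dSmooth_real_add
      (dSmooth_real_mul (dSmooth_real_sub dSmooth_const dSmooth_subtype_val) dSmooth_const)
      (dSmooth_real_mul dSmooth_subtype_val dSmooth_const)
  · rw [ofSmooth_zero]
    exact Subtype.ext (by simp)
  · rw [ofSmooth_one]
    exact Subtype.ext (by simp)

theorem mk_precomp_comp (α : SitPath X) {κ μ : SitPath unitInterval} (e : μ 1 = κ 0) :
    (PathClass.mk (α.precomp κ)).comp (PathClass.mk (α.precomp μ)) =
      PathClass.mk (α.precomp (κ.concat μ e)) := by
  have h : (α.precomp μ) 1 = (α.precomp κ) 0 := congrArg α.1.toFun e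
  rw [PathClass.comp_mk _ _ h]
  exact congrArg PathClass.mk (map_concat α.1.toFun α.1.smooth κ μ e).symm

/-- The class of `α ∘ κ` depends only on the end points of `κ`. -/
theorem mk_precomp_eq (α : SitPath X) {κ κ' : SitPath unitInterval} (h0 : κ 0 = κ' 0)
    (h1 : κ 1 = κ' 1) : PathClass.mk (α.precomp κ) = PathClass.mk (α.precomp κ') := by
  obtain ⟨lo, lo0, lo1⟩ := exists_path_unitInterval 0 (κ 0)
  obtain ⟨hi, hi0, hi1⟩ := exists_path_unitInterval (κ 1) 1
  -- Completed by the fixed paths `lo` and `hi`, every such `μ` becomes a self-map of `[0,1]` fixing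
  -- the end points, so the completed path is in the class of `α`. Cancelling `lo` and `hi` then
  -- compares `κ` with `κ'`.
  have key : ∀ μ : SitPath unitInterval, μ 0 = κ 0 → μ 1 = κ 1 →
      (PathClass.mk (α.precomp hi)).comp
        ((PathClass.mk (α.precomp μ)).comp (PathClass.mk (α.precomp lo))) = PathClass.mk α := by
    intro μ m0 m1
    have e1 : lo 1 = μ 0 := lo1.trans m0.symm
    have e2 : (μ.concat lo e1) 1 = hi 0 := by rw [concat_one, m1, hi0]
    rw [mk_precomp_comp α e1, mk_precomp_comp α e2]
    refine Quot.sound (.reparam _ _ (hi.concat (μ.concat lo e1) e2).1 ?_ ?_ fun _ => rfl)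
    · exact (concat_zero _ _ _).trans ((concat_zero _ _ _).trans lo0)
    · exact (concat_one _ _ _).trans hi1
  have e := (key κ rfl rfl).trans (key κ' h0.symm h1.symm).symm
  have f : ∀ μ : SitPath unitInterval, μ 0 = κ 0 →
      (PathClass.mk (α.precomp lo)).tgt = (PathClass.mk (α.precomp μ)).src :=
    fun μ hμ => congrArg α.1.toFun (lo1.trans hμ.symm)
  have f' : ∀ μ : SitPath unitInterval, μ 1 = κ 1 →
      (PathClass.mk (α.precomp μ)).tgt = (PathClass.mk (α.precomp hi)).src :=
    fun μ hμ => congrArg α.1.toFun (hμ.trans hi0.symm)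
  refine PathClass.comp_right_cancel (f κ rfl) (f κ' h0.symm) (PathClass.comp_left_cancel ?_ ?_ e)
  · rw [PathClass.tgt_comp _ _ (f κ rfl)]
    exact f' κ rfl
  · rw [PathClass.tgt_comp _ _ (f κ' h0.symm)]
    exact f' κ' h1.symm

end SitPath

/-- A smooth function `ℝ → [0,1]` that vanishes near `0`, is `1` near `1` and is the identity
on `[2ε, 1-2ε]`. -/
def flattened (ε t : ℝ) : ℝ :=
  (1 - Real.smoothTransition ((t - (1 - 2 * ε)) / ε)) *
      ((clamp t : unitInterval) * Real.smoothTransition ((t - ε) / ε)) +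
    Real.smoothTransition ((t - (1 - 2 * ε)) / ε)

theorem dSmooth_flattened (ε : ℝ) : DSmooth (fun t : unitInterval => flattened ε t) := by
  have h : ∀ a : ℝ, DSmooth (fun t : unitInterval => Real.smoothTransition (((t : ℝ) - a) / ε)) :=
    fun a n p hp => by
      have hq : ContDiff ℝ ∞ (fun x => (p x : ℝ)) := IsPlot.contDiff hp
      exact ContDiff.isPlot (X := ℝ)
        (Real.smoothTransition.contDiff.comp ((hq.sub contDiff_const).div_const ε))
  have h' : DSmooth (fun t : unitInterval => ((clamp (t : ℝ) : unitInterval) : ℝ)) := by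
    have : (fun t : unitInterval => ((clamp (t : ℝ) : unitInterval) : ℝ)) =
        fun t : unitInterval => (t : ℝ) := funext fun t => coe_clamp t.2.1 t.2.2
    rw [this]
    exact dSmooth_subtype_val
  exact dSmooth_real_add (dSmooth_real_mul (dSmooth_real_sub dSmooth_const (h _))
    (dSmooth_real_mul h' (h _))) (h _)

theorem flattened_mem (ε t : ℝ) : flattened ε t ∈ Set.Icc (0 : ℝ) 1 := by
  have a0 := (clamp t).2.1
  have a1 := (clamp t).2.2
  have b0 := Real.smoothTransition.nonneg ((t - ε) / ε)
  have b1 := Real.smoothTransition.le_one ((t - ε) / ε)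
  have c0 := Real.smoothTransition.nonneg ((t - (1 - 2 * ε)) / ε)
  have c1 := Real.smoothTransition.le_one ((t - (1 - 2 * ε)) / ε)
  rw [flattened]
  have d0 := mul_nonneg a0 b0
  have d1 := mul_le_one₀ a1 b0 b1
  constructor
  · nlinarith
  · nlinarith

/-- The bound `3 * ε ≤ 1` keeps `t ≤ ε` to the left of `1 - 2 * ε`, where the second transition
starts. -/
theorem flattened_of_lt {ε t : ℝ} (hε : 0 < ε) (hε' : 3 * ε ≤ 1) (h : t ≤ ε) :
    flattened ε t = 0 := by
  rw [flattened, Real.smoothTransition.zero_of_nonpos (x := (t - ε) / ε)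
    (div_nonpos_of_nonpos_of_nonneg (by linarith) hε.le),
    Real.smoothTransition.zero_of_nonpos
      (div_nonpos_of_nonpos_of_nonneg (by linarith) hε.le)]
  simp

theorem flattened_of_gt {ε t : ℝ} (hε : 0 < ε) (h : 1 - ε ≤ t) : flattened ε t = 1 := by
  rw [flattened, Real.smoothTransition.one_of_one_le (x := (t - (1 - 2 * ε)) / ε)
    ((one_le_div hε).2 (by linarith))]
  simp

theorem flattened_of_mid {ε t : ℝ} (hε : 0 < ε) (h : 2 * ε ≤ t) (h' : t ≤ 1 - 2 * ε) :
    flattened ε t = t := by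
  rw [flattened, Real.smoothTransition.one_of_one_le (x := (t - ε) / ε)
    ((one_le_div hε).2 (by linarith)), Real.smoothTransition.zero_of_nonpos
      (div_nonpos_of_nonpos_of_nonneg (by linarith) hε.le),
    coe_clamp (by linarith) (by linarith)]
  ring

theorem dSmooth_clamp_of_mem {S : Set ℝ} (hS : S ⊆ Set.Icc 0 1) :
    DSmooth (fun t : S => (clamp t : unitInterval)) := fun _ p hp => by
  have hq : ContDiff ℝ ∞ (fun x => (p x : ℝ)) := IsPlot.contDiff hp
  exact isPlot_unitInterval hq fun x => hS (p x).2

theorem clamp_coe (t : unitInterval) : clamp (t : ℝ) = t :=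
  Subtype.ext (coe_clamp t.2.1 t.2.2)

theorem clamp_of_le {t : ℝ} (h : t ≤ 0) : (clamp t : unitInterval) = 0 :=
  Set.projIcc_of_le_left _ h

theorem clamp_of_ge {t : ℝ} (h : 1 ≤ t) : (clamp t : unitInterval) = 1 :=
  Set.projIcc_of_right_le _ h

/-- Although `clamp` is not smooth, it has corners only at the end points, near which `α` is
constant. -/
theorem SitPath.dSmooth_extend (α : SitPath X) : DSmooth (fun t : ℝ => α (clamp t)) := by
  obtain ⟨ε, hε, hα⟩ := α.2
  refine dSmooth_of_nhds dSmooth_id fun t => ?_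
  rcases le_or_gt t 0 with h | h
  · refine ⟨Set.Iio (min ε 1), isOpen_Iio, h.trans_lt (by positivity), ?_⟩
    have : (fun y : id ⁻¹' Set.Iio (min ε 1) => α (clamp y)) = fun _ => α 0 := by
      funext y
      have hy : (y : ℝ) < min ε 1 := y.2
      rcases le_or_gt (y : ℝ) 0 with h0 | h0
      · rw [clamp_of_le h0]
      · exact (hα _).1 (by
          rw [coe_clamp h0.le (hy.le.trans (min_le_right _ _))]
          exact hy.trans_le (min_le_left _ _))
    rw [this]
    exact dSmooth_const
  rcases le_or_gt 1 t with h' | h'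
  · refine ⟨Set.Ioi (max (1 - ε) 0), isOpen_Ioi, ?_, ?_⟩
    · exact lt_of_lt_of_le (max_lt (by linarith) one_pos) h'
    have : (fun y : id ⁻¹' Set.Ioi (max (1 - ε) 0) => α (clamp y)) = fun _ => α 1 := by
      funext y
      have hy : max (1 - ε) 0 < (y : ℝ) := y.2
      rcases le_or_gt 1 (y : ℝ) with h0 | h0
      · rw [clamp_of_ge h0]
      · exact (hα _).2 (by
          rw [coe_clamp ((le_max_right _ _).trans hy.le) h0.le]
          exact (le_max_left _ _).trans_lt hy)
    rw [this]
    exact dSmooth_const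
  · exact ⟨Set.Ioo 0 1, isOpen_Ioo, ⟨h, h'⟩,
      α.1.smooth.comp (dSmooth_clamp_of_mem Set.Ioo_subset_Icc_self)⟩

/-- By compactness the image of `f` keeps a positive distance from the end points of a smaller
interval in `J`. The margin `ε` leaves room for a path that stops smoothly at both ends. -/
theorem exists_bounds {J : Set ℝ} (hJ : IsOpen J) (f : SitPath J) :
    ∃ p ∈ J, ∃ q ∈ J, ∃ ε > 0, ∀ t, p + ε ≤ f t ∧ f t ≤ q - ε := by
  have hc : Continuous (fun t : ℝ => (f (clamp t) : ℝ)) :=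
    (dSmooth_subtype_val.comp f.dSmooth_extend).contDiff.continuous
  obtain ⟨a, -, ha⟩ := isCompact_Icc.exists_isMinOn (Set.nonempty_Icc.2 zero_le_one)
    (hc.continuousOn (s := Set.Icc (0 : ℝ) 1))
  obtain ⟨b, -, hb⟩ := isCompact_Icc.exists_isMaxOn (Set.nonempty_Icc.2 zero_le_one)
    (hc.continuousOn (s := Set.Icc (0 : ℝ) 1))
  obtain ⟨δ, hδ, hδJ⟩ := Metric.isOpen_iff.1 hJ _ (f (clamp a)).2
  obtain ⟨δ', hδ', hδJ'⟩ := Metric.isOpen_iff.1 hJ _ (f (clamp b)).2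
  refine ⟨f (clamp a) - δ / 2, hδJ ?_, f (clamp b) + δ' / 2, hδJ' ?_, min (δ / 2) (δ' / 2),
    by positivity, fun t => ?_⟩
  · rw [Metric.mem_ball, Real.dist_eq, abs_lt]
    constructor <;> linarith
  · rw [Metric.mem_ball, Real.dist_eq, abs_lt]
    constructor <;> linarith
  · have h1 : (f (clamp a) : ℝ) ≤ f (clamp t) := ha t.2
    have h2 : (f (clamp t) : ℝ) ≤ f (clamp b) := hb t.2
    rw [clamp_coe] at h1 h2
    have := min_le_left (δ / 2) (δ' / 2)
    have := min_le_right (δ / 2) (δ' / 2)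
    constructor <;> linarith

/-- Finitely many paths in an open interval factor through one path in it. -/
theorem exists_factorization {J : Set ℝ} (hJ : IsOpen J) (hJ' : J.OrdConnected) (f g : SitPath J) :
    ∃ (ρ : SitPath J) (κ μ : SitPath unitInterval), ρ.precomp κ = f ∧ ρ.precomp μ = g ∧
      ∀ t, f t = g t → κ t = μ t := by
  obtain ⟨p, hp, q, hq, ε, hε, hf⟩ := exists_bounds hJ f
  obtain ⟨p', hp', q', hq', ε', hε', hg⟩ := exists_bounds hJ g
  obtain ⟨m, hm, hmp, hmp'⟩ : ∃ m ∈ J, m ≤ p ∧ m ≤ p' := by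
    rcases le_total p p' with h | h
    exacts [⟨p, hp, le_rfl, h⟩, ⟨p', hp', h, le_rfl⟩]
  obtain ⟨M, hM, hqM, hqM'⟩ : ∃ M ∈ J, q ≤ M ∧ q' ≤ M := by
    rcases le_total q q' with h | h
    exacts [⟨q', hq', h, le_rfl⟩, ⟨q, hq, le_rfl, h⟩]
  have hmM : 0 < M - m := by linarith [(hf 0).1, (hf 0).2]
  -- The common factor `ρ` runs affinely from `m` to `M` except on two end pieces of parameter
  -- length `2 * η`. Their image has length at most `min ε ε'`, hence lies in the margins avoided by
  -- `f` and `g`; the bound `1 / 3` is needed by `flattened_of_lt`.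
  set η := min (1 / 3) (min ε ε' / (2 * (M - m))) with hη
  have hη0 : 0 < η := by positivity
  have hη3 : η ≤ 1 / 3 := min_le_left _ _
  have hη2 : 2 * η * (M - m) ≤ min ε ε' := by
    have : η ≤ min ε ε' / (2 * (M - m)) := min_le_right _ _
    rw [le_div_iff₀ (by positivity)] at this
    linarith
  have hmem : ∀ t : unitInterval, m + (M - m) * flattened η t ∈ J := fun t => by
    obtain ⟨h0, h1⟩ := flattened_mem η t
    exact hJ'.out hm hM ⟨by nlinarith, by nlinarith⟩
  let ρ : SitPath J := ⟨⟨fun t => ⟨m + (M - m) * flattened η t, hmem t⟩,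
    dSmooth_subtype_mk (dSmooth_real_add dSmooth_const
      (dSmooth_real_mul dSmooth_const (dSmooth_flattened η))) hmem⟩, η, hη0, fun t =>
    ⟨fun ht => Subtype.ext (by
      change m + (M - m) * flattened η t = m + (M - m) * flattened η (0 : unitInterval)
      rw [flattened_of_lt hη0 (by linarith) ht.le,
        flattened_of_lt hη0 (by linarith) (by rw [Set.Icc.coe_zero]; exact hη0.le)]),
    fun ht => Subtype.ext (by
      change m + (M - m) * flattened η t = m + (M - m) * flattened η (1 : unitInterval)
      rw [flattened_of_gt hη0 ht.le,
        flattened_of_gt hη0 (by rw [Set.Icc.coe_one]; linarith)])⟩⟩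
  -- Away from the margins `ρ` is affine, so the inverse affine map applied to `φ` provides the
  -- factor; it is constant near the end points because `φ` is.
  have key : ∀ φ : SitPath J, (∀ t, m + min ε ε' ≤ φ t ∧ φ t ≤ M - min ε ε') →
      ∃ κ : SitPath unitInterval, ρ.precomp κ = φ ∧
        ∀ t, (κ t : ℝ) = ((φ t : ℝ) - m) * (M - m)⁻¹ := by
    intro φ hφ
    have hk : ∀ t, 2 * η ≤ ((φ t : ℝ) - m) / (M - m) ∧ ((φ t : ℝ) - m) / (M - m) ≤ 1 - 2 * η :=
      fun t => ⟨by rw [le_div_iff₀ hmM]; linarith [(hφ t).1],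
        by rw [div_le_iff₀ hmM]; linarith [(hφ t).2]⟩
    have hk' : ∀ t, ((φ t : ℝ) - m) * (M - m)⁻¹ ∈ unitInterval := fun t => by
      have := hk t
      rw [← div_eq_mul_inv]
      exact ⟨by linarith, by linarith⟩
    obtain ⟨δ, hδ, hs⟩ := φ.2
    refine ⟨⟨⟨fun t => ⟨((φ t : ℝ) - m) * (M - m)⁻¹, hk' t⟩, dSmooth_subtype_mk
      (dSmooth_real_mul (dSmooth_real_sub (dSmooth_subtype_val.comp φ.1.smooth) dSmooth_const)
        dSmooth_const) hk'⟩, δ, hδ, fun t => ⟨fun ht => ?_, fun ht => ?_⟩⟩,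
      SitPath.ext' fun t => Subtype.ext ?_, fun t => rfl⟩
    · exact Subtype.ext (congrArg (fun x : J => ((x : ℝ) - m) * (M - m)⁻¹) ((hs t).1 ht))
    · exact Subtype.ext (congrArg (fun x : J => ((x : ℝ) - m) * (M - m)⁻¹) ((hs t).2 ht))
    · change m + (M - m) * flattened η (((φ t : ℝ) - m) * (M - m)⁻¹) = φ t
      rw [← div_eq_mul_inv, flattened_of_mid hη0 (hk t).1 (hk t).2, mul_div_cancel₀ _ hmM.ne']
      ring
  obtain ⟨κ, hκ, hκ'⟩ := key f fun t => by
    have := hf t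
    have := min_le_left ε ε'
    constructor <;> linarith
  obtain ⟨μ, hμ, hμ'⟩ := key g fun t => by
    have := hg t
    have := min_le_right ε ε'
    constructor <;> linarith
  exact ⟨ρ, κ, μ, hκ, hμ, fun t ht => Subtype.ext (by rw [hκ', hμ', ht])⟩

/-- The class of `α ∘ f` depends only on the end points of the path `f` in the interval on which
`α` is defined. -/
theorem LocalPath.mk_map_eq (α : LocalPath X) {f g : SitPath α.dom} (h0 : f 0 = g 0)
    (h1 : f 1 = g 1) :
    PathClass.mk (f.map α.toFun α.smooth) = PathClass.mk (g.map α.toFun α.smooth) := by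
  obtain ⟨ρ, κ, μ, rfl, rfl, h⟩ := exists_factorization α.isOpen_dom α.ordConnected_dom f g
  exact (ρ.map α.toFun α.smooth).mk_precomp_eq (h 0 h0) (h 1 h1)

theorem LocalPath.affine_mem (α : LocalPath X) (r s : α.dom) (t : unitInterval) :
    (t : ℝ) * s + (1 - (t : ℝ)) * r ∈ α.dom := by
  have := α.ordConnected_dom.convex s.2 r.2 t.2.1 (sub_nonneg.2 t.2.2) (by ring)
  simpa using this

/-- The affine path from `r` to `s` in an interval. -/
def LocalPath.affine (α : LocalPath X) (r s : α.dom) : SmoothMap unitInterval α.dom where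
  toFun t := ⟨t * s + (1 - t) * r, α.affine_mem r s t⟩
  smooth := dSmooth_subtype_mk (P := fun x => x ∈ α.dom) (dSmooth_real_add
    (dSmooth_real_mul dSmooth_subtype_val dSmooth_const)
    (dSmooth_real_mul (dSmooth_real_sub dSmooth_const dSmooth_subtype_val) dSmooth_const))
    (α.affine_mem r s)

/-- The class of the restriction of `α` to the interval from `r` to `s`. -/
def LocalPath.segClass (α : LocalPath X) (r s : α.dom) : PathClass X :=
  PathClass.ofSmooth (α.segment r s)

section segClass

variable (α : LocalPath X)

theorem LocalPath.affine_zero (r s : α.dom) : α.affine r s 0 = r :=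
  Subtype.ext (by simp [affine])

theorem LocalPath.affine_one (r s : α.dom) : α.affine r s 1 = s :=
  Subtype.ext (by simp [affine])

theorem LocalPath.src_segClass (r s : α.dom) : (α.segClass r s).src = α r :=
  (SitPath.ofSmooth_zero _).trans (α.segment_zero r s)

theorem LocalPath.tgt_segClass (r s : α.dom) : (α.segClass r s).tgt = α s :=
  (SitPath.ofSmooth_one _).trans (α.segment_one r s)

/-- The affine path from `r` to `s` may be replaced by any other path in the domain, for instance by
a concatenation. -/
theorem LocalPath.segClass_eq {r s : α.dom} (f : SitPath α.dom) (h0 : f 0 = r) (h1 : f 1 = s) :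
    α.segClass r s = PathClass.mk (f.map α.toFun α.smooth) := by
  refine α.mk_map_eq (f := SitPath.ofSmooth (α.affine r s)) ?_ ?_
  · rw [SitPath.ofSmooth_zero, α.affine_zero, h0]
  · rw [SitPath.ofSmooth_one, α.affine_one, h1]

theorem LocalPath.segClass_self (r : α.dom) :
    α.segClass r r = PathClass.mk (.const (α r)) :=
  α.segClass_eq (.const r) rfl rfl

/-- Both sides come from paths from `r` to `t` in the same interval. This holds even if `s` does not
lie between `r` and `t`. -/
theorem LocalPath.segClass_comp (r s t : α.dom) :
    (α.segClass s t).comp (α.segClass r s) = α.segClass r t := by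
  have e : SitPath.ofSmooth (α.affine r s) 1 = SitPath.ofSmooth (α.affine s t) 0 := by
    rw [SitPath.ofSmooth_one, SitPath.ofSmooth_zero, α.affine_zero, α.affine_one]
  rw [α.segClass_eq (r := r) (s := t) ((SitPath.ofSmooth (α.affine s t)).concat _ e)
    (by rw [SitPath.concat_zero, SitPath.ofSmooth_zero, α.affine_zero])
    (by rw [SitPath.concat_one, SitPath.ofSmooth_one, α.affine_one]), SitPath.map_concat]
  exact PathClass.comp_mk _ _ (congrArg α.toFun e)

theorem LocalPath.segClass_reparam (f : LocalPath α.dom) (r s : f.dom) :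
    (α.reparam f).segClass r s = α.segClass (f r) (f s) := by
  symm
  refine α.segClass_eq ((SitPath.ofSmooth (f.affine r s)).map f.toFun f.smooth) ?_ ?_
  · exact congrArg f.toFun ((SitPath.ofSmooth_zero _).trans (f.affine_zero _ _))
  · exact congrArg f.toFun ((SitPath.ofSmooth_one _).trans (f.affine_one _ _))

end segClass

theorem SitPath.dSmooth_ofSmooth : DSmooth (SitPath.ofSmooth (X := X)) :=
  dSmooth_subtype_mk (f := fun α : SmoothMap unitInterval X =>
      (⟨fun t => α (clamp (bump t)), α.smooth.comp bump_smooth⟩ : SmoothMap unitInterval X))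
    (SmoothMap.dSmooth_of_eval (SmoothMap.dSmooth_eval.comp (dSmooth_prodMk dSmooth_fst
      (bump_smooth.comp dSmooth_snd)))) _

theorem PathClass.dSmooth_ofSmooth : DSmooth (PathClass.ofSmooth (X := X)) :=
  PathClass.dSmooth_mk.comp SitPath.dSmooth_ofSmooth

/-- Joint smoothness in the path and in both times; the smoothness axiom for `Θ^H` rests on it. -/
theorem LocalPath.dSmooth_segClass :
    DSmooth (fun q : {q : InitPath X × ℝ // q.2 ∈ q.1.1.1.dom} =>
      q.1.1.1.1.segClass ⟨q.1.1.1.2, q.1.1.2⟩ ⟨q.1.2, q.2⟩) := by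
  refine PathClass.dSmooth_ofSmooth.comp (SmoothMap.dSmooth_of_eval ?_)
  refine LocalPath.dSmooth_eval.comp (dSmooth_subtype_mk
    (P := fun p : LocalPath X × ℝ => p.2 ∈ p.1.dom) (f := fun z :
      {q : InitPath X × ℝ // q.2 ∈ q.1.1.1.dom} × unitInterval =>
        (z.1.1.1.1.1, (z.2 : ℝ) * z.1.1.2 + (1 - (z.2 : ℝ)) * z.1.1.1.1.2)) ?_ fun z =>
    (z.1.1.1.1.1.affine ⟨z.1.1.1.1.2, z.1.1.1.2⟩ ⟨z.1.1.2, z.1.2⟩ z.2).2)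
  have hq : DSmooth (fun z : {q : InitPath X × ℝ // q.2 ∈ q.1.1.1.dom} × unitInterval => z.1.1) :=
    dSmooth_subtype_val.comp dSmooth_fst
  have hp := dSmooth_subtype_val.comp (dSmooth_fst.comp hq)
  have ht : DSmooth (fun z : {q : InitPath X × ℝ // q.2 ∈ q.1.1.1.dom} × unitInterval =>
    (z.2 : ℝ)) := dSmooth_subtype_val.comp dSmooth_snd
  exact dSmooth_prodMk (dSmooth_fst.comp hp) (dSmooth_real_add
    (dSmooth_real_mul ht (dSmooth_snd.comp hq))
    (dSmooth_real_mul (dSmooth_real_sub dSmooth_const ht) (dSmooth_snd.comp hp)))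

/-- Concatenation is smooth in families of paths that are constant on the outer thirds. -/
theorem dSmooth_concatFun_ofSmooth {β α : Z → SmoothMap unitInterval X} (hβ : DSmooth β)
    (hα : DSmooth α) (h : ∀ z, α z 1 = β z 0) :
    DSmooth (fun q : Z × unitInterval =>
      concatFun (SitPath.ofSmooth (β q.1)).1.toFun (SitPath.ofSmooth (α q.1)).1.toFun q.2) := by
  have ht : DSmooth (fun q : Z × unitInterval => (q.2 : ℝ)) := dSmooth_subtype_val.comp dSmooth_snd
  -- Because `bump` is constant up to `1 / 3` and from `2 / 3` on, each of the two formulas stays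
  -- valid beyond `t = 1 / 2`; they overlap for `1 / 3 < t < 2 / 3`, which avoids any gluing at the
  -- midpoint.
  have h1 : ∀ (z : Z) (t : unitInterval), (t : ℝ) < 2 / 3 →
      concatFun (SitPath.ofSmooth (β z)).1.toFun (SitPath.ofSmooth (α z)).1.toFun t =
        α z (clamp (SitPath.bump (2 * t))) := by
    intro z t hz
    rw [concatFun]
    split_ifs with hlt
    · change α z (clamp (SitPath.bump (clamp _))) = _
      rw [SitPath.bump_clamp]
    · change β z (clamp (SitPath.bump (clamp _))) = _
      rw [SitPath.bump_clamp, SitPath.bump_of_le (by linarith), SitPath.bump_of_ge (by linarith),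
        clamp_zero, clamp_one, h]
  have h2 : ∀ (z : Z) (t : unitInterval), 1 / 3 < (t : ℝ) →
      concatFun (SitPath.ofSmooth (β z)).1.toFun (SitPath.ofSmooth (α z)).1.toFun t =
        β z (clamp (SitPath.bump (2 * t - 1))) := by
    intro z t hz
    rw [concatFun]
    split_ifs with hlt
    · change α z (clamp (SitPath.bump (clamp _))) = _
      rw [SitPath.bump_clamp, SitPath.bump_of_le (t := 2 * (t : ℝ) - 1) (by linarith),
        SitPath.bump_of_ge (by linarith), clamp_zero, clamp_one, h]
    · change β z (clamp (SitPath.bump (clamp _))) = _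
      rw [SitPath.bump_clamp]
  refine dSmooth_of_nhds ht fun q => ?_
  rcases lt_or_ge (q.2 : ℝ) (1 / 2) with hq | hq
  · refine ⟨Set.Iio (2 / 3), isOpen_Iio, lt_trans hq (by norm_num), ?_⟩
    have := (SmoothMap.dSmooth_eval (X := unitInterval) (Y := X)).comp
      (dSmooth_prodMk (hα.comp dSmooth_fst)
      (dSmooth_clamp_bump (dSmooth_real_mul (dSmooth_const (y := 2)) ht)))
    convert dSmooth_restrict this using 2 with y
    exact h1 _ _ y.2
  · refine ⟨Set.Ioi (1 / 3), isOpen_Ioi, lt_of_lt_of_le (by norm_num) hq, ?_⟩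
    have := (SmoothMap.dSmooth_eval (X := unitInterval) (Y := X)).comp
      (dSmooth_prodMk (hβ.comp dSmooth_fst)
      (dSmooth_clamp_bump (dSmooth_real_sub (dSmooth_real_mul (dSmooth_const (y := 2)) ht)
        (dSmooth_const (y := 1)))))
    convert dSmooth_restrict this using 2 with y
    exact h2 _ _ y.2

/-- Concatenation of composable path classes is smooth. -/
theorem PathClass.dSmooth_comp {b a : Z → PathClass X} (hb : DSmooth b) (ha : DSmooth a)
    (h : ∀ z, (a z).tgt = (b z).src) : DSmooth (fun z => (b z).comp (a z)) := by
  refine dSmooth_of_locally fun n p hp r₀ => ?_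
  obtain ⟨V, hV, hr, q, hq, hqb⟩ := liftsPlots_mk n _ (hb n p hp) r₀
  obtain ⟨W, hW, hr', q', hq', hqa⟩ := liftsPlots_mk n _ (ha n p hp) r₀
  refine ⟨V ∩ W, hV.inter hW, ⟨hr, hr'⟩, ?_⟩
  -- The intervals on which the lifted representatives are constant may vary wildly with `r`.
  -- Flattening them by `ofSmooth` makes these intervals uniform and preserves the classes.
  let β : ↑(V ∩ W) → SmoothMap unitInterval X := fun r => (q ⟨r, r.2.1⟩).1
  let α : ↑(V ∩ W) → SmoothMap unitInterval X := fun r => (q' ⟨r, r.2.2⟩).1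
  have hβ : DSmooth β :=
    dSmooth_subtype_val.comp (hq.comp (dSmooth_inclusion Set.inter_subset_left))
  have hα : DSmooth α :=
    dSmooth_subtype_val.comp (hq'.comp (dSmooth_inclusion Set.inter_subset_right))
  have hαβ : ∀ r, α r 1 = β r 0 := fun r => by
    have := h (p r)
    rw [← Function.comp_apply (f := a), ← Function.comp_apply (f := b), ← hqb ⟨r, r.2.1⟩,
      ← hqa ⟨r, r.2.2⟩] at this
    exact this
  have hs : ∀ r, SitPath.ofSmooth (α r) 1 = SitPath.ofSmooth (β r) 0 := fun r => by
    rw [SitPath.ofSmooth_one, SitPath.ofSmooth_zero, hαβ]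
  have key : DSmooth (fun r : ↑(V ∩ W) => PathClass.mk
      ((SitPath.ofSmooth (β r)).concat (SitPath.ofSmooth (α r)) (hs r))) :=
    dSmooth_mk.comp (dSmooth_subtype_mk (f := fun r : ↑(V ∩ W) =>
      ((SitPath.ofSmooth (β r)).concat (SitPath.ofSmooth (α r)) (hs r)).1)
      (SmoothMap.dSmooth_of_eval (dSmooth_concatFun_ofSmooth hβ hα hαβ)) _)
  convert key using 2 with r
  rw [← PathClass.comp_mk, mk_ofSmooth, mk_ofSmooth]
  exact congrArg₂ comp (hqb ⟨r, r.2.1⟩).symm (hqa ⟨r, r.2.2⟩).symm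

end Classes

/-! ### Criteria for principal bundles -/

section Principal

variable {E X X' Y Y' G : Type*} [DiffeologicalSpace E] [DiffeologicalSpace X]
  [DiffeologicalSpace X'] [DiffeologicalSpace Y] [DiffeologicalSpace Y']

theorem LiftsPlots.of_comp {π : X → Y} {ρ : Y → Y'} (hπ : DSmooth π)
    (h : LiftsPlots (fun x => ρ (π x))) : LiftsPlots ρ := by
  intro n p hp r₀
  obtain ⟨V, hV, hr, q, hq, hqp⟩ := h n p hp r₀
  exact ⟨V, hV, hr, fun r => π (q r), hπ.comp hq, hqp⟩

theorem LiftsPlots.prodMap {π : X → Y} {π' : X' → Y'} (h : LiftsPlots π) (h' : LiftsPlots π') :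
    LiftsPlots (Prod.map π π') := by
  intro n p hp r₀
  obtain ⟨V, hV, hr, q, hq, hqp⟩ := h n _ hp.1 r₀
  obtain ⟨W, hW, hr', q', hq', hqp'⟩ := h' n _ hp.2 r₀
  exact ⟨V ∩ W, hV.inter hW, ⟨hr, hr'⟩, fun r => (q ⟨r, r.2.1⟩, q' ⟨r, r.2.2⟩),
    dSmooth_prodMk (hq.comp (dSmooth_inclusion Set.inter_subset_left))
      (hq'.comp (dSmooth_inclusion Set.inter_subset_right)),
    fun r => Prod.ext (hqp _) (hqp' _)⟩

theorem liftsPlots_id : LiftsPlots (id : X → X) := fun _ _ hp _ =>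
  ⟨Set.univ, isOpen_univ, trivial, _, dSmooth_restrict hp.dSmooth, fun _ => rfl⟩

/-- A smooth surjection that lifts plots and whose fibres are the orbits of an action identifies
the base with the orbit space. -/
theorem exists_quotient_diffeo {act : E → G → E} {π : E → X} (hπ : DSmooth π)
    (hl : LiftsPlots π) (hs : Function.Surjective π) (ho : ∀ ξ g, π (act ξ g) = π ξ)
    (hf : ∀ ξ η, π ξ = π η → ∃ g, η = act ξ g) :
    ∃ Φ : X ≃ Quot (OrbitRel act), DSmooth Φ ∧ DSmooth Φ.symm ∧ ∀ ξ, Φ (π ξ) = Quot.mk _ ξ := by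
  have key : ∀ ξ, Quot.mk (OrbitRel act) (Function.surjInv hs (π ξ)) = Quot.mk _ ξ :=
    fun ξ => Quot.sound (hf _ _ (Function.surjInv_eq hs _))
  let Φ : X ≃ Quot (OrbitRel act) :=
    { toFun := fun x => Quot.mk _ (Function.surjInv hs x)
      invFun := Quot.lift π (by rintro ξ _ ⟨g, rfl⟩; exact (ho ξ g).symm)
      left_inv := Function.surjInv_eq hs
      right_inv := by
        intro y
        induction y using Quot.ind with | _ ξ => exact key ξ }
  refine ⟨Φ, hl.dSmooth_of_comp ?_, dSmooth_of_comp_quotMk hπ, key⟩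
  have : (fun ξ => Φ (π ξ)) = Quot.mk _ := funext key
  rw [this]
  exact dSmooth_quotMk _

variable [DiffeologicalSpace G]

/-- The inverse of the graph map sends `(ξ, η)` to the element `g` with `η = ξ g`. Freeness makes it
unique, so any local smooth choice of such elements along a plot computes it. -/
theorem isDiffeoOntoImage_graph {act : E → G → E}
    (hs : DSmooth (fun p : E × G => act p.1 p.2))
    (hinj : ∀ ξ g h, act ξ g = act ξ h → g = h)
    (hd : ∀ (n : ℕ) (p : EuclideanSpace ℝ (Fin n) → E × E), IsPlot p →
      (∀ r, ∃ g, (p r).2 = act (p r).1 g) → ∀ r₀,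
      ∃ V : Set (EuclideanSpace ℝ (Fin n)), IsOpen V ∧ r₀ ∈ V ∧
        ∃ ρ : V → G, DSmooth ρ ∧ ∀ r : V, (p r).2 = act (p r).1 (ρ r)) :
    IsDiffeoOntoImage (fun p : E × G => (p.1, act p.1 p.2)) := by
  refine ⟨dSmooth_prodMk dSmooth_fst hs, ?_⟩
  have h : ∀ y : Set.range (fun p : E × G => (p.1, act p.1 p.2)), ∃ g, y.1.2 = act y.1.1 g := by
    rintro ⟨_, ⟨p, rfl⟩⟩
    exact ⟨p.2, rfl⟩
  choose d hdd using h
  refine ⟨fun y => (y.1.1, d y), dSmooth_prodMk (dSmooth_fst.comp dSmooth_subtype_val) ?_,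
    fun p => Prod.ext rfl (hinj p.1 _ _ (hdd ⟨(p.1, act p.1 p.2), p, rfl⟩).symm)⟩
  refine dSmooth_of_locally fun n p hp r₀ => ?_
  obtain ⟨V, hV, hr, ρ, hρ, h⟩ := hd n (fun r => (p r).1) hp (fun r => ⟨_, hdd (p r)⟩) r₀
  refine ⟨V, hV, hr, ?_⟩
  convert hρ using 2 with r
  exact hinj _ _ _ ((hdd _).symm.trans (h r))

end Principal

/-! ### Path classes with fixed starting point -/

section PointedPaths

variable {X : Type*} [DiffeologicalSpace X]

theorem LocalPath.segClass_congr {Y : Type*} [DiffeologicalSpace Y] {β : LocalPath Y}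
    {f g : β.dom → X} {hf : DSmooth f} {hg : DSmooth g} (r s : β.dom) (h : ∀ t, f t = g t) :
    (β.withFun f hf).segClass r s = (β.withFun g hg).segClass r s := by
  obtain rfl : f = g := funext h
  rfl

theorem PointedPaths.exists_tgt_eq (h : IsDPathConnected X) (x y : X) :
    ∃ a : PointedPaths x, a.1.tgt = y := by
  obtain ⟨α, s, t, hs, ht⟩ := h x y
  exact ⟨⟨α.segClass s t, (α.src_segClass s t).trans hs⟩, (α.tgt_segClass s t).trans ht⟩

/-- In a path-connected space the end point map `ℱ_x(X) → X` lifts plots. -/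
theorem PointedPaths.liftsPlots_tgt (h : IsDPathConnected X) (x : X) :
    LiftsPlots (fun a : PointedPaths x => a.1.tgt) := by
  intro n p hp r₀
  obtain ⟨a, ha⟩ := exists_tgt_eq h x (p r₀)
  -- The plot is lifted by prolonging a fixed class `a` ending at `p r₀` by the radial paths `t ↦ p
  -- (r₀ + t (r - r₀))`, which depend smoothly on `r`.
  have hF : DSmooth (fun q : EuclideanSpace ℝ (Fin n) × unitInterval =>
      p (r₀ + (q.2 : ℝ) • (q.1 - r₀))) := by
    refine hp.dSmooth.comp fun m f hf => ?_
    have h1 : ContDiff ℝ ∞ (fun y => (f y).1) := IsPlot.contDiff hf.1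
    have h2 : ContDiff ℝ ∞ (fun y => ((f y).2 : ℝ)) := IsPlot.contDiff hf.2
    exact ContDiff.isPlot (contDiff_const.add (h2.smul (h1.sub contDiff_const)))
  let σ : EuclideanSpace ℝ (Fin n) → SmoothMap unitInterval X := fun r =>
    ⟨fun t => p (r₀ + (t : ℝ) • (r - r₀)), hF.comp (dSmooth_prodMk dSmooth_const dSmooth_id)⟩
  have hσ : DSmooth σ := SmoothMap.dSmooth_of_eval hF
  have h0 : ∀ r, a.1.tgt = (PathClass.ofSmooth (σ r)).src := fun r => by
    refine ha.trans (Eq.trans ?_ (SitPath.ofSmooth_zero (σ r)).symm)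
    change _ = p (r₀ + ((0 : unitInterval) : ℝ) • (r - r₀))
    rw [Set.Icc.coe_zero, zero_smul, add_zero]
  have h1 : ∀ r, (PathClass.ofSmooth (σ r)).tgt = p r := fun r => by
    refine (SitPath.ofSmooth_one (σ r)).trans ?_
    change p (r₀ + ((1 : unitInterval) : ℝ) • (r - r₀)) = _
    rw [Set.Icc.coe_one, one_smul, add_sub_cancel]
  refine ⟨Set.univ, isOpen_univ, trivial,
    fun r => ⟨(PathClass.ofSmooth (σ r)).comp a.1, (PathClass.src_comp _ _).trans a.2⟩,
    dSmooth_subtype_mk (P := fun a : PathClass X => a.src = x)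
      (dSmooth_restrict (PathClass.dSmooth_comp (PathClass.dSmooth_ofSmooth.comp hσ) dSmooth_const
        h0)) _, fun r => (PathClass.tgt_comp _ _ (h0 r)).trans (h1 r)⟩

theorem PointedPaths.mulLoop_one {x : X} (a : PointedPaths x) : a.mulLoop 1 = a :=
  Subtype.ext (PathClass.comp_const _ _ a.2)

theorem PointedPaths.mulLoop_mul {x : X} (a : PointedPaths x) (γ δ : LoopGroup x) :
    a.mulLoop (γ * δ) = (a.mulLoop γ).mulLoop δ :=
  Subtype.ext (PathClass.comp_assoc _ _ _ (δ.2.2.trans γ.2.1.symm) (γ.2.2.trans a.2.symm)).symm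

/-- Freeness of the action of the loop group on pointed classes. -/
theorem PointedPaths.mulLoop_cancel {x : X} {a : PointedPaths x} {γ : LoopGroup x}
    (h : a.mulLoop γ = a) : γ = 1 := by
  refine Subtype.ext (PathClass.comp_left_cancel (c := a.1) (γ.2.2.trans a.2.symm) a.2.symm ?_)
  exact (congrArg Subtype.val h).trans (congrArg Subtype.val a.mulLoop_one).symm

/-- Paths that start at `x` and are constant near the end points. -/
abbrev PointedSit (x : X) : Type _ := {α : SitPath X // α 0 = x}

/-- The class of a pointed path. -/
def PointedSit.cls {x : X} (α : PointedSit x) : PointedPaths x := ⟨PathClass.mk α.1, α.2⟩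

/-- Reversal is defined on paths, so two classes with the same end point are compared on
representatives; smooth representatives exist locally. -/
theorem PointedSit.liftsPlots_cls (x : X) : LiftsPlots (PointedSit.cls (x := x)) := by
  intro n p hp r₀
  obtain ⟨V, hV, hr, q, hq, hqp⟩ := PathClass.liftsPlots_mk n (fun r => (p r).1) hp r₀
  exact ⟨V, hV, hr, fun r => ⟨q r, (congrArg PathClass.src (hqp r)).trans (p r).2⟩,
    dSmooth_subtype_mk (P := fun α : SitPath X => α 0 = x) hq _, fun r => Subtype.ext (hqp r)⟩

theorem PointedSit.reverse_src {x : X} (α β : PointedSit x) (h : α.1 1 = β.1 1) :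
    (PathClass.mk β.1).tgt = (PathClass.mk α.1.reverse).src :=
  h.symm.trans (SitPath.reverse_zero _).symm

/-- The loop `α⁻ ∨ β`. -/
def PointedSit.diff {x : X} (α β : PointedSit x) (h : α.1 1 = β.1 1) : LoopGroup x :=
  ⟨(PathClass.mk α.1.reverse).comp (PathClass.mk β.1), (PathClass.src_comp _ _).trans β.2,
    (PathClass.tgt_comp _ _ (reverse_src α β h)).trans ((SitPath.reverse_one _).trans α.2)⟩

/-- Retracing turns `α ∨ α⁻ ∨ β` into `β`; thus `diff` is division for the action of loops on a
fibre of the end point map. -/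
theorem PointedSit.cls_mulLoop_diff {x : X} (α β : PointedSit x) (h : α.1 1 = β.1 1) :
    α.cls.mulLoop (α.diff β h) = β.cls := by
  refine Subtype.ext ?_
  change (PathClass.mk α.1).comp ((PathClass.mk α.1.reverse).comp (PathClass.mk β.1)) = _
  have e : (PathClass.mk α.1.reverse).tgt = (PathClass.mk α.1).src := SitPath.reverse_one _
  rw [← PathClass.comp_assoc _ _ _ (reverse_src α β h) e,
    PathClass.comp_reverse]
  exact PathClass.const_comp _ _ h.symm

theorem SitPath.dSmooth_reverse : DSmooth (SitPath.reverse (X := X)) := by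
  have hs : DSmooth unitInterval.symm := dSmooth_subtype_mk (P := fun t => t ∈ unitInterval)
    (dSmooth_real_sub (dSmooth_const (y := 1)) dSmooth_subtype_val) fun t => (unitInterval.symm t).2
  exact dSmooth_subtype_mk (f := fun α : SitPath X => α.reverse.1)
    (SmoothMap.dSmooth_of_eval (SmoothMap.dSmooth_eval.comp
      (dSmooth_prodMk (dSmooth_subtype_val.comp dSmooth_fst) (hs.comp dSmooth_snd)))) _

theorem PointedSit.dSmooth_diff {Z : Type*} [DiffeologicalSpace Z] {x : X}
    {α β : Z → PointedSit x} (hα : DSmooth α) (hβ : DSmooth β) (h : ∀ z, (α z).1 1 = (β z).1 1) :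
    DSmooth (fun z => (α z).diff (β z) (h z)) :=
  dSmooth_subtype_mk (P := fun a : PathClass X => a.src = x ∧ a.tgt = x) (PathClass.dSmooth_comp
    (PathClass.dSmooth_mk.comp (SitPath.dSmooth_reverse.comp (dSmooth_subtype_val.comp hα)))
    (PathClass.dSmooth_mk.comp (dSmooth_subtype_val.comp hβ))
    fun z => reverse_src (α z) (β z) (h z)) _

end PointedPaths

/-! ### The associated bundle: fibres and projection -/

namespace HolObj

variable {G : Type u} [Group G] [DiffeologicalSpace G] (P : HolObj G)

/-- The relation is the orbit relation of an action of the loop group. Hence nothing has to be added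
to generate an equivalence relation, and equality in the quotient is witnessed by a single loop. -/
theorem equivalence_assocRel : Equivalence P.AssocRel where
  refl p := ⟨1, by rw [p.1.mulLoop_one, map_one, inv_one, one_mul]⟩
  symm := by
    rintro p _ ⟨γ, rfl⟩
    refine ⟨γ⁻¹, Prod.ext ?_ ?_⟩
    · exact (p.1.mulLoop_one.symm.trans (by rw [← mul_inv_cancel γ])).trans
        (p.1.mulLoop_mul γ γ⁻¹)
    · simp
  trans := by
    rintro p _ _ ⟨γ, rfl⟩ ⟨δ, rfl⟩
    exact ⟨γ * δ, Prod.ext (p.1.mulLoop_mul γ δ).symm (by simp [mul_assoc])⟩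

variable {P} in
theorem assocRel_of_eq {p q : PointedPaths P.pt × G}
    (h : (Quot.mk P.AssocRel p) = Quot.mk _ q) : P.AssocRel p q :=
  P.equivalence_assocRel.eqvGen_iff.1 (Quot.eqvGen_exact h)

/-- The element `⟦[α], g⟧` of the associated bundle. -/
def assocMk (p : PointedSit P.pt × G) : P.Assoc := Quot.mk _ (p.1.cls, p.2)

theorem liftsPlots_assocMk : LiftsPlots P.assocMk :=
  (liftsPlots_quotMk P.AssocRel).comp ((PointedSit.liftsPlots_cls P.pt).prodMap liftsPlots_id)

theorem exists_assocMk (ξ : P.Assoc) : ∃ p, P.assocMk p = ξ := by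
  obtain ⟨⟨⟨a, ha⟩, g⟩, rfl⟩ := Quot.exists_rep ξ
  obtain ⟨α, rfl⟩ := Quot.exists_rep a
  exact ⟨(⟨α, ha⟩, g), rfl⟩

/-- With `δ = [α⁻ ∨ β]` one has `⟦[α], H(δ) h⟧ = ⟦[α ∨ δ], h⟧ = ⟦[β], h⟧`. The formula gives
transitivity on fibres and, being smooth in the representatives, smoothness of division. -/
theorem assocMk_eq_act {p q : PointedSit P.pt × G} (h : p.1.1 1 = q.1.1 1) :
    P.assocMk q = P.assocAct (P.assocMk p) (p.2⁻¹ * P.hol (p.1.diff q.1 h) * q.2) := by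
  refine Eq.symm (Quot.sound ⟨p.1.diff q.1 h, Prod.ext ?_ ?_⟩)
  · exact (PointedSit.cls_mulLoop_diff _ _ h).symm
  · change q.2 = _ * (p.2 * _)
    simp [mul_assoc]

/-- A loop witnessing the equality fixes the path component, so it is trivial and the group
components agree. -/
theorem assocAct_injective (ξ : P.Assoc) (g h : G) (e : P.assocAct ξ g = P.assocAct ξ h) :
    g = h := by
  induction ξ using Quot.ind with | _ p => ?_
  obtain ⟨γ, hγ⟩ := assocRel_of_eq e
  have h1 : γ = 1 := PointedPaths.mulLoop_cancel (congrArg Prod.fst hγ).symm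
  have h2 : p.2 * h = (P.hol γ)⁻¹ * (p.2 * g) := congrArg Prod.snd hγ
  rw [h1, map_one, inv_one, one_mul] at h2
  exact (mul_left_cancel h2).symm

theorem assocProj_act (ξ : P.Assoc) (g : G) : P.assocProj (P.assocAct ξ g) = P.assocProj ξ := by
  induction ξ using Quot.ind with | _ p => rfl

theorem liftsPlots_assocProj : LiftsPlots P.assocProj :=
  LiftsPlots.of_comp (π := fun a : PointedPaths P.pt => (Quot.mk P.AssocRel (a, 1)))
    ((dSmooth_quotMk P.AssocRel).comp (dSmooth_prodMk dSmooth_id dSmooth_const))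
    (PointedPaths.liftsPlots_tgt P.pathConnected P.pt)

theorem surjective_assocProj : Function.Surjective P.assocProj := fun x => by
  obtain ⟨a, ha⟩ := PointedPaths.exists_tgt_eq P.pathConnected P.pt x
  exact ⟨Quot.mk _ (a, 1), ha⟩

theorem exists_assocAct_eq (ξ η : P.Assoc) (h : P.assocProj ξ = P.assocProj η) :
    ∃ g, η = P.assocAct ξ g := by
  obtain ⟨p, rfl⟩ := P.exists_assocMk ξ
  obtain ⟨q, rfl⟩ := P.exists_assocMk η
  exact ⟨_, P.assocMk_eq_act h⟩

/-! ### The connection of the associated bundle -/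

variable {P}

theorem assocPush_comp {b a : PathClass P.X} (hab : a.tgt = b.src) {ξ : P.Assoc}
    (h : P.assocProj ξ = a.src) : P.assocPush b (P.assocPush a ξ) = P.assocPush (b.comp a) ξ := by
  induction ξ using Quot.ind with | _ p =>
    exact congrArg (Quot.mk _) (Prod.ext (Subtype.ext (PathClass.comp_assoc _ _ _ h hab).symm) rfl)

theorem assocPush_const (ξ : P.Assoc) :
    P.assocPush (PathClass.mk (.const (P.assocProj ξ))) ξ = ξ := by
  induction ξ using Quot.ind with | _ p =>
    exact congrArg (Quot.mk _) (Prod.ext (Subtype.ext (PathClass.const_comp _ _ rfl)) rfl)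

theorem assocProj_push {b : PathClass P.X} {ξ : P.Assoc} (h : P.assocProj ξ = b.src) :
    P.assocProj (P.assocPush b ξ) = b.tgt := by
  induction ξ using Quot.ind with | _ p => exact PathClass.tgt_comp _ _ h

theorem assocPush_act (b : PathClass P.X) (ξ : P.Assoc) (g : G) :
    P.assocPush b (P.assocAct ξ g) = P.assocAct (P.assocPush b ξ) g := by
  induction ξ using Quot.ind with | _ p => rfl

theorem dSmooth_assocPush {Z : Type*} [DiffeologicalSpace Z] {b : Z → PathClass P.X}
    {ξ : Z → P.Assoc} (hb : DSmooth b) (hξ : DSmooth ξ) (h : ∀ z, P.assocProj (ξ z) = (b z).src) :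
    DSmooth (fun z => P.assocPush (b z) (ξ z)) := by
  refine dSmooth_of_locally fun n p hp r₀ => ?_
  obtain ⟨V, hV, hr, q, hq, hqp⟩ := liftsPlots_quotMk P.AssocRel n _ (hξ n p hp) r₀
  refine ⟨V, hV, hr, ?_⟩
  have e : ∀ r : V, (q r).1.1.tgt = (b (p r)).src := fun r =>
    (congrArg P.assocProj (hqp r)).trans (h (p r))
  have key : DSmooth (fun r : V => Quot.mk P.AssocRel ((q r).1.push (b (p r)), (q r).2)) :=
    (dSmooth_quotMk P.AssocRel).comp (dSmooth_prodMk (dSmooth_subtype_mk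
      (P := fun a : PathClass P.X => a.src = P.pt)
      (PathClass.dSmooth_comp (hb.comp (dSmooth_restrict hp.dSmooth))
        (dSmooth_subtype_val.comp (dSmooth_fst.comp hq)) e) _) (dSmooth_snd.comp hq))
  have e' : (fun r : V => P.assocPush (b (p r)) (ξ (p r))) =
      fun r : V => Quot.mk P.AssocRel ((q r).1.push (b (p r)), (q r).2) :=
    funext fun r => congrArg (P.assocPush _) (hqp r).symm
  exact e' ▸ key

/-- The path in the base under a path in the associated bundle. -/
abbrev basePath (c : LocalPath P.Assoc) : LocalPath P.X := c.map P.assocProj P.dSmooth_assocProj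

theorem assocConn_eq (c : LocalPath P.Assoc) (r s : c.dom) :
    P.assocConn c r s = P.assocPush ((basePath c).segClass r s) (c r) := rfl

theorem proj_eq_src (c : LocalPath P.Assoc) (r s : c.dom) :
    P.assocProj (c r) = ((basePath c).segClass r s).src := ((basePath c).src_segClass r s).symm

theorem assocProj_conn (c : LocalPath P.Assoc) (r s : c.dom) :
    P.assocProj (P.assocConn c r s) = P.assocProj (c s) := by
  rw [assocConn_eq, assocProj_push (proj_eq_src c r s), (basePath c).tgt_segClass]

/-- Prolongation from `r` to `s` and on to `t` is prolongation from `r` to `t`. A path that is its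
own prolongation from one time is therefore so from every time, which is the last connection axiom.
-/
theorem assocConn_trans (c : LocalPath P.Assoc) (r s t : c.dom) :
    P.assocPush ((basePath c).segClass s t) (P.assocConn c r s) = P.assocConn c r t := by
  rw [assocConn_eq, assocConn_eq, assocPush_comp ?_ (proj_eq_src c r s),
    (basePath c).segClass_comp]
  rw [(basePath c).tgt_segClass, (basePath c).src_segClass]

theorem assocConn_self (c : LocalPath P.Assoc) (r : c.dom) : P.assocConn c r r = c r := by
  rw [assocConn_eq, (basePath c).segClass_self]
  exact assocPush_const _

theorem dSmooth_localPath_map {X Y : Type*} [DiffeologicalSpace X] [DiffeologicalSpace Y]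
    {F : X → Y} (hF : DSmooth F) : DSmooth (fun α : LocalPath X => α.map F hF) := by
  refine LocalPath.dSmooth_of_eval (fun n p hp r₀ s₀ hs => ?_) ?_
  · exact OpenDomains.of_dSmooth dSmooth_id n p hp r₀ s₀ hs
  · exact hF.comp LocalPath.dSmooth_eval

theorem dSmooth_assocConn :
    DSmooth (fun q : {q : InitPath P.Assoc × ℝ // q.2 ∈ q.1.1.1.dom} =>
      P.assocConn q.1.1.1.1 ⟨q.1.1.1.2, q.1.1.2⟩ ⟨q.1.2, q.2⟩) := by
  have h1 := dSmooth_subtype_val (P := fun q : InitPath P.Assoc × ℝ => q.2 ∈ q.1.1.1.dom)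
  have h2 := dSmooth_subtype_val (P := fun p : LocalPath P.Assoc × ℝ => p.2 ∈ p.1.dom)
  refine dSmooth_assocPush (b := fun q : {q : InitPath P.Assoc × ℝ // q.2 ∈ q.1.1.1.dom} =>
    (basePath q.1.1.1.1).segClass ⟨q.1.1.1.2, q.1.1.2⟩ ⟨q.1.2, q.2⟩) ?_
    (LocalPath.dSmooth_eval.comp (dSmooth_fst.comp h1)) fun q => proj_eq_src _ _ _
  refine LocalPath.dSmooth_segClass.comp (dSmooth_subtype_mk
    (P := fun q : InitPath P.X × ℝ => q.2 ∈ q.1.1.1.dom)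
    (f := fun q : {q : InitPath P.Assoc × ℝ // q.2 ∈ q.1.1.1.dom} =>
      ((⟨(basePath q.1.1.1.1, q.1.1.1.2), q.1.1.2⟩ : InitPath P.X), q.1.2))
    (dSmooth_prodMk (dSmooth_subtype_mk (P := fun p : LocalPath P.X × ℝ => p.2 ∈ p.1.dom)
      (dSmooth_prodMk ?_ ?_) _) (dSmooth_snd.comp h1)) fun q => q.2)
  · exact (dSmooth_localPath_map P.dSmooth_assocProj).comp
      (dSmooth_fst.comp (h2.comp (dSmooth_fst.comp h1)))
  · exact dSmooth_snd.comp (h2.comp (dSmooth_fst.comp h1))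

variable (P) in
theorem dSmooth_assocConn_path (c : LocalPath P.Assoc) (t : c.dom) :
    DSmooth (P.assocConn c t) :=
  dSmooth_assocConn.comp (dSmooth_subtype_mk
    (P := fun q : InitPath P.Assoc × ℝ => q.2 ∈ q.1.1.1.dom)
    (f := fun s : c.dom => ((⟨(c, t), t.2⟩ : InitPath P.Assoc), (s : ℝ)))
    (dSmooth_prodMk dSmooth_const dSmooth_subtype_val) fun s => s.2)

variable (P) in
/-- The universal connection induces a connection on the associated bundle. -/
theorem isConnection_assoc : IsConnection P.assocAct P.assocProj P.assocConn where
  smooth_path := P.dSmooth_assocConn_path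
  smooth := by
    refine LocalPath.dSmooth_of_eval (fun n p hp r₀ s₀ hs => ?_) dSmooth_assocConn
    exact OpenDomains.of_dSmooth (dSmooth_fst.comp dSmooth_subtype_val) n p hp r₀ s₀ hs
  lifting := assocProj_conn
  basepoint := assocConn_self
  -- Multiplying by `ρ` leaves the base path unchanged, and prolongation commutes with the action,
  -- so only the value of `ρ` at the initial time `t` enters.
  equivariant α ρ _ h t s := by
    rw [assocConn_eq, assocConn_eq, ← assocPush_act]
    exact congrArg (fun b => P.assocPush b _)
      (LocalPath.segClass_congr _ _ fun s => P.assocProj_act (α s) (ρ s))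
  reparam α f t s := congrArg (fun b => P.assocPush b _) ((basePath α).segClass_reparam f t s)
  projection α t s := congrArg₂ (fun b ξ => P.assocPush b ξ)
    (LocalPath.segClass_congr _ _ fun s => assocProj_conn α t s) (assocConn_self α t)
  horizontal := by
    rintro α ⟨r, hr⟩ t s
    rw [assocConn_eq, ← hr t, assocConn_trans, hr]

/-! ### The associated bundle is principal -/

variable (P) [DiffeologicalGroup G]

theorem dSmooth_mul {Z : Type*} [DiffeologicalSpace Z] {f g : Z → G} (hf : DSmooth f)
    (hg : DSmooth g) : DSmooth (fun z => f z * g z) :=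
  DiffeologicalGroup.smooth_mul.comp (dSmooth_prodMk hf hg)

/-- The product of the quotient map with the identity of `G` still lifts plots, so smoothness can be
tested on representatives. -/
theorem smooth_assocAct : DSmooth (fun p : P.Assoc × G => P.assocAct p.1 p.2) := by
  refine ((liftsPlots_quotMk P.AssocRel).prodMap liftsPlots_id).dSmooth_of_comp ?_
  exact (dSmooth_quotMk P.AssocRel).comp (dSmooth_prodMk (dSmooth_fst.comp dSmooth_fst)
    (dSmooth_mul (dSmooth_snd.comp dSmooth_fst) dSmooth_snd))

/-- The associated bundle is a principal bundle. -/
theorem isPrincipalBundle_assoc : IsPrincipalBundle P.assocAct P.assocProj where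
  act_one ξ := by
    induction ξ using Quot.ind with | _ p => exact congrArg (Quot.mk _) (Prod.ext rfl (mul_one _))
  act_mul ξ g h := by
    induction ξ using Quot.ind with
    | _ p => exact congrArg (Quot.mk _) (Prod.ext rfl (mul_assoc _ _ _).symm)
  smooth_act := smooth_assocAct P
  smooth_proj := P.dSmooth_assocProj
  surjective_proj := P.surjective_assocProj
  graph := by
    refine isDiffeoOntoImage_graph (smooth_assocAct P) P.assocAct_injective
      fun n p hp h r₀ => ?_
    obtain ⟨V, hV, hr, q, hq, hqp⟩ := P.liftsPlots_assocMk n _ hp.1 r₀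
    obtain ⟨W, hW, hr', q', hq', hqp'⟩ := P.liftsPlots_assocMk n _ hp.2 r₀
    have hq := hq.comp (dSmooth_inclusion (Set.inter_subset_left (s := V) (t := W)))
    have hq' := hq'.comp (dSmooth_inclusion (Set.inter_subset_right (s := V) (t := W)))
    have e : ∀ r : ↑(V ∩ W), (q ⟨r, r.2.1⟩).1.1 1 = (q' ⟨r, r.2.2⟩).1.1 1 := fun r => by
      obtain ⟨g, hg⟩ := h r
      refine (congrArg P.assocProj (hqp ⟨r, r.2.1⟩)).trans
        (Eq.trans ?_ (congrArg P.assocProj (hqp' ⟨r, r.2.2⟩)).symm)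
      rw [hg, assocProj_act]
    -- The quotient `g⁻¹ H(α⁻ ∨ β) h` from `assocMk_eq_act`, evaluated on local lifts of both
    -- components of the plot.
    refine ⟨V ∩ W, hV.inter hW, ⟨hr, hr'⟩, fun r => (q ⟨r, r.2.1⟩).2⁻¹ *
      P.hol ((q ⟨r, r.2.1⟩).1.diff (q' ⟨r, r.2.2⟩).1 (e r)) * (q' ⟨r, r.2.2⟩).2, ?_, fun r => ?_⟩
    · exact dSmooth_mul (dSmooth_mul (DiffeologicalGroup.smooth_inv.comp (dSmooth_snd.comp hq))
        (P.smooth_hol.comp (PointedSit.dSmooth_diff (dSmooth_fst.comp hq)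
          (dSmooth_fst.comp hq') e)))
        (dSmooth_snd.comp hq')
    · rw [← hqp ⟨r, r.2.1⟩, ← hqp' ⟨r, r.2.2⟩]
      exact P.assocMk_eq_act (e r)
  quotient := exists_quotient_diffeo P.dSmooth_assocProj P.liftsPlots_assocProj
    P.surjective_assocProj P.assocProj_act P.exists_assocAct_eq

end HolObj

theorem dSmooth_congr {X Y : Type*} [DiffeologicalSpace X] [DiffeologicalSpace Y] {f g : X → Y}
    (hf : DSmooth f) (h : ∀ x, g x = f x) : DSmooth g :=
  (funext h : g = f) ▸ hf

/-- A nonempty set that contains with one point of a small neighbourhood all the others is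
everything. -/
theorem eq_univ_of_locally {T : Type*} [TopologicalSpace T] [PreconnectedSpace T] {S : Set T}
    (hS : S.Nonempty) (h : ∀ x, ∃ U ∈ 𝓝 x, ∀ y ∈ U, ∀ z ∈ U, y ∈ S → z ∈ S) : S = Set.univ := by
  refine IsClopen.eq_univ ⟨⟨isOpen_iff_mem_nhds.2 fun x hx => ?_⟩,
    isOpen_iff_mem_nhds.2 fun x hx => ?_⟩ hS
  · obtain ⟨U, hU, hx'⟩ := h x
    exact Filter.mem_of_superset hU fun y hy hyS => hx (hx' y hy x (mem_of_mem_nhds hU) hyS)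
  · obtain ⟨U, hU, hx'⟩ := h x
    exact Filter.mem_of_superset hU fun y hy => hx' x (mem_of_mem_nhds hU) y hy hx

/-! ### Principal bundles and horizontal lifts -/

section Bundles

variable {E X G : Type*} [DiffeologicalSpace E] [DiffeologicalSpace X] [Group G]
  [DiffeologicalSpace G] {act : E → G → E} {π : E → X} {A : Transport E}

namespace IsPrincipalBundle

variable (hP : IsPrincipalBundle act π)

include hP

theorem equivalence_orbitRel : Equivalence (OrbitRel act) where
  refl ξ := ⟨1, (hP.act_one ξ).symm⟩
  symm := by
    rintro ξ _ ⟨g, rfl⟩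
    exact ⟨g⁻¹, by rw [← hP.act_mul, mul_inv_cancel, hP.act_one]⟩
  trans := by
    rintro ξ _ _ ⟨g, rfl⟩ ⟨h, rfl⟩
    exact ⟨g * h, (hP.act_mul _ _ _).symm⟩

/-- Invariance of `π` is not an axiom; it follows from the identification of the base with the orbit
space. -/
theorem proj_act (ξ : E) (g : G) : π (act ξ g) = π ξ := by
  obtain ⟨Φ, -, -, h⟩ := hP.quotient
  refine Φ.injective ?_
  rw [h, h]
  exact (Quot.sound ⟨g, rfl⟩).symm

theorem exists_act_eq {ξ η : E} (h : π ξ = π η) : ∃ g, η = act ξ g := by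
  obtain ⟨Φ, -, -, hΦ⟩ := hP.quotient
  have e : Quot.mk (OrbitRel act) ξ = Quot.mk _ η := by rw [← hΦ, ← hΦ, h]
  exact hP.equivalence_orbitRel.eqvGen_iff.1 (Quot.eqvGen_exact e)

theorem act_injective {ξ : E} {g h : G} (e : act ξ g = act ξ h) : g = h := by
  obtain ⟨-, k, -, hk⟩ := hP.graph
  have h1 := hk (ξ, g)
  have h2 := hk (ξ, h)
  simp only [e] at h1
  exact congrArg Prod.snd (h1.symm.trans h2)

/-- Up to the diffeomorphism `Φ`, the projection is the quotient map onto the orbit space. -/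
theorem liftsPlots_proj : LiftsPlots π := by
  obtain ⟨Φ, hs, -, hΦ⟩ := hP.quotient
  intro n p hp r₀
  obtain ⟨V, hV, hr, q, hq, h⟩ := liftsPlots_quotMk (OrbitRel act) n _ (hs n p hp) r₀
  exact ⟨V, hV, hr, q, hq, fun r => Φ.injective ((hΦ _).trans (h r))⟩

/-- Two smooth maps into the total space with the same projection differ by a smooth map into the
structure group. -/
theorem exists_diff {Z : Type*} [DiffeologicalSpace Z] {f g : Z → E} (hf : DSmooth f)
    (hg : DSmooth g) (h : ∀ z, π (f z) = π (g z)) :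
    ∃ ρ : Z → G, DSmooth ρ ∧ ∀ z, g z = act (f z) (ρ z) := by
  obtain ⟨-, k, hk, hk'⟩ := hP.graph
  have hr : ∀ z, (f z, g z) ∈ Set.range (fun p : E × G => (p.1, act p.1 p.2)) := fun z => by
    obtain ⟨γ, hγ⟩ := hP.exists_act_eq (h z)
    exact ⟨(f z, γ), Prod.ext rfl hγ.symm⟩
  refine ⟨fun z => (k ⟨(f z, g z), hr z⟩).2, dSmooth_snd.comp (hk.comp
    (dSmooth_subtype_mk (dSmooth_prodMk hf hg) hr)), fun z => ?_⟩
  obtain ⟨γ, hγ⟩ := hP.exists_act_eq (h z)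
  have : k ⟨(f z, g z), hr z⟩ = (f z, γ) := by
    rw [← hk' (f z, γ)]
    congr 2
    exact Prod.ext rfl hγ
  exact hγ.trans (congrArg (fun p => act (f z) (Prod.snd p)) this.symm)

end IsPrincipalBundle

/-- Horizontal lifts of a path. -/
structure IsHorLift (π : E → X) (A : Transport E) (γ : LocalPath X) (f : γ.dom → E) : Prop where
  smooth : DSmooth f
  proj : ∀ s, π (f s) = γ s
  hor : IsHorizontal A (γ.withFun f smooth)

/-- Horizontal lifts of a path on a part of its domain. -/
structure IsPartialLift (π : E → X) (A : Transport E) (γ : LocalPath X) (α : LocalPath E) :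
    Prop where
  sub : α.dom ⊆ γ.dom
  proj : ∀ u : α.dom, π (α u) = γ ⟨u, sub u.2⟩
  hor : IsHorizontal A α

namespace IsConnection

variable (hA : IsConnection act π A)

include hA

omit [DiffeologicalSpace X] [Group G] in
-- Restriction to a subinterval is reparameterization by the inclusion; this makes horizontality a
-- local matter.
theorem conn_restrict (α : LocalPath E) {J : Set ℝ} (hJ : IsOpen J) (hJ' : J.OrdConnected)
    (hsub : J ⊆ α.dom) {f : J → E} (hf : DSmooth f) (h : ∀ s : J, f s = α ⟨s.1, hsub s.2⟩)
    (t s : J) : A ⟨J, hJ, hJ', f, hf⟩ t s = A α ⟨t, hsub t.2⟩ ⟨s, hsub s.2⟩ := by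
  obtain rfl : f = fun s => α ⟨s.1, hsub s.2⟩ := funext h
  exact hA.reparam α ⟨J, hJ, hJ', Set.inclusion hsub, dSmooth_inclusion hsub⟩ t s

omit [Group G] in
theorem horLift_apply {γ : LocalPath X} {f : γ.dom → E} (hf : IsHorLift π A γ f) (t s : γ.dom) :
    A (γ.withFun f hf.smooth) t s = f s := hA.horizontal _ hf.hor t s

omit [Group G] in
theorem horLift_reparam {γ : LocalPath X} {f : γ.dom → E} (hf : IsHorLift π A γ f)
    (φ : LocalPath γ.dom) (t : φ.dom) : IsHorLift π A (γ.reparam φ) (fun s => f (φ s)) where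
  smooth := hf.smooth.comp φ.smooth
  proj s := hf.proj (φ s)
  hor := ⟨t, fun s => (hA.reparam (γ.withFun f hf.smooth) φ t s).trans (hA.horLift_apply hf _ _)⟩

theorem horLift_act (hP : IsPrincipalBundle act π) {γ : LocalPath X} {f : γ.dom → E}
    (hf : IsHorLift π A γ f) (g : G) : IsHorLift π A γ (fun s => act (f s) g) where
  smooth := hP.smooth_act.comp (dSmooth_prodMk hf.smooth dSmooth_const)
  proj s := (hP.proj_act _ _).trans (hf.proj s)
  hor := by
    obtain ⟨t, ht⟩ := hf.hor
    exact ⟨t, fun s =>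
      (hA.equivariant (γ.withFun f hf.smooth) (fun _ => g) dSmooth_const _ t s).trans
        (congrArg (act · g) (ht s))⟩

/-- Write `g = f ρ` with `ρ` smooth and `ρ t = e`. Equivariance under the non-constant `ρ` gives `g
= A_t (f ρ) = A_t f · ρ t = f`. -/
theorem horLift_unique (hP : IsPrincipalBundle act π) {γ : LocalPath X} {f g : γ.dom → E}
    (hf : IsHorLift π A γ f) (hg : IsHorLift π A γ g) {t : γ.dom} (h : f t = g t) : f = g := by
  obtain ⟨ρ, hρ, hρ'⟩ := hP.exists_diff hf.smooth hg.smooth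
    fun s => (hf.proj s).trans (hg.proj s).symm
  have h1 : ρ t = 1 := hP.act_injective (ξ := f t) (by rw [← hρ', hP.act_one, h])
  obtain rfl : g = fun s => act (f s) (ρ s) := funext hρ'
  funext s
  have := hA.equivariant (γ.withFun f hf.smooth) ρ hρ hg.smooth t s
  rw [h1, hA.horLift_apply hf, hP.act_one] at this
  exact this.symm.trans (hA.horLift_apply hg t s)

omit [Group G] in
-- `A_t α` is horizontal because `A_t` is idempotent.
theorem horLift_conn (α : LocalPath E) (hπ : DSmooth π) (t : α.dom) :
    IsHorLift π A (α.map π hπ) (A α t) where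
  smooth := hA.smooth_path α t
  proj s := hA.lifting α t s
  hor := ⟨t, fun s => hA.projection α t s⟩

/-! #### Existence of horizontal lifts -/

/-- The common domain is again an open interval, so uniqueness applies to the two restrictions. -/
theorem partialLift_eq (hP : IsPrincipalBundle act π) {γ : LocalPath X} {α β : LocalPath E}
    (hα : IsPartialLift π A γ α) (hβ : IsPartialLift π A γ β) {t : ℝ} (h1 : t ∈ α.dom)
    (h2 : t ∈ β.dom) (h : α ⟨t, h1⟩ = β ⟨t, h2⟩) {u : ℝ} (u1 : u ∈ α.dom) (u2 : u ∈ β.dom) :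
    α ⟨u, u1⟩ = β ⟨u, u2⟩ := by
  have hJ := α.isOpen_dom.inter β.isOpen_dom
  have hJ' := α.ordConnected_dom.inter β.ordConnected_dom
  have s1 : α.dom ∩ β.dom ⊆ α.dom := Set.inter_subset_left
  have s2 : α.dom ∩ β.dom ⊆ β.dom := Set.inter_subset_right
  have f1 : DSmooth (fun s : ↑(α.dom ∩ β.dom) => α ⟨s, s1 s.2⟩) :=
    α.smooth.comp (dSmooth_inclusion s1)
  have f2 : DSmooth (fun s : ↑(α.dom ∩ β.dom) => β ⟨s, s2 s.2⟩) :=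
    β.smooth.comp (dSmooth_inclusion s2)
  let δ : LocalPath X := ⟨α.dom ∩ β.dom, hJ, hJ', fun s => γ ⟨s, hα.sub (s1 s.2)⟩,
    γ.smooth.comp (dSmooth_inclusion (s1.trans hα.sub))⟩
  have l1 : IsHorLift π A δ (fun s => α ⟨s, s1 s.2⟩) :=
    ⟨f1, fun s => hα.proj _, ⟨t, h1, h2⟩, fun s =>
      (hA.conn_restrict α hJ hJ' s1 f1 (fun _ => rfl) _ _).trans (hA.horizontal α hα.hor _ _)⟩
  have l2 : IsHorLift π A δ (fun s => β ⟨s, s2 s.2⟩) :=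
    ⟨f2, fun s => hβ.proj _, ⟨t, h1, h2⟩, fun s =>
      (hA.conn_restrict β hJ hJ' s2 f2 (fun _ => rfl) _ _).trans (hA.horizontal β hβ.hor _ _)⟩
  exact congrFun (hA.horLift_unique hP l1 l2 (t := ⟨t, h1, h2⟩) h) ⟨u, u1, u2⟩

/-- The path has some smooth lift near `t`, and `A_t` makes it horizontal without changing its
projection. -/
theorem exists_partialLift (hP : IsPrincipalBundle act π) (γ : LocalPath X) (t : γ.dom) :
    ∃ α, IsPartialLift π A γ α ∧ (t : ℝ) ∈ α.dom := by
  obtain ⟨w, hw, hwo, htw, q, hq, hqp⟩ := hP.liftsPlots_proj.exists_lift γ.isOpen_dom γ.smooth t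
  obtain ⟨ε, hε, hb⟩ := Metric.isOpen_iff.1 hwo _ htw
  have ht : (t : ℝ) ∈ Metric.ball (t : ℝ) ε := Metric.mem_ball_self hε
  let α : LocalPath E := ⟨Metric.ball t ε, Metric.isOpen_ball,
    (convex_ball _ _).ordConnected, fun s => q (Set.inclusion hb s),
    hq.comp (dSmooth_inclusion hb)⟩
  refine ⟨α.withFun (A α ⟨t, ht⟩) (hA.smooth_path _ _), ⟨hb.trans hw, fun u => ?_, ⟨t, ht⟩,
    hA.projection α _⟩, ht⟩
  exact (hA.lifting α _ _).trans (hqp _)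

theorem partialLift_translate (hP : IsPrincipalBundle act π) {γ : LocalPath X} {α : LocalPath E}
    (hα : IsPartialLift π A γ α) {t : ℝ} (h1 : t ∈ α.dom) {ξ : E}
    (hξ : π ξ = γ ⟨t, hα.sub h1⟩) :
    ∃ f : α.dom → E, ∃ hf, IsPartialLift π A γ (α.withFun f hf) ∧ f ⟨t, h1⟩ = ξ := by
  obtain ⟨g, hg⟩ := hP.exists_act_eq ((hα.proj ⟨t, h1⟩).trans hξ.symm)
  have l := hA.horLift_act hP (γ := α.map π hP.smooth_proj) (f := α.toFun)
    ⟨α.smooth, fun _ => rfl, hα.hor⟩ g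
  exact ⟨_, l.smooth, ⟨hα.sub, fun u => (l.proj u).trans (hα.proj u), l.hor⟩, hg.symm⟩

-- Agreement at one common time forces agreement on the whole overlap, so the union is a smooth
-- path. Its horizontality can be tested at `t`, which lies in both domains, by restricting to
-- either of them.
open Classical in
theorem partialLift_glue (hP : IsPrincipalBundle act π) {γ : LocalPath X} {α β : LocalPath E}
    (hα : IsPartialLift π A γ α) (hβ : IsPartialLift π A γ β) {t : ℝ} (h1 : t ∈ α.dom)
    (h2 : t ∈ β.dom) (h : α ⟨t, h1⟩ = β ⟨t, h2⟩) :
    ∃ δ, IsPartialLift π A γ δ ∧ β.dom ⊆ δ.dom ∧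
      ∃ hs : α.dom ⊆ δ.dom, ∀ u : α.dom, δ ⟨u, hs u.2⟩ = α u := by
  let f : ↑(α.dom ∪ β.dom) → E := fun u =>
    if hu : (u : ℝ) ∈ α.dom then α ⟨u, hu⟩ else β ⟨u, u.2.resolve_left hu⟩
  have f1 : ∀ (u : ↑(α.dom ∪ β.dom)) (hu : (u : ℝ) ∈ α.dom), f u = α ⟨u, hu⟩ := fun u hu =>
    dif_pos hu
  have f2 : ∀ (u : ↑(α.dom ∪ β.dom)) (hu : (u : ℝ) ∈ β.dom), f u = β ⟨u, hu⟩ := fun u hu => by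
    by_cases hu' : (u : ℝ) ∈ α.dom
    · exact (f1 u hu').trans (hA.partialLift_eq hP hα hβ h1 h2 h hu' hu)
    · exact dif_neg hu'
  have hf : DSmooth f := by
    refine dSmooth_of_nhds (c := Subtype.val) dSmooth_subtype_val fun u => ?_
    rcases u.2 with hu | hu
    · refine ⟨α.dom, α.isOpen_dom, hu, ?_⟩
      exact dSmooth_congr (α.smooth.comp (dSmooth_subtype_mk (P := fun s => s ∈ α.dom)
        (dSmooth_subtype_val.comp dSmooth_subtype_val) fun y => y.2)) fun y => f1 y.1 y.2
    · refine ⟨β.dom, β.isOpen_dom, hu, ?_⟩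
      exact dSmooth_congr (β.smooth.comp (dSmooth_subtype_mk (P := fun s => s ∈ β.dom)
        (dSmooth_subtype_val.comp dSmooth_subtype_val) fun y => y.2)) fun y => f2 y.1 y.2
  have hc : (α.dom ∪ β.dom).OrdConnected :=
    (IsPreconnected.union t h1 h2 α.ordConnected_dom.isPreconnected
      β.ordConnected_dom.isPreconnected).ordConnected
  let δ : LocalPath E := ⟨α.dom ∪ β.dom, α.isOpen_dom.union β.isOpen_dom, hc, f, hf⟩
  refine ⟨δ, ⟨Set.union_subset hα.sub hβ.sub, fun u => ?_, ⟨t, Or.inl h1⟩, fun u => ?_⟩,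
    Set.subset_union_right, Set.subset_union_left, fun u => f1 _ u.2⟩
  · rcases u.2 with hu | hu
    · exact (congrArg π (f1 u hu)).trans (hα.proj _)
    · exact (congrArg π (f2 u hu)).trans (hβ.proj _)
  · rcases u.2 with hu | hu
    · exact (hA.conn_restrict δ α.isOpen_dom α.ordConnected_dom Set.subset_union_left α.smooth
        (fun s => (f1 ⟨s.1, Or.inl s.2⟩ s.2).symm) ⟨t, h1⟩ ⟨u, hu⟩).symm.trans
        ((hA.horizontal α hα.hor _ _).trans (f1 u hu).symm)
    · exact (hA.conn_restrict δ β.isOpen_dom β.ordConnected_dom Set.subset_union_right β.smooth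
        (fun s => (f2 ⟨s.1, Or.inr s.2⟩ s.2).symm) ⟨t, h2⟩ ⟨u, hu⟩).symm.trans
        ((hA.horizontal β hβ.hor _ _).trans (f2 u hu).symm)

/-- Every path in the base has a horizontal lift with a prescribed value at one time. -/
theorem exists_horLift (hP : IsPrincipalBundle act π) (γ : LocalPath X) (t : γ.dom) {ξ : E}
    (hξ : π ξ = γ t) : ∃ f, IsHorLift π A γ f ∧ f t = ξ := by
  let S : Set γ.dom := {s | ∃ α, IsPartialLift π A γ α ∧ (s : ℝ) ∈ α.dom ∧
    ∃ ht : (t : ℝ) ∈ α.dom, α ⟨t, ht⟩ = ξ}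
  have hc : PreconnectedSpace γ.dom :=
    Subtype.preconnectedSpace γ.ordConnected_dom.isPreconnected
  -- On the domain of a local lift around `x`, membership in `S` spreads from any `y` to any `z`:
  -- the local lift is translated to meet the given partial lift at time `y` and then attached to
  -- it.
  have hS : S = Set.univ := by
    refine eq_univ_of_locally ⟨t, ?_⟩ fun x => ?_
    · obtain ⟨α, hα, ht⟩ := hA.exists_partialLift hP γ t
      obtain ⟨f, hf, hl, hft⟩ := hA.partialLift_translate hP hα ht hξ
      exact ⟨_, hl, ht, ht, hft⟩
    · obtain ⟨α, hα, hx⟩ := hA.exists_partialLift hP γ x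
      refine ⟨Subtype.val ⁻¹' α.dom,
        (α.isOpen_dom.preimage continuous_subtype_val).mem_nhds hx, fun y hy z hz => ?_⟩
      rintro ⟨β, hβ, hyβ, ht, hβt⟩
      obtain ⟨f, hf, hl, hft⟩ := hA.partialLift_translate hP hα hy (hβ.proj ⟨y, hyβ⟩)
      obtain ⟨δ, hδ, h1, h2, h3⟩ := hA.partialLift_glue hP hβ hl hyβ hy hft.symm
      exact ⟨δ, hδ, h1 hz, h2 ht, (h3 ⟨t, ht⟩).trans hβt⟩
  have h : ∀ s : γ.dom, s ∈ S := fun s => hS ▸ Set.mem_univ s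
  choose α hα hs ht hαt using h
  -- The partial lifts chosen for different times all pass through `ξ` at time `t`, hence agree
  -- where both are defined.
  have key : ∀ (s s' : γ.dom) (h : (s' : ℝ) ∈ (α s).dom), α s' ⟨s', hs s'⟩ = α s ⟨s', h⟩ :=
    fun s s' h => hA.partialLift_eq hP (hα s') (hα s) (ht s') (ht s)
      ((hαt s').trans (hαt s).symm) _ _
  have hf : DSmooth (fun s => α s ⟨s, hs s⟩) := by
    refine dSmooth_of_nhds (c := Subtype.val) dSmooth_subtype_val fun s => ?_
    refine ⟨(α s).dom, (α s).isOpen_dom, hs s, ?_⟩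
    exact dSmooth_congr ((α s).smooth.comp (dSmooth_subtype_mk (P := fun s' => s' ∈ (α s).dom)
      (dSmooth_subtype_val.comp dSmooth_subtype_val) fun y => y.2)) fun y => key s y.1 y.2
  refine ⟨fun s => α s ⟨s, hs s⟩, ⟨hf, fun s => (hα s).proj _, t, fun s => ?_⟩, hαt t⟩
  exact (hA.conn_restrict (γ.withFun _ hf) (α s).isOpen_dom (α s).ordConnected_dom (hα s).sub
    (α s).smooth (fun u => (key s ⟨u, (hα s).sub u.2⟩ u.2).symm) ⟨t, ht s⟩ ⟨s, hs s⟩).symm.trans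
    (hA.horizontal _ (hα s).hor _ _)

end IsConnection

end Bundles

/-! ### Extension of flat-ended paths to the real line -/

section Line

variable {X Y : Type*} [DiffeologicalSpace X] [DiffeologicalSpace Y]

/-- The extension of a path that is constant near the end points to the real line. -/
def SitPath.line (α : SitPath X) : LocalPath X where
  dom := Set.univ
  isOpen_dom := isOpen_univ
  ordConnected_dom := Set.ordConnected_univ
  toFun s := α (clamp s)
  smooth := dSmooth_restrict α.dSmooth_extend

/-- A point of the domain of `α.line`. -/
def SitPath.pt (α : SitPath X) (t : unitInterval) : α.line.dom := ⟨t, trivial⟩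

theorem SitPath.line_pt (α : SitPath X) (t : unitInterval) : α.line (α.pt t) = α t :=
  congrArg α.1.toFun (clamp_coe t)

/-- The path `α ∘ u`, where `u : [0,1] → [0,1]` is smooth. -/
def SitPath.compMap (α : SitPath X) (u : SmoothMap unitInterval unitInterval) :
    SmoothMap unitInterval X := ⟨fun t => α (u t), α.1.smooth.comp u.smooth⟩

end Line

/-! ### Parallel transport along paths -/

namespace BundleObj

variable {G : Type u} [Group G] [DiffeologicalSpace G] (B C : BundleObj G)

/-- Horizontal lifts with respect to the connection of `B`. -/
abbrev HorLift (γ : LocalPath B.X) (f : γ.dom → B.E) : Prop := IsHorLift B.proj B.conn γ f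

open Classical in
/-- Parallel transport along `γ` from time `s` to time `t`. -/
def transport (γ : LocalPath B.X) (s t : γ.dom) (ξ : B.E) : B.E :=
  if h : B.proj ξ = γ s then (B.isConnection.exists_horLift B.principal γ s h).choose t else ξ

variable {B C}

/-- By uniqueness any horizontal lift computes the transport; the properties below are read off from
one lift. -/
theorem transport_eq {γ : LocalPath B.X} {f : γ.dom → B.E} (hf : B.HorLift γ f) (s t : γ.dom) :
    B.transport γ s t (f s) = f t := by
  have h : B.proj (f s) = γ s := hf.proj s
  rw [transport, dif_pos h]
  obtain ⟨h1, h2⟩ := (B.isConnection.exists_horLift B.principal γ s h).choose_spec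
  exact congrFun (B.isConnection.horLift_unique B.principal h1 hf h2) t

theorem exists_horLift (γ : LocalPath B.X) (s : γ.dom) {ξ : B.E} (h : B.proj ξ = γ s) :
    ∃ f, B.HorLift γ f ∧ f s = ξ := B.isConnection.exists_horLift B.principal γ s h

section transport

variable {γ : LocalPath B.X} {s : γ.dom} {ξ : B.E} (h : B.proj ξ = γ s)

include h

theorem proj_transport (t : γ.dom) : B.proj (B.transport γ s t ξ) = γ t := by
  obtain ⟨f, hf, rfl⟩ := exists_horLift γ s h
  rw [transport_eq hf, hf.proj]

theorem transport_act (t : γ.dom) (g : G) :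
    B.transport γ s t (B.act ξ g) = B.act (B.transport γ s t ξ) g := by
  obtain ⟨f, hf, rfl⟩ := exists_horLift γ s h
  rw [transport_eq hf]
  exact transport_eq (B.isConnection.horLift_act B.principal hf g) s t

theorem transport_trans (t r : γ.dom) :
    B.transport γ t r (B.transport γ s t ξ) = B.transport γ s r ξ := by
  obtain ⟨f, hf, rfl⟩ := exists_horLift γ s h
  rw [transport_eq hf, transport_eq hf, transport_eq hf]

theorem transport_self : B.transport γ s s ξ = ξ := by
  obtain ⟨f, hf, rfl⟩ := exists_horLift γ s h
  exact transport_eq hf s s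

/-- A morphism commutes with the connections and so maps horizontal lifts to horizontal lifts. -/
theorem transport_map (F : B ⟶ C) (t : γ.dom) :
    F.tot (B.transport γ s t ξ) = C.transport (γ.map F.base F.smooth_base) s t (F.tot ξ) := by
  obtain ⟨f, hf, rfl⟩ := exists_horLift γ s h
  rw [transport_eq hf]
  have hl : C.HorLift (γ.map F.base F.smooth_base) (fun s => F.tot (f s)) :=
    { smooth := F.smooth_tot.comp hf.smooth
      proj := fun s => (F.comm _).trans (congrArg F.base (hf.proj s))
      hor := ⟨s, fun t => (F.map_conn (γ.withFun f hf.smooth) s t).symm.trans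
        (congrArg F.tot (B.isConnection.horLift_apply hf s t))⟩ }
  exact (transport_eq hl s t).symm

end transport

theorem transport_reparam (γ : LocalPath B.X) (φ : LocalPath γ.dom) (s t : φ.dom) {ξ : B.E}
    (h : B.proj ξ = γ (φ s)) :
    B.transport (γ.reparam φ) s t ξ = B.transport γ (φ s) (φ t) ξ := by
  obtain ⟨f, hf, rfl⟩ := exists_horLift γ (φ s) h
  rw [transport_eq hf]
  exact transport_eq (B.isConnection.horLift_reparam hf φ s) s t

/-- The connection is recovered from its transport, so compatibility with connections can be checked
on transports. -/
theorem transport_conn (α : LocalPath B.E) (s t : α.dom) :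
    B.transport (α.map B.proj B.principal.smooth_proj) s t (α s) = B.conn α s t := by
  have := transport_eq (B.isConnection.horLift_conn α B.principal.smooth_proj s) s t
  rwa [B.isConnection.basepoint] at this

/-! ### Transport along path classes -/

variable (B) in
/-- Parallel transport along a path that is constant near the end points. -/
def par (α : SitPath B.X) (ξ : B.E) : B.E := B.transport α.line (α.pt 0) (α.pt 1) ξ

/-- The default value `ξ` does not depend on the path. Hence equivalent paths have equal transports
as maps on all of `E`, and these descend to classes. -/
theorem par_of_ne {α : SitPath B.X} {ξ : B.E} (h : B.proj ξ ≠ α 0) : B.par α ξ = ξ :=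
  dif_neg fun h' => h (h'.trans (α.line_pt 0))

theorem proj_par {α : SitPath B.X} {ξ : B.E} (h : B.proj ξ = α 0) : B.proj (B.par α ξ) = α 1 :=
  (proj_transport (h.trans (α.line_pt 0).symm) _).trans (α.line_pt 1)

theorem par_map_line (γ : LocalPath B.X) (φ : SitPath γ.dom) {ξ : B.E} (h : B.proj ξ = γ (φ 0)) :
    B.par (φ.map γ.toFun γ.smooth) ξ = B.transport γ (φ 0) (φ 1) ξ := by
  have h0 := φ.line_pt 0
  refine (transport_reparam γ φ.line (φ.pt 0) (φ.pt 1) ?_).trans ?_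
  · rw [h0, h]
  · rw [φ.line_pt, φ.line_pt]

/-- The flattening of `α ∘ v` is the line of `α` reparameterized by the flattening of `v`, so only
the end points of `v` matter. -/
theorem par_ofSmooth_compMap (α : SitPath B.X) (v : SmoothMap unitInterval unitInterval) {ξ : B.E}
    (h : B.proj ξ = α (v 0)) :
    B.par (.ofSmooth (α.compMap v)) ξ = B.transport α.line (α.pt (v 0)) (α.pt (v 1)) ξ := by
  have hs : DSmooth α.pt := dSmooth_subtype_mk (P := fun t => t ∈ α.line.dom)
    dSmooth_subtype_val _
  have e : SitPath.ofSmooth (α.compMap v) =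
      ((SitPath.ofSmooth v).map α.pt hs).map α.line.toFun α.line.smooth :=
    SitPath.ext' fun t => (α.line_pt _).symm
  have e0 : (SitPath.ofSmooth v).map α.pt hs 0 = α.pt (v 0) :=
    congrArg α.pt (SitPath.ofSmooth_zero v)
  have e1 : (SitPath.ofSmooth v).map α.pt hs 1 = α.pt (v 1) :=
    congrArg α.pt (SitPath.ofSmooth_one v)
  rw [e, par_map_line, e0, e1]
  rw [e0, α.line_pt, h]

theorem par_ofSmooth (α : SitPath B.X) {ξ : B.E} (h : B.proj ξ = α 0) :
    B.par (.ofSmooth α.1) ξ = B.par α ξ :=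
  par_ofSmooth_compMap α ⟨id, dSmooth_id⟩ h

/-- Since `v` may run backwards or cover only part of `[0,1]`, reversals and the halves of a
concatenation become transports along a single line. -/
theorem par_eq_transport (β α : SitPath B.X) (v : SmoothMap unitInterval unitInterval)
    (hv : ∀ t, α t = β (v t)) {ξ : B.E} (h : B.proj ξ = α 0) :
    B.par α ξ = B.transport β.line (β.pt (v 0)) (β.pt (v 1)) ξ := by
  have e : α.1 = β.compMap v := by
    obtain ⟨⟨f, hf⟩, h'⟩ := α
    obtain rfl : f = fun t => β (v t) := funext hv
    rfl
  rw [← par_ofSmooth α h, e, par_ofSmooth_compMap]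
  rw [h, hv]

theorem par_reverse (α : SitPath B.X) {ξ : B.E} (h : B.proj ξ = α 1) :
    B.par α.reverse ξ = B.transport α.line (α.pt 1) (α.pt 0) ξ := by
  have hs : DSmooth unitInterval.symm := dSmooth_subtype_mk (P := fun t => t ∈ unitInterval)
    (dSmooth_real_sub (dSmooth_const (y := 1)) dSmooth_subtype_val) fun t => (unitInterval.symm t).2
  refine (par_eq_transport α α.reverse ⟨_, hs⟩ (fun _ => rfl)
    (h.trans α.reverse_zero.symm)).trans ?_
  change B.transport α.line (α.pt (unitInterval.symm 0)) (α.pt (unitInterval.symm 1)) ξ = _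
  rw [unitInterval.symm_zero, unitInterval.symm_one]

theorem par_par_reverse (α : SitPath B.X) {ξ : B.E} (h : B.proj ξ = α 1) :
    B.par α (B.par α.reverse ξ) = ξ := by
  have h' := h.trans (α.line_pt 1).symm
  rw [par_reverse α h, par, transport_trans h', transport_self h']

/-- Both `α` and `β` are reparameterized pieces of their concatenation, by `t / 2` and `(1 + t) /
2`; the claim becomes transitivity of transport along it. -/
theorem par_concat (β α : SitPath B.X) (hαβ : α 1 = β 0) {ξ : B.E} (h : B.proj ξ = α 0) :
    B.par (β.concat α hαβ) ξ = B.par β (B.par α ξ) := by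
  have hl : DSmooth (fun t : unitInterval => (clamp ((t : ℝ) / 2) : unitInterval)) :=
    fun n p hp => isPlot_unitInterval
      ((IsPlot.contDiff hp : ContDiff ℝ ∞ fun x => (p x : ℝ)).div_const 2)
      fun x => ⟨by linarith [(p x).2.1], by linarith [(p x).2.2]⟩
  have hr : DSmooth (fun t : unitInterval => (clamp ((1 + (t : ℝ)) / 2) : unitInterval)) :=
    fun n p hp => isPlot_unitInterval ((contDiff_const.add
      (IsPlot.contDiff hp : ContDiff ℝ ∞ fun x => (p x : ℝ))).div_const 2)
      fun x => ⟨by linarith [(p x).2.1], by linarith [(p x).2.2]⟩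
  set κ := β.concat α hαβ with hκ
  have e1 := par_eq_transport κ α ⟨_, hl⟩ (fun t => by
    rw [hκ, PathClass.concat_left_half _ _ _ t.2.1 t.2.2, clamp_coe]) h
  have e2 := par_eq_transport κ β ⟨_, hr⟩ (fun t => by
    rw [hκ, PathClass.concat_right_half _ _ _ t.2.1 t.2.2, clamp_coe])
    ((proj_par h).trans hαβ)
  have a0 : (clamp (((0 : unitInterval) : ℝ) / 2) : unitInterval) = 0 := by
    rw [Set.Icc.coe_zero, zero_div, clamp_zero]
  have a1 : (clamp ((1 + ((0 : unitInterval) : ℝ)) / 2) : unitInterval) =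
      clamp (((1 : unitInterval) : ℝ) / 2) := by
    rw [Set.Icc.coe_zero, Set.Icc.coe_one, add_zero]
  have a2 : (clamp ((1 + ((1 : unitInterval) : ℝ)) / 2) : unitInterval) = 1 := by
    rw [Set.Icc.coe_one, show ((1 : ℝ) + 1) / 2 = 1 by norm_num, clamp_one]
  simp only [a0] at e1
  simp only [a1, a2] at e2
  rw [e2, e1, transport_trans]
  · rfl
  · rw [κ.line_pt, h]
    exact (SitPath.concat_zero β α hαβ).symm

/-- Transport depends only on the end points of a reparameterization and cancels a path against its
reverse. The induction is general in `ξ` because, inside a concatenation, it is used at a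
transported point. -/
theorem par_retraceStep {α β : SitPath B.X} (hs : RetraceStep α β) (ξ : B.E) :
    B.par α ξ = B.par β ξ := by
  induction hs generalizing ξ with
  | reparam α β f h0 h1 hf =>
    by_cases h : B.proj ξ = α 0
    · rw [par_eq_transport β α f hf h, h0, h1]
      rfl
    · rw [par_of_ne h, par_of_ne]
      rwa [hf, h0] at h
  | retrace β η α hβ hα =>
    by_cases h : B.proj ξ = α 0
    · rw [par_concat _ _ _ (by simpa using h), par_concat _ _ _ (by simpa using h),
        par_concat _ _ _ (by simpa using h), par_concat _ _ _ h,
        par_par_reverse _ ((proj_par h).trans hα)]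
    · rw [par_of_ne (by simpa using h), par_of_ne (by simpa using h)]
  | concat_left β α α' h h' hs ih =>
    by_cases hξ : B.proj ξ = α 0
    · rw [par_concat _ _ _ hξ, par_concat _ _ _ (hξ.trans hs.endpoints.1), ih]
    · rw [par_of_ne (by simpa using hξ), par_of_ne]
      simpa [← hs.endpoints.1] using hξ
  | concat_right β β' α h h' hs ih =>
    by_cases hξ : B.proj ξ = α 0
    · rw [par_concat _ _ _ hξ, par_concat _ _ _ hξ, ih]
    · rw [par_of_ne (by simpa using hξ), par_of_ne (by simpa using hξ)]

variable (B) in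
/-- Parallel transport along a path class. -/
def parClass : PathClass B.X → B.E → B.E :=
  Quot.lift B.par fun _ _ h => funext fun ξ => par_retraceStep h ξ

section parClass

variable {a b : PathClass B.X} {ξ : B.E} (h : B.proj ξ = a.src)

include h

theorem proj_parClass : B.proj (B.parClass a ξ) = a.tgt := by
  induction a using Quot.ind with | _ α => exact proj_par h

theorem parClass_act (g : G) : B.parClass a (B.act ξ g) = B.act (B.parClass a ξ) g := by
  induction a using Quot.ind with
  | _ α => exact transport_act (h.trans (α.line_pt 0).symm) _ g

theorem parClass_comp (hab : a.tgt = b.src) :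
    B.parClass (b.comp a) ξ = B.parClass b (B.parClass a ξ) := by
  induction a using Quot.ind with | _ α => ?_
  induction b using Quot.ind with | _ β => ?_
  exact (congrArg (B.parClass · ξ) (PathClass.comp_mk β α hab)).trans (par_concat β α hab h)

theorem parClass_map (F : B ⟶ C) :
    F.tot (B.parClass a ξ) = C.parClass (a.map F.base F.smooth_base) (F.tot ξ) := by
  induction a using Quot.ind with
  | _ α => exact transport_map (h.trans (α.line_pt 0).symm) F _

end parClass

/-- The bridge between transport along classes and transport along paths on open intervals. -/
theorem parClass_segClass (γ : LocalPath B.X) (s t : γ.dom) {ξ : B.E} (h : B.proj ξ = γ s) :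
    B.parClass (γ.segClass s t) ξ = B.transport γ s t ξ := by
  have e0 : SitPath.ofSmooth (γ.affine s t) 0 = s :=
    (SitPath.ofSmooth_zero _).trans (γ.affine_zero s t)
  have e1 : SitPath.ofSmooth (γ.affine s t) 1 = t :=
    (SitPath.ofSmooth_one _).trans (γ.affine_one s t)
  rw [γ.segClass_eq (SitPath.ofSmooth (γ.affine s t)) e0 e1]
  refine (par_map_line γ (SitPath.ofSmooth (γ.affine s t)) (by rw [e0, h])).trans ?_
  rw [e0, e1]

/-! ### Smoothness of transport -/

/-- The path `t ↦ p t` on the whole real line. -/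
def linePath {X : Type*} [DiffeologicalSpace X] (p : ℝ → X) (hp : DSmooth p) : LocalPath X :=
  ⟨Set.univ, isOpen_univ, Set.ordConnected_univ, fun s => p s, dSmooth_restrict hp⟩

/-- Smoothness in `r` is propagated along the time axis. Near a time `x` the family lifts to smooth
paths `Q r` in `E`; then `A_y (Q r)` is horizontal and smooth in `r`, and `L r` is its translate by
the smooth difference `ρ r` of `Q r` and `L r` at time `y`. -/
theorem dSmooth_horLift {n : ℕ} {p : EuclideanSpace ℝ (Fin n) → ℝ → B.X}
    (hp : DSmooth (fun q : EuclideanSpace ℝ (Fin n) × ℝ => p q.1 q.2)) (hp' : ∀ r, DSmooth (p r))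
    {L : EuclideanSpace ℝ (Fin n) → ℝ → B.E}
    (hL : ∀ r, B.HorLift (linePath (p r) (hp' r)) (fun s : (Set.univ : Set ℝ) => L r s))
    (h0 : DSmooth (fun r => L r 0)) (t : ℝ) : DSmooth (fun r => L r t) := by
  have hB := B.principal
  have hA := B.isConnection
  refine dSmooth_of_nhds (c := id) dSmooth_id fun r₀ => ?_
  -- The neighbourhood `V` may depend on `t`; this is harmless, since only a fixed final time is
  -- needed.
  let S : Set ℝ := {t | ∃ V : Set (EuclideanSpace ℝ (Fin n)), IsOpen V ∧ r₀ ∈ V ∧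
    DSmooth (fun r : V => L r t)}
  suffices hS : S = Set.univ by
    obtain ⟨V, hV, hr, hs⟩ : t ∈ S := hS ▸ Set.mem_univ t
    exact ⟨V, hV, hr, hs⟩
  refine eq_univ_of_locally ⟨0, Set.univ, isOpen_univ, trivial, dSmooth_restrict h0⟩ fun x => ?_
  obtain ⟨w, hwu, hwo, hw, q, hq, hqp⟩ := hB.liftsPlots_proj.exists_lift
    (isOpen_univ (X := EuclideanSpace ℝ (Fin n) × ℝ)) (dSmooth_restrict hp) ⟨(r₀, x), trivial⟩
  obtain ⟨V₀, W, hV₀, hW, hr, hx, hVW⟩ := isOpen_prod_iff.1 hwo r₀ x hw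
  obtain ⟨ε, hε, hb⟩ := Metric.isOpen_iff.1 hW x hx
  have hmem : ∀ (r : V₀) (s : Metric.ball x ε), ((r : EuclideanSpace ℝ (Fin n)), (s : ℝ)) ∈ w :=
    fun r s => hVW ⟨r.2, hb s.2⟩
  have hQ : DSmooth (fun z : V₀ × Metric.ball x ε => q ⟨(z.1, z.2), hmem z.1 z.2⟩) :=
    hq.comp (dSmooth_subtype_mk (P := fun z => z ∈ w) (dSmooth_prodMk
      (dSmooth_subtype_val.comp dSmooth_fst) (dSmooth_subtype_val.comp dSmooth_snd)) _)
  let Q : V₀ → LocalPath B.E := fun r => ⟨Metric.ball x ε, Metric.isOpen_ball,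
    (convex_ball _ _).ordConnected, fun s => q ⟨(r, s), hmem r s⟩,
    hQ.comp (dSmooth_prodMk dSmooth_const dSmooth_id)⟩
  have hQs : DSmooth Q := by
    refine LocalPath.dSmooth_of_eval (OpenDomains.of_const fun _ _ => rfl) ?_
    exact hQ.comp (dSmooth_prodMk (dSmooth_fst.comp dSmooth_subtype_val)
      (dSmooth_subtype_mk (P := fun s => s ∈ Metric.ball x ε)
        (dSmooth_snd.comp dSmooth_subtype_val) fun z => z.2))
  refine ⟨Metric.ball x ε, Metric.ball_mem_nhds x hε, fun y hy z hz => ?_⟩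
  rintro ⟨V₁, hV₁, hr₁, hs⟩
  refine ⟨V₀ ∩ V₁, hV₀.inter hV₁, ⟨hr, hr₁⟩, ?_⟩
  have i0 := dSmooth_inclusion (Set.inter_subset_left (s := V₀) (t := V₁))
  have i1 := dSmooth_inclusion (Set.inter_subset_right (s := V₀) (t := V₁))
  have hqL : ∀ (r : V₀) (s : Metric.ball x ε), B.proj (L r s) = B.proj (Q r s) := fun r s =>
    ((hL r).proj ⟨s, trivial⟩).trans (hqp ⟨(r, s), hmem r s⟩).symm
  obtain ⟨ρ, hρ, hρ'⟩ := hB.exists_diff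
    (f := fun r : ↑(V₀ ∩ V₁) => Q ⟨r, r.2.1⟩ ⟨y, hy⟩) (g := fun r : ↑(V₀ ∩ V₁) => L r y)
    (hQ.comp (dSmooth_prodMk i0 (dSmooth_const (y := (⟨y, hy⟩ : Metric.ball x ε)))))
    (hs.comp i1) fun r => (hqL ⟨r, r.2.1⟩ ⟨y, hy⟩).symm
  have hc : DSmooth (fun r : V₀ => B.conn (Q r) ⟨y, hy⟩ ⟨z, hz⟩) := by
    have h1 : DSmooth (fun r : V₀ => (⟨(Q r, y), hy⟩ : InitPath B.E)) :=
      dSmooth_subtype_mk (P := fun p : LocalPath B.E × ℝ => p.2 ∈ p.1.dom)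
        (dSmooth_prodMk hQs dSmooth_const) _
    exact LocalPath.dSmooth_eval.comp (dSmooth_subtype_mk
      (P := fun p : LocalPath B.E × ℝ => p.2 ∈ p.1.dom)
      (dSmooth_prodMk (hA.smooth.comp h1) (dSmooth_const (y := z))) fun r => hz)
  refine dSmooth_congr (hB.smooth_act.comp (dSmooth_prodMk (hc.comp i0) hρ)) fun r => ?_
  let r' : V₀ := ⟨r, r.2.1⟩
  have l1 := hA.horLift_act hB (hA.horLift_conn (Q r') hB.smooth_proj ⟨y, hy⟩) (ρ r)
  have l2 : B.HorLift ((Q r').map B.proj hB.smooth_proj) (fun s => L r s) :=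
    { smooth := (hL r).smooth.comp (dSmooth_inclusion (Set.subset_univ _))
      proj := fun s => hqL r' s
      hor := ⟨⟨y, hy⟩, fun s => (hA.conn_restrict ((linePath (p r) (hp' r)).withFun _ (hL r).smooth)
        Metric.isOpen_ball (convex_ball _ _).ordConnected (Set.subset_univ _) _ (fun _ => rfl)
        ⟨y, hy⟩ s).trans (hA.horLift_apply (hL r) _ _)⟩ }
  refine (congrFun (hA.horLift_unique hB l1 l2 (t := ⟨y, hy⟩) ?_) ⟨z, hz⟩).symm
  rw [hA.basepoint]
  exact (hρ' r).symm

theorem dSmooth_par {Z : Type*} [DiffeologicalSpace Z] {α : Z → SitPath B.X} {ξ : Z → B.E}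
    (hα : DSmooth α) (hξ : DSmooth ξ) (h : ∀ z, B.proj (ξ z) = α z 0) :
    DSmooth (fun z => B.par (α z) (ξ z)) := by
  intro n f hf
  -- The members of a plot need not be constant on a uniform neighbourhood of the end points, so
  -- their flattenings are extended to the line; there `bump` absorbs `clamp` and joint smoothness
  -- holds.
  have hs : DSmooth (fun q : EuclideanSpace ℝ (Fin n) × ℝ =>
      SitPath.ofSmooth (α (f q.1)).1 (clamp q.2)) := by
    refine dSmooth_congr (f := fun q : EuclideanSpace ℝ (Fin n) × ℝ =>
      (α (f q.1)).1 (clamp (SitPath.bump q.2))) ?_ fun q => ?_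
    · exact SmoothMap.dSmooth_eval.comp (dSmooth_prodMk
        (dSmooth_subtype_val.comp (hα.comp (hf.dSmooth.comp dSmooth_fst)))
        (dSmooth_clamp_bump dSmooth_snd))
    · change (α (f q.1)).1 (clamp (SitPath.bump (clamp q.2))) = _
      rw [SitPath.bump_clamp]
  have hs' : ∀ r, DSmooth (fun t => SitPath.ofSmooth (α (f r)).1 (clamp t)) := fun r =>
    SitPath.dSmooth_extend _
  have h' : ∀ r, B.proj (ξ (f r)) = SitPath.ofSmooth (α (f r)).1 0 := fun r =>
    (h (f r)).trans (SitPath.ofSmooth_zero _).symm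
  have hl : ∀ r, ∃ L : ℝ → B.E, B.HorLift (linePath _ (hs' r)) (fun s => L s) ∧
      L 0 = ξ (f r) ∧ L 1 = B.par (α (f r)) (ξ (f r)) := fun r => by
    obtain ⟨L, hL, hL0⟩ := exists_horLift (linePath _ (hs' r)) ⟨0, trivial⟩ (ξ := ξ (f r))
      ((h' r).trans (congrArg (SitPath.ofSmooth (α (f r)).1).1.toFun clamp_zero.symm))
    refine ⟨fun t => L ⟨t, trivial⟩, hL, hL0, ?_⟩
    rw [← par_ofSmooth _ (h (f r)), ← hL0]
    exact (transport_eq hL ⟨0, trivial⟩ ⟨1, trivial⟩).symm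
  choose L hL hL0 hL1 using hl
  have := dSmooth_horLift hs hs' hL (dSmooth_congr (hξ.comp hf.dSmooth) hL0) 1
  exact (dSmooth_congr this fun r => (hL1 r).symm).isPlot

theorem dSmooth_parClass {Z : Type*} [DiffeologicalSpace Z] {a : Z → PathClass B.X} {ξ : Z → B.E}
    (ha : DSmooth a) (hξ : DSmooth ξ) (h : ∀ z, B.proj (ξ z) = (a z).src) :
    DSmooth (fun z => B.parClass (a z) (ξ z)) := by
  refine dSmooth_of_locally fun n p hp r₀ => ?_
  obtain ⟨V, hV, hr, q, hq, hqp⟩ := PathClass.liftsPlots_mk n _ (ha n p hp) r₀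
  refine ⟨V, hV, hr, dSmooth_congr (dSmooth_par hq (hξ.comp (dSmooth_restrict hp.dSmooth))
    fun r => (h (p r)).trans (congrArg PathClass.src (hqp r)).symm) fun r => ?_⟩
  exact congrArg (B.parClass · (ξ (p r))) (hqp r).symm

end BundleObj

variable {G : Type u} [Group G] [DiffeologicalSpace G]

theorem SitPath.segClass_line {X : Type*} [DiffeologicalSpace X] (α : SitPath X) :
    α.line.segClass (α.pt 0) (α.pt 1) = PathClass.mk α := by
  rw [← PathClass.mk_ofSmooth]
  refine congrArg PathClass.mk (SitPath.ext' fun t => ?_)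
  have : ∀ s : unitInterval, α.line.segment (α.pt 0) (α.pt 1) s = α s := fun s => by
    refine Eq.trans ?_ (α.line_pt s)
    change α (clamp ((s : ℝ) * (1 : unitInterval) + (1 - (s : ℝ)) * (0 : unitInterval))) =
      α (clamp s)
    rw [Set.Icc.coe_one, Set.Icc.coe_zero, mul_one, mul_zero, add_zero]
  exact this _

/-! ### The holonomy representation and the comparison map -/

namespace BundleObj

variable (B C : BundleObj G)

theorem exists_parClass_eq (γ : LoopGroup B.ptX) :
    ∃ g, B.parClass γ.1 B.ptE = B.act B.ptE g :=
  B.principal.exists_act_eq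
    ((B.proj_pt.trans γ.2.2.symm).trans (proj_parClass (B.proj_pt.trans γ.2.1.symm)).symm)

/-- The element of the structure group by which transport along a loop moves the base point. -/
def holElt (γ : LoopGroup B.ptX) : G := (B.exists_parClass_eq γ).choose

theorem act_holElt (γ : LoopGroup B.ptX) :
    B.act B.ptE (B.holElt γ) = B.parClass γ.1 B.ptE := (B.exists_parClass_eq γ).choose_spec.symm

/-- The holonomy representation. -/
def hol : LoopGroup B.ptX →* G :=
  MonoidHom.mk' B.holElt fun γ δ => by
    -- In `γ ∨ δ` the loop `δ` is run first, and transport commutes with the right action: `T_γ (ξ₀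
    -- H(δ)) = ξ₀ H(γ) H(δ)`. So the order of factors is preserved.
    refine B.principal.act_injective (ξ := B.ptE) ?_
    rw [act_holElt, LoopGroup.coe_mul, parClass_comp (B.proj_pt.trans δ.2.1.symm)
      (δ.2.2.trans γ.2.1.symm), ← act_holElt, parClass_act (B.proj_pt.trans γ.2.1.symm),
      ← act_holElt, B.principal.act_mul]

theorem parClass_loop (γ : LoopGroup B.ptX) :
    B.parClass γ.1 B.ptE = B.act B.ptE (B.hol γ) := (B.act_holElt γ).symm

/-- `γ ↦ T_γ(ξ₀)` and the constant map `ξ₀` are smooth with the same projection, and `hol` is their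
difference. -/
theorem dSmooth_hol : DSmooth B.hol := by
  have hp : ∀ γ : LoopGroup B.ptX, B.proj B.ptE = γ.1.src := fun γ => B.proj_pt.trans γ.2.1.symm
  obtain ⟨ρ, hρ, h⟩ := B.principal.exists_diff
    (dSmooth_const (X := LoopGroup B.ptX) (y := B.ptE))
    (dSmooth_parClass (dSmooth_subtype_val (P := fun a : PathClass B.X => a.src = B.ptX ∧
      a.tgt = B.ptX)) (dSmooth_const (y := B.ptE)) hp)
    fun γ => (B.proj_pt.trans γ.2.2.symm).trans (proj_parClass (hp γ)).symm
  exact dSmooth_congr hρ fun γ => B.principal.act_injective ((B.parClass_loop γ).symm.trans (h γ))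

variable {B C} in
theorem hol_map (F : B ⟶ C) (γ : LoopGroup B.ptX) :
    C.hol (LoopGroup.map F.base F.smooth_base F.base_pt γ) = B.hol γ := by
  refine C.principal.act_injective (ξ := C.ptE) ?_
  rw [← parClass_loop, ← F.tot_pt, ← F.equivariant, ← parClass_loop,
    parClass_map (B.proj_pt.trans γ.2.1.symm)]
  rfl

theorem isHolonomy_hol : IsHolonomy B B.hol := by
  intro γ h0 h1 hγ0 hγ1
  constructor
  · obtain ⟨f, hf, h⟩ := exists_horLift γ ⟨0, h0⟩ (B.proj_pt.trans hγ0.symm)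
    exact ⟨f, hf.smooth, hf.proj, h, hf.hor⟩
  · intro f hf hp hf0 hh
    have hl : B.HorLift γ f := ⟨hf, hp, hh⟩
    rw [← parClass_loop, ← transport_eq hl ⟨0, h0⟩ ⟨1, h1⟩, hf0]
    exact (parClass_segClass γ ⟨0, h0⟩ ⟨1, h1⟩ (B.proj_pt.trans hγ0.symm)).symm

/-- The object of the holonomy category defined by a bundle with connection. -/
abbrev toHol : HolObj G where
  X := B.X
  pathConnected := B.pathConnected
  pt := B.ptX
  hol := B.hol
  smooth_hol := B.dSmooth_hol

/-- The comparison map `⟦[α], g⟧ ↦ T_α(ξ₀) g` from the bundle associated with the holonomy. -/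
def comparison : B.toHol.Assoc → B.E :=
  Quot.lift (fun p => B.act (B.parClass p.1.1 B.ptE) p.2) (by
    rintro p _ ⟨γ, rfl⟩
    change _ = B.act (B.parClass (p.1.1.comp γ.1) B.ptE) ((B.hol γ)⁻¹ * p.2)
    rw [parClass_comp (B.proj_pt.trans γ.2.1.symm) (γ.2.2.trans p.1.2.symm), parClass_loop,
      parClass_act (B.proj_pt.trans p.1.2.symm), ← B.principal.act_mul, mul_inv_cancel_left])

theorem dSmooth_parClass_pt :
    DSmooth (fun a : PointedPaths B.ptX => B.parClass a.1 B.ptE) :=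
  dSmooth_parClass dSmooth_subtype_val dSmooth_const fun a => B.proj_pt.trans a.2.symm

theorem dSmooth_comparison : DSmooth B.comparison :=
  dSmooth_of_comp_quotMk (R := B.toHol.AssocRel) (f := B.comparison)
    (B.principal.smooth_act.comp
      (dSmooth_prodMk (B.dSmooth_parClass_pt.comp dSmooth_fst) dSmooth_snd))

theorem proj_comparison (ξ : B.toHol.Assoc) :
    B.proj (B.comparison ξ) = B.toHol.assocProj ξ := by
  induction ξ using Quot.ind with
  | _ p =>
    exact (B.principal.proj_act _ _).trans (proj_parClass (B.proj_pt.trans p.1.2.symm))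

theorem comparison_act (ξ : B.toHol.Assoc) (g : G) :
    B.comparison (B.toHol.assocAct ξ g) = B.act (B.comparison ξ) g := by
  induction ξ using Quot.ind with | _ p => exact B.principal.act_mul _ _ _

theorem comparison_pt : B.comparison B.toHol.assocPt = B.ptE := by
  refine (B.principal.act_one _).trans ?_
  refine (B.parClass_loop 1).trans ?_
  rw [map_one, B.principal.act_one]

/-- Prolongation upstairs corresponds to transport in `E`; the compatibility with the connections
follows from this. -/
theorem comparison_push (b : PathClass B.X) (ξ : B.toHol.Assoc) (h : B.toHol.assocProj ξ = b.src) :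
    B.comparison (B.toHol.assocPush b ξ) = B.parClass b (B.comparison ξ) := by
  induction ξ using Quot.ind with
  | _ p =>
    have hp : B.proj B.ptE = p.1.1.src := B.proj_pt.trans p.1.2.symm
    refine (congrArg (B.act · p.2) (parClass_comp hp h)).trans ?_
    exact (parClass_act ((proj_parClass hp).trans h) p.2).symm

theorem comparison_conn (c : LocalPath B.toHol.Assoc) (r s : c.dom) :
    B.comparison (B.toHol.assocConn c r s) =
      B.conn (c.map B.comparison B.dSmooth_comparison) r s := by
  have h := HolObj.proj_eq_src c r s
  rw [HolObj.assocConn_eq, comparison_push _ _ _ h,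
    parClass_segClass (HolObj.basePath c) r s (B.proj_comparison (c r)), ← transport_conn]
  have key : ∀ (f g : c.dom → B.X) (hf : DSmooth f) (hg : DSmooth g), f = g → ∀ ξ,
      B.transport (c.withFun f hf) r s ξ = B.transport (c.withFun g hg) r s ξ := by
    rintro f _ _ _ rfl _
    rfl
  exact key _ _ _ _ (funext fun t => (B.proj_comparison (c t)).symm) _

/-- Injectivity needs transitivity on the fibres of the source and freeness on the target;
surjectivity needs path-connectedness of the base and transitivity on the fibres of the target. -/
theorem bijective_comparison : Function.Bijective B.comparison := by
  constructor
  · intro ξ η h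
    have hp : B.toHol.assocProj ξ = B.toHol.assocProj η := by
      rw [← proj_comparison, h, proj_comparison]
    obtain ⟨g, rfl⟩ := B.toHol.exists_assocAct_eq ξ η hp
    rw [comparison_act] at h
    have : g = 1 := B.principal.act_injective (h.symm.trans (B.principal.act_one _).symm)
    subst this
    induction ξ using Quot.ind with
    | _ p => exact congrArg (Quot.mk _) (Prod.ext rfl (mul_one _).symm)
  · intro ξ
    obtain ⟨a, ha⟩ := PointedPaths.exists_tgt_eq B.pathConnected B.ptX (B.proj ξ)
    obtain ⟨g, hg⟩ := B.principal.exists_act_eq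
      ((proj_parClass (B.proj_pt.trans a.2.symm)).trans ha)
    exact ⟨Quot.mk _ (a, g), hg.symm⟩

/-- The comparison map as a bijection. -/
def comparisonEquiv : B.toHol.Assoc ≃ B.E := Equiv.ofBijective _ B.bijective_comparison

/-- The projection of a plot of `E` lifts locally to path classes `q`. The plot is then `T_q(ξ₀) ρ`
with `ρ` smooth, so its preimage is `⟦q, ρ⟧`. -/
theorem dSmooth_comparisonEquiv_symm : DSmooth B.comparisonEquiv.symm := by
  refine dSmooth_of_locally fun n p hp r₀ => ?_
  obtain ⟨V, hV, hr, q, hq, hqp⟩ := PointedPaths.liftsPlots_tgt B.pathConnected B.ptX n _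
    (B.principal.smooth_proj n p hp) r₀
  obtain ⟨ρ, hρ, h⟩ := B.principal.exists_diff (B.dSmooth_parClass_pt.comp hq)
    (dSmooth_restrict (S := V) hp.dSmooth)
    fun r => (proj_parClass (B.proj_pt.trans (q r).2.symm)).trans (hqp r)
  refine ⟨V, hV, hr, dSmooth_congr ((dSmooth_quotMk B.toHol.AssocRel).comp
    (dSmooth_prodMk hq hρ)) fun r => ?_⟩
  exact (Equiv.symm_apply_eq _).2 (h r)

/-- A bundle morphism with smooth inverses is an isomorphism. -/
def isoOfEquiv {B C : BundleObj G} (F : B ⟶ C) (e : B.E ≃ C.E) (he : ∀ ξ, F.tot ξ = e ξ)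
    (hs : DSmooth e.symm) (f : B.X ≃ C.X) (hf : ∀ x, F.base x = f x) (hfs : DSmooth f.symm) :
    B ≅ C where
  hom := F
  inv :=
    { tot := e.symm
      base := f.symm
      smooth_tot := hs
      smooth_base := hfs
      comm := fun ξ => f.injective (by
        rw [f.apply_symm_apply, ← hf, ← F.comm, he, e.apply_symm_apply])
      equivariant := fun ξ g => e.injective (by
        rw [e.apply_symm_apply, ← he, F.equivariant, he, e.apply_symm_apply])
      tot_pt := e.injective (by rw [e.apply_symm_apply, ← he, F.tot_pt])
      base_pt := f.injective (by rw [f.apply_symm_apply, ← hf, F.base_pt])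
      map_conn := fun α t s => e.injective (by
        rw [e.apply_symm_apply, ← he, F.map_conn]
        have key : ∀ (g : α.dom → C.E) (hg : DSmooth g), g = α.toFun →
            C.conn α t s = C.conn (α.withFun g hg) t s := by
          rintro g _ rfl
          rfl
        exact key _ _ (funext fun r => (he _).trans (e.apply_symm_apply _))) }
  hom_inv_id := BundleHom.ext
    (funext fun ξ => (congrArg e.symm (he ξ)).trans (e.symm_apply_apply ξ))
    (funext fun x => (congrArg f.symm (hf x)).trans (f.symm_apply_apply x))
  inv_hom_id := BundleHom.ext (funext fun ξ => (he _).trans (e.apply_symm_apply ξ))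
    (funext fun x => (hf _).trans (f.apply_symm_apply x))

end BundleObj

/-! ### The equivalence -/

variable [DiffeologicalGroup G]

variable (G) in
/-- The functor that sends a holonomy map to its associated bundle with connection. -/
abbrev assoc : HolObj G ⥤ BundleObj G :=
  assocFunctor (fun P => P.isPrincipalBundle_assoc) (fun P => P.isConnection_assoc)

variable (G) in
/-- The functor that sends a bundle with connection to its holonomy. -/
abbrev holonomy : BundleObj G ⥤ HolObj G :=
  holFunctor BundleObj.hol BundleObj.dSmooth_hol BundleObj.hol_map

/-- A horizontal lift equals its own image under `Θ^H` from time `0`, that is, its value at time `0`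
prolonged along the base path. -/
theorem parClass_assoc (P : HolObj G) (a : PathClass P.X) (ξ : P.Assoc)
    (h : P.assocProj ξ = a.src) : ((assoc G).obj P).parClass a ξ = P.assocPush a ξ := by
  induction a using Quot.ind with | _ α => ?_
  obtain ⟨f, hf, rfl⟩ := BundleObj.exists_horLift (B := (assoc G).obj P) α.line (α.pt 0) (ξ := ξ)
    (h.trans (α.line_pt 0).symm)
  refine (BundleObj.transport_eq hf _ _).trans ?_
  refine (((assoc G).obj P).isConnection.horLift_apply hf (α.pt 0) (α.pt 1)).symm.trans ?_
  refine congrArg (fun b => P.assocPush b _) ?_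
  exact (LocalPath.segClass_congr (β := α.line) (hg := α.line.smooth) _ _ hf.proj).trans
    α.segClass_line

/-- Transport moves the base point to `⟦[γ], e⟧`, and the defining relation identifies this with
`⟦[x₀], H([γ])⟧`. -/
theorem hol_assoc (P : HolObj G) (γ : LoopGroup P.pt) :
    ((assoc G).obj P).hol γ = P.hol γ := by
  refine ((assoc G).obj P).principal.act_injective (ξ := P.assocPt) ?_
  refine (((assoc G).obj P).parClass_loop γ).symm.trans ?_
  refine (parClass_assoc P γ.1 P.assocPt γ.2.1.symm).trans (Eq.symm (Quot.sound ⟨γ, ?_⟩))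
  refine Prod.ext (Subtype.ext ?_) (by simp)
  exact (PathClass.comp_const _ _ γ.2.1).trans (PathClass.const_comp _ _ γ.2.2).symm

variable (G) in
/-- Every holonomy map is the holonomy of its associated bundle. -/
def unitIso : 𝟭 (HolObj G) ≅ assoc G ⋙ holonomy G :=
  NatIso.ofComponents (fun P =>
    { hom :=
        { map := id
          smooth := dSmooth_id
          map_pt := rfl
          map_hol := fun γ => (congrArg ((assoc G).obj P).hol
            (Subtype.ext (PathClass.map_id dSmooth_id γ.1))).trans (hol_assoc P γ) }
      inv :=
        { map := id
          smooth := dSmooth_id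
          map_pt := rfl
          map_hol := fun γ => (congrArg P.hol
            (Subtype.ext (PathClass.map_id dSmooth_id γ.1))).trans (hol_assoc P γ).symm }
      hom_inv_id := rfl
      inv_hom_id := rfl }) fun _ => rfl

variable (G) in
/-- Every bundle with connection is associated with its holonomy. -/
def counitIso : holonomy G ⋙ assoc G ≅ 𝟭 (BundleObj G) :=
  NatIso.ofComponents (fun B => BundleObj.isoOfEquiv (B := (holonomy G ⋙ assoc G).obj B) (C := B)
    { tot := B.comparison
      base := id
      smooth_tot := B.dSmooth_comparison
      smooth_base := dSmooth_id
      comm := B.proj_comparison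
      equivariant := B.comparison_act
      tot_pt := B.comparison_pt
      base_pt := rfl
      map_conn := B.comparison_conn }
    B.comparisonEquiv (fun _ => rfl) B.dSmooth_comparisonEquiv_symm (Equiv.refl _) (fun _ => rfl)
    dSmooth_id) fun {B C} F => BundleHom.ext (funext fun ξ => by
      induction ξ using Quot.ind with
      | _ p =>
        -- Naturality: `F` takes `T_α(ξ₀)` to the transport of `F ξ₀ = ξ₀'` along `f ∘ α`.
        have hp : B.proj B.ptE = p.1.1.src := B.proj_pt.trans p.1.2.symm
        refine Eq.trans ?_ (F.equivariant (B.parClass p.1.1 B.ptE) p.2).symm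
        exact congrArg (C.act · p.2)
          (((BundleObj.parClass_map hp F).trans (congrArg _ F.tot_pt)).symm)) rfl

end DiffHol

end

theorem mainTheorem1 (G : Type u) [Group G] [DiffeologicalSpace G] [DiffeologicalGroup G] :
    ∃ (hP : ∀ P : HolObj G, IsPrincipalBundle P.assocAct P.assocProj)
      (hA : ∀ P : HolObj G, IsConnection P.assocAct P.assocProj P.assocConn)
      (H : ∀ B : BundleObj G, LoopGroup B.ptX →* G)
      (hs : ∀ B : BundleObj G, DSmooth (H B))
      (hm : ∀ {B C : BundleObj G} (F : B ⟶ C) (γ : LoopGroup B.ptX),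
        H C (LoopGroup.map F.base F.smooth_base F.base_pt γ) = H B γ),
      (∀ B : BundleObj G, IsHolonomy B (H B)) ∧
      ∃ e : HolObj G ≌ BundleObj G,
        e.functor = assocFunctor hP hA ∧ e.inverse = holFunctor H hs hm :=
  ⟨fun P => P.isPrincipalBundle_assoc, fun P => P.isConnection_assoc, BundleObj.hol,
    BundleObj.dSmooth_hol, BundleObj.hol_map, BundleObj.isHolonomy_hol,
    -- Only the unit is adjusted to obtain the triangle identity; the two functors stay as given.
    CategoryTheory.Equivalence.mk (assoc G) (holonomy G) (unitIso G) (counitIso G), rfl, rfl⟩
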